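/- **Notation.** For a partition $\mu=(\mu_1\ge\dots\ge\mu_{l(\mu)}>0)$ put $|\mu|=\sum_i\mu_i$, $\kappa_\mu=|\mu|+\sum_i(\mu_i^2-2i\mu_i)$, $z_\mu=\prod_j m_j(\mu)!\,j^{m_j(\mu)}$ where $m_j(\mu)$ is the number of parts equal to $j$, and $p_\mu=p_{\mu_1}\cdots p_{\mu_{l(\mu)}}$ in formal variables $p=(p_1,p_2,\dots)$. For a box $e$ of the Young diagram of $\mu$, $h(e)$ is its hook length. For $|\nu|=|\mu|=d$, $\chi_\nu(\mu)$ is the value of the irreducible character of $S_d$ indexed by $\nu$ on the class of permutations of cycle type $\mu$. Let $$V_\nu(\lambda)=\prod_{1\le a<b\le l(\nu)}\frac{\sin[(\nu_a-\nu_b+b-a)\lambda/2]}{\sin[(b-a)\lambda/2]}\cdot\frac{1}{\prod_{i=1}^{l(\nu)}\prod_{v=1}^{\nu_i}2\sin[(v-i+l(\nu))\lambda/2]},$$ $$W_\mu(\lambda;\tau)=\sum_{|\nu|=|\mu|}\frac{\chi_\nu(\mu)}{z_\mu}\,e^{\sqrt{-1}(\tau+\frac12)\kappa_\nu\lambda/2}\,V_\nu(\lambda),$$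 $$R(\lambda;\tau;p)^\bullet=\sum_{|\mu|\ge0}W_\mu(\lambda;\tau)\,p_\mu,\qquad R(\lambda;\tau;p)=\sum_{n\ge1}\frac{(-1)^{n-1}}{n}\sum_\mu\Big(\sum_{\mu^1\cup\dots\cup\mu^n=\mu}\ \prod_{i=1}^nW_{\mu^i}(\lambda;\tau)\Big)p_\mu,$$ where the inner sum is over ordered $n$-tuples of nonempty partitions whose union (as multisets of parts) is $\mu$. **Theorem.** Let $\lambda\in\mathbb C$ be such that $\sin(k\lambda/2)\ne0$ for every integer $k\ge1$. Then: 1. The series in the logarithm below has constant term $1$, and as formal power series in $p_1,p_2,\dots$ with complex coefficients $$\log\Bigg(\sum_{n\ge0}\ \sum_{|\rho|=|\eta|=n}\frac{e^{\frac14\kappa_\rho\sqrt{-1}\lambda}}{\prod_{e\in\rho}2\sin(h(e)\lambda/2)}\,\frac{\chi_\rho(\eta)}{z_\eta}\,p_\eta\Bigg)=-\sum_{d\ge1}\frac{\sqrt{-1}^{\,d+1}p_d}{2d\sin(d\lambda/2)}.$$ 2. For every partition $\mu$, $$V_\mu(\lambda)=\frac{1}{2^{|\mu|}\prod_{x\in\mu}\sin(h(x)\lambda/2)}.$$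 3. $R(\lambda;0;p)^\bullet$ has constant term $1$, and $$R(\lambda;0;p)=\log R(\lambda;0;p)^\bullet=-\sum_{d\ge1}\frac{\sqrt{-1}^{\,d+1}p_d}{2d\sin(d\lambda/2)}.$$ -/

import Mathlib

open scoped MvPowerSeries.WithPiTopology

noncomputable section

namespace MarinoVafa

/-! ### Partitions, Young diagrams, hook lengths -/

/-- A partition of an arbitrary natural number: `μ.1` is its size `|μ|`, `μ.2.parts` the multiset
of its (positive) parts. -/
abbrev Ptn : Type := Σ n : ℕ, n.Partition

/-- The Young diagram of a partition: its boxes are the `(i, j)` with `j < μ_{i+1}`. -/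
def diagram {n : ℕ} (ρ : n.Partition) : YoungDiagram :=
  YoungDiagram.ofRowLens (ρ.parts.sort (· ≥ ·))
    (List.sortedGE_iff_pairwise.mpr (Multiset.pairwise_sort ρ.parts (· ≥ ·)))

theorem card_cellsOfRowLens (w : List ℕ) :
    (YoungDiagram.cellsOfRowLens w).card = w.sum := by
  induction w with
  | nil => rfl
  | cons a w ih =>
    rw [YoungDiagram.cellsOfRowLens, Finset.card_union_of_disjoint]
    · simp [ih]
    · rw [Finset.disjoint_left]
      rintro ⟨i, j⟩ h1 h2
      simp only [Finset.mem_product, Finset.mem_singleton, Finset.mem_map] at h1 h2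
      obtain ⟨⟨a, b⟩, -, h⟩ := h2
      have := congrArg Prod.fst h
      simp at this
      omega

theorem card_cells_diagram {n : ℕ} (ρ : n.Partition) : (diagram ρ).cells.card = n := by
  have h : (diagram ρ).cells = YoungDiagram.cellsOfRowLens (ρ.parts.sort (· ≥ ·)) := rfl
  rw [h, card_cellsOfRowLens, ← Multiset.sum_coe, Multiset.sort_eq, ρ.parts_sum]

/-- The part `μ_i` for `i = 1, 2, …` (it is `0` for `i > l(μ)`). -/
def part {n : ℕ} (μ : n.Partition) (i : ℕ) : ℕ := (diagram μ).rowLen (i - 1)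

/-- The number of parts `l(μ)`. -/
def len {n : ℕ} (μ : n.Partition) : ℕ := μ.parts.card

/-- The hook length of a box: arm length plus leg length plus one. -/
def hook (Y : YoungDiagram) (c : ℕ × ℕ) : ℕ :=
  (Y.rowLen c.1 - (c.2 + 1)) + (Y.colLen c.2 - (c.1 + 1)) + 1

/-- `κ_μ = |μ| + ∑_i (μ_i² - 2 i μ_i)`. -/
def kappa {n : ℕ} (μ : n.Partition) : ℤ :=
  n + ∑ i ∈ Finset.Icc 1 (len μ), ((part μ i : ℤ) ^ 2 - 2 * i * part μ i)

/-- `z_μ = ∏_j m_j(μ)! j^{m_j(μ)}`. -/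
def zee {n : ℕ} (μ : n.Partition) : ℕ :=
  ∏ j ∈ μ.parts.toFinset, (μ.parts.count j).factorial * j ^ μ.parts.count j

/-! ### Irreducible characters of the symmetric groups -/

/-- The symmetric group on the boxes of a Young diagram. -/
abbrev BoxPerm (Y : YoungDiagram) : Type := Equiv.Perm {c : ℕ × ℕ // c ∈ Y.cells}

open Classical in
/-- `a = ∑ σ`, over the permutations of the boxes that preserve every row. -/
def rowSymmetrizer (Y : YoungDiagram) : MonoidAlgebra ℂ (BoxPerm Y) :=
  ∑ σ : BoxPerm Y with ∀ c, (σ c).1.1 = c.1.1, MonoidAlgebra.single σ 1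

open Classical in
/-- `b = ∑ sgn(σ) σ`, over the permutations of the boxes that preserve every column. -/
def colAntisymmetrizer (Y : YoungDiagram) : MonoidAlgebra ℂ (BoxPerm Y) :=
  ∑ σ : BoxPerm Y with ∀ c, (σ c).1.2 = c.1.2,
    MonoidAlgebra.single σ (((Equiv.Perm.sign σ : ℤˣ) : ℤ) : ℂ)

/-- The Young symmetrizer `a b`. -/
def youngSymmetrizer (Y : YoungDiagram) : MonoidAlgebra ℂ (BoxPerm Y) :=
  rowSymmetrizer Y * colAntisymmetrizer Y

/-- The left ideal of the group algebra generated by the Young symmetrizer (the Specht module). -/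
def spechtModule (Y : YoungDiagram) : Submodule ℂ (MonoidAlgebra ℂ (BoxPerm Y)) :=
  LinearMap.range (LinearMap.mulRight ℂ (youngSymmetrizer Y))

/-- The irreducible representation indexed by a Young diagram: the symmetric group acts on the
Specht module by left multiplication.  One row gives the trivial, one column the sign
representation. -/
def spechtRep (Y : YoungDiagram) : Representation ℂ (BoxPerm Y) (spechtModule Y) where
  toFun g := (LinearMap.mulLeft ℂ (MonoidAlgebra.single g (1 : ℂ))).restrict (by
    rintro _ ⟨x, rfl⟩
    exact ⟨MonoidAlgebra.single g 1 * x, by simp [mul_assoc]⟩)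
  map_one' := by
    ext x : 2
    simp [← MonoidAlgebra.one_def]
  map_mul' g h := by
    ext x : 2
    simp [← mul_assoc, MonoidAlgebra.single_mul_single]

theorem exists_cycleType {n : ℕ} (ρ η : n.Partition) :
    ∃ σ : BoxPerm (diagram ρ), σ.partition.parts = η.parts := by
  classical
  have hc : Fintype.card {c : ℕ × ℕ // c ∈ (diagram ρ).cells} = n := by
    rw [Fintype.card_coe, card_cells_diagram]
  have hsplit : η.parts.filter (2 ≤ ·) + Multiset.replicate (η.parts.count 1) 1 = η.parts := by
    rw [← Multiset.filter_eq' η.parts 1]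
    conv_rhs => rw [← Multiset.filter_add_not (2 ≤ ·) η.parts]
    congr 1
    refine Multiset.filter_congr fun x hx => ?_
    have := η.parts_pos hx
    omega
  have hsum : (η.parts.filter (2 ≤ ·)).sum + η.parts.count 1 = n := by
    have := congrArg Multiset.sum hsplit
    simpa [η.parts_sum] using this
  obtain ⟨σ, hσ⟩ := (Equiv.Perm.exists_with_cycleType_iff
    {c : ℕ × ℕ // c ∈ (diagram ρ).cells} (m := η.parts.filter (2 ≤ ·))).mpr
    ⟨by rw [hc]; omega, fun a ha => (Multiset.mem_filter.mp ha).2⟩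
  refine ⟨σ, ?_⟩
  rw [Equiv.Perm.parts_partition, ← Equiv.Perm.sum_cycleType, hσ, hc]
  conv_rhs => rw [← hsplit]
  congr 2
  omega

/-- `χ_ρ(η)`: the value of the irreducible character `χ_ρ` on the conjugacy class `C(η)`, evaluated
at a chosen permutation of cycle type `η` (see `chi_eq` for independence of the choice). -/
def chi {n : ℕ} (ρ η : n.Partition) : ℂ :=
  (spechtRep (diagram ρ)).character (Classical.choose (exists_cycleType ρ η))

theorem chi_eq {n : ℕ} (ρ η : n.Partition) (σ : BoxPerm (diagram ρ))
    (hσ : σ.partition.parts = η.parts) : (spechtRep (diagram ρ)).character σ = chi ρ η := by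
  have h : IsConj (Classical.choose (exists_cycleType ρ η)) σ := by
    rw [Equiv.Perm.partition_eq_of_isConj]
    apply Nat.Partition.ext
    rw [hσ]
    exact Classical.choose_spec (exists_cycleType ρ η)
  obtain ⟨g, hg⟩ := isConj_iff.mp h
  rw [← hg, chi, Representation.char_conj]

/-! ### Power series in `p_1, p_2, …` -/

/-- `p_μ = p_{μ_1} ⋯ p_{μ_l}`. -/
def pMon (μ : Ptn) : MvPowerSeries ℕ+ ℂ :=
  (μ.2.parts.map fun j => MvPowerSeries.X (Nat.toPNat' j)).prod

/-- `∑_μ a_μ p_μ`, over all partitions `μ` including the empty one, as a formal power series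
(see `hasSum_partitionSeries`, `coeff_partitionSeries`). -/
def partitionSeries (a : Ptn → ℂ) : MvPowerSeries ℕ+ ℂ :=
  ∑' μ : Ptn, MvPowerSeries.C (a μ) * pMon μ

/-- The partition `μ` with `p_μ = ∏ p_i ^ m i`. -/
def ofExponent (m : ℕ+ →₀ ℕ) : Ptn :=
  ⟨_, Nat.Partition.ofMultiset ((Finsupp.toMultiset m).map fun i : ℕ+ => (i : ℕ))⟩

theorem Ptn.ext' {μ ν : Ptn} (h : μ.2.parts = ν.2.parts) : μ = ν := by
  obtain ⟨n, μ⟩ := μ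
  obtain ⟨k, ν⟩ := ν
  have : n = k := by rw [← μ.parts_sum, ← ν.parts_sum]; exact congrArg _ h
  subst this
  exact congrArg _ (Nat.Partition.ext h)

theorem parts_ofExponent (m : ℕ+ →₀ ℕ) :
    (ofExponent m).2.parts = (Finsupp.toMultiset m).map fun i : ℕ+ => (i : ℕ) := by
  simp only [ofExponent, Nat.Partition.ofMultiset_parts]
  rw [Multiset.filter_eq_self]
  intro a ha
  obtain ⟨i, -, rfl⟩ := Multiset.mem_map.mp ha
  exact i.ne_zero

theorem prod_X (s : Multiset ℕ+) :
    (s.map fun i => (MvPowerSeries.X i : MvPowerSeries ℕ+ ℂ)).prod =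
      MvPowerSeries.monomial (Multiset.toFinsupp s) 1 := by
  induction s using Multiset.induction_on with
  | empty => simp
  | cons a s ih =>
    rw [Multiset.map_cons, Multiset.prod_cons, ih, MvPowerSeries.X,
      MvPowerSeries.monomial_mul_monomial, ← Multiset.singleton_add, map_add]
    simp

theorem pMon_eq (μ : Ptn) : pMon μ =
    MvPowerSeries.monomial (Multiset.toFinsupp (μ.2.parts.map Nat.toPNat')) 1 := by
  rw [← prod_X, Multiset.map_map]
  rfl

theorem eq_exponent_iff (m : ℕ+ →₀ ℕ) (μ : Ptn) :
    m = Multiset.toFinsupp (μ.2.parts.map Nat.toPNat') ↔ μ = ofExponent m := by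
  constructor
  · rintro rfl
    apply Ptn.ext'
    rw [parts_ofExponent, Multiset.toFinsupp_toMultiset, Multiset.map_map]
    conv_lhs => rw [← Multiset.map_id μ.2.parts]
    refine Multiset.map_congr rfl fun x hx => ?_
    have := μ.2.parts_pos hx
    simp only [id, Function.comp_apply, Nat.toPNat'_coe, if_pos this]
  · rintro rfl
    rw [parts_ofExponent, Multiset.map_map]
    have : (Nat.toPNat' ∘ fun i : ℕ+ => (i : ℕ)) = id := by
      funext i
      simp
    rw [this, Multiset.map_id, Finsupp.toMultiset_toFinsupp]

/-- The power series in which `p_μ` has coefficient `a μ`. -/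
def coeffSeries (a : Ptn → ℂ) : MvPowerSeries ℕ+ ℂ := fun m => a (ofExponent m)

theorem hasSum_aux (a : Ptn → ℂ) :
    HasSum (fun μ : Ptn => MvPowerSeries.C (a μ) * pMon μ)
      (coeffSeries a) := by
  classical
  rw [MvPowerSeries.WithPiTopology.hasSum_iff_hasSum_coeff]
  intro m
  have h : MvPowerSeries.coeff m (coeffSeries a) =
      MvPowerSeries.coeff m (MvPowerSeries.C (a (ofExponent m)) * pMon (ofExponent m)) := by
    rw [MvPowerSeries.coeff_C_mul, pMon_eq, MvPowerSeries.coeff_monomial,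
      if_pos ((eq_exponent_iff m _).mpr rfl), mul_one]
    rfl
  rw [h]
  refine hasSum_single (ofExponent m) fun μ hμ => ?_
  rw [MvPowerSeries.coeff_C_mul, pMon_eq, MvPowerSeries.coeff_monomial,
    if_neg (fun hm => hμ ((eq_exponent_iff m μ).mp hm)), mul_zero]

theorem hasSum_partitionSeries (a : Ptn → ℂ) :
    HasSum (fun μ : Ptn => MvPowerSeries.C (a μ) * pMon μ) (partitionSeries a) :=
  (hasSum_aux a).summable.hasSum

theorem coeff_partitionSeries (a : Ptn → ℂ) (m : ℕ+ →₀ ℕ) :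
    MvPowerSeries.coeff m (partitionSeries a) = a (ofExponent m) := by
  rw [partitionSeries, (hasSum_aux a).tsum_eq]
  rfl

/-- The formal logarithm `log f = ∑_{k ≥ 1} (-1)^{k-1} (f - 1)^k / k` of a power series `f` with
constant coefficient `1`. -/
def formalLog (f : MvPowerSeries ℕ+ ℂ) : MvPowerSeries ℕ+ ℂ :=
  PowerSeries.subst (f - 1) (PowerSeries.log ℂ)

/-! ### The generating series -/

open Complex (I exp sin)

/-- `∑_{n ≥ 0} ∑_{|ρ| = |η| = n} e^{κ_ρ √-1 λ/4} / ∏_{e ∈ ρ} 2 sin(h(e) λ/2) · χ_ρ(η)/z_η · p_η`. -/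
def hookSeries (lam : ℂ) : MvPowerSeries ℕ+ ℂ :=
  partitionSeries fun η => ∑ ρ : η.1.Partition,
    exp (kappa ρ * I * lam / 4) / (∏ e ∈ (diagram ρ).cells, 2 * sin (hook (diagram ρ) e * lam / 2))
      * (chi ρ η.2 / zee η.2)

/-- `V_ν(λ)`. -/
def V {n : ℕ} (ν : n.Partition) (lam : ℂ) : ℂ :=
  (∏ b ∈ Finset.Icc 1 (len ν), ∏ a ∈ Finset.Ico 1 b,
      sin (((part ν a : ℂ) - part ν b + b - a) * lam / 2) / sin (((b : ℂ) - a) * lam / 2)) *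
    (1 / ∏ i ∈ Finset.Icc 1 (len ν), ∏ v ∈ Finset.Icc 1 (part ν i),
      2 * sin (((v : ℂ) - i + len ν) * lam / 2))

/-- `∑_{|ν| = |μ|} χ_ν(C(μ))/z_μ · e^{√-1 (τ + 1/2) κ_ν λ/2} V_ν(λ)`. -/
def weight (lam τ : ℂ) (μ : Ptn) : ℂ :=
  ∑ ν : μ.1.Partition,
    chi ν μ.2 / zee μ.2 * exp (I * (τ + 1 / 2) * kappa ν * lam / 2) * V ν lam

/-- `R(λ; τ; p)^•`. -/
def Rbullet (lam τ : ℂ) : MvPowerSeries ℕ+ ℂ := partitionSeries (weight lam τ)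

/-- The `n`-tuples `(μ^1, …, μ^n)` of nonempty partitions with `μ^1 ∪ ⋯ ∪ μ^n = μ`. -/
def splittings (n : ℕ) (μ : Ptn) : Set (Fin n → Ptn) :=
  {t | (∀ i, 0 < (t i).1) ∧ ∑ i, (t i).2.parts = μ.2.parts}

theorem splittings_finite (n : ℕ) (μ : Ptn) : (splittings n μ).Finite := by
  have hinj : Function.Injective (fun (t : Fin n → Ptn) i => (t i).2.parts) := by
    intro s t h
    funext i
    exact Ptn.ext' (congrFun h i)
  refine Set.Finite.of_finite_image (f := fun (t : Fin n → Ptn) i => (t i).2.parts)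
    (Set.Finite.subset (Set.Finite.pi' (ι := Fin n) (t := fun _ => Set.Iic μ.2.parts)
      fun _ => ?_) ?_) hinj.injOn
  · exact Set.finite_Iic _
  · rintro _ ⟨t, ht, rfl⟩ i
    rw [Set.mem_Iic, ← ht.2]
    exact Finset.single_le_sum (f := fun i => (t i).2.parts) (fun _ _ => Multiset.zero_le _)
      (Finset.mem_univ i)

theorem splittings_empty {n : ℕ} {μ : Ptn} (h : μ.1 < n) : splittings n μ = ∅ := by
  rw [Set.eq_empty_iff_forall_notMem]
  rintro t ⟨h0, ht⟩
  have h1 : ∑ i, (t i).1 = μ.1 := by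
    have h2 := congrArg Multiset.sumAddMonoidHom ht
    rw [map_sum] at h2
    simpa [Multiset.coe_sumAddMonoidHom, Nat.Partition.parts_sum] using h2
  have h3 : ∑ _i : Fin n, 1 ≤ ∑ i, (t i).1 := Finset.sum_le_sum fun i _ => h0 i
  simp at h3
  omega

/-- The `n`-th term of the series defining `R(λ; τ; p)`. -/
def Rterm (lam τ : ℂ) (n : ℕ+) : MvPowerSeries ℕ+ ℂ :=
  MvPowerSeries.C ((-1 : ℂ) ^ ((n : ℕ) - 1) / n) *
    partitionSeries fun μ => ∑ᶠ t ∈ splittings n μ, ∏ i, weight lam τ (t i)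

/-- `R(λ; τ; p)
= ∑_{n ≥ 1} (-1)^{n-1}/n ∑_μ (∑_{μ^1 ∪ ⋯ ∪ μ^n = μ} ∏_i ∑_{|ν^i| = |μ^i|} ⋯) p_μ`. -/
def R (lam τ : ℂ) : MvPowerSeries ℕ+ ℂ := ∑' n : ℕ+, Rterm lam τ n

theorem summable_Rterm (lam τ : ℂ) : Summable (Rterm lam τ) := by
  rw [MvPowerSeries.WithPiTopology.summable_iff_summable_coeff]
  intro m
  refine summable_of_hasFiniteSupport ?_
  refine (Set.finite_Iic (Nat.toPNat' ((ofExponent m).1 + 1))).subset fun n hn => ?_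
  by_contra hlt
  apply hn
  have h : (ofExponent m).1 < (n : ℕ) := by
    rw [Set.mem_Iic, not_le, ← PNat.coe_lt_coe] at hlt
    simp at hlt
    omega
  simp [Rterm, MvPowerSeries.coeff_C_mul, coeff_partitionSeries, splittings_empty h]

end MarinoVafa

end

open scoped MvPowerSeries.WithPiTopology

noncomputable section

namespace MarinoVafa

/-! ### The cycle index -/

/-- The centralizer order `z` as a function of the multiset of parts. -/
def centralizerOrder (s : Multiset ℕ) : ℕ :=
  ∏ j ∈ s.toFinset, (s.count j).factorial * j ^ s.count j

theorem zee_eq {n : ℕ} (μ : n.Partition) : zee μ = centralizerOrder μ.parts := rfl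

theorem centralizerOrder_cons (k : ℕ) (s : Multiset ℕ) :
    centralizerOrder (k ::ₘ s) = k * (s.count k + 1) * centralizerOrder s := by
  have aux : ∀ (t : Multiset ℕ) (S : Finset ℕ), t.toFinset ⊆ S →
      centralizerOrder t = ∏ j ∈ S, (t.count j).factorial * j ^ t.count j := by
    intro t S h
    refine Finset.prod_subset h fun j _ hj => ?_
    rw [Multiset.mem_toFinset] at hj
    simp [Multiset.count_eq_zero_of_notMem hj]
  have hk : k ∈ (k ::ₘ s).toFinset := by simp
  rw [aux (k ::ₘ s) _ subset_rfl, aux s (k ::ₘ s).toFinset (by intro x; simp; tauto),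
    ← Finset.mul_prod_erase _ _ hk, ← Finset.mul_prod_erase _ _ hk, Multiset.count_cons_self,
    Nat.factorial_succ, pow_succ]
  have : ∀ j ∈ (k ::ₘ s).toFinset.erase k, ((k ::ₘ s).count j).factorial * j ^ (k ::ₘ s).count j
      = (s.count j).factorial * j ^ s.count j := by
    intro j hj
    rw [Multiset.count_cons_of_ne (Finset.ne_of_mem_erase hj)]
  rw [Finset.prod_congr rfl this]
  ring

theorem centralizerOrder_pos {s : Multiset ℕ} (h : ∀ i ∈ s, 0 < i) : 0 < centralizerOrder s :=
  Finset.prod_pos fun j hj => Nat.mul_pos (Nat.factorial_pos _)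
    (Nat.pow_pos (h j (Multiset.mem_toFinset.mp hj)))

theorem zee_ne_zero {n : ℕ} (μ : n.Partition) : (zee μ : ℂ) ≠ 0 := by
  rw [zee_eq]
  exact_mod_cast (centralizerOrder_pos fun i hi => μ.parts_pos hi).ne'

section CycleIndex

variable {A : Type*} [CommRing A] [Algebra ℂ A]

/-- `∏ v_i / z` over the parts of a partition. -/
def cycleWeight (v : ℕ → A) (s : Multiset ℕ) : A :=
  ((centralizerOrder s : ℂ)⁻¹) • (s.map v).prod

theorem cycleWeight_cons (v : ℕ → A) {k : ℕ} (hk : k ≠ 0) (s : Multiset ℕ) :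
    ((k : ℂ) * (s.count k + 1 : ℕ)) • cycleWeight v (k ::ₘ s) = v k * cycleWeight v s := by
  rw [cycleWeight, cycleWeight, centralizerOrder_cons, Multiset.map_cons, Multiset.prod_cons,
    smul_smul, mul_smul_comm]
  congr 1
  have : (s.count k : ℂ) + 1 ≠ 0 := by exact_mod_cast (Nat.succ_ne_zero (s.count k))
  have : (k : ℂ) ≠ 0 := by exact_mod_cast hk
  push_cast
  rw [mul_inv, ← mul_assoc, mul_inv_cancel₀ (mul_ne_zero ‹_› ‹_›), one_mul]

/-- The cycle index of the symmetric group of degree `n`, evaluated at `v`. -/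
def cycleIndex (v : ℕ → A) (n : ℕ) : A := ∑ η : n.Partition, cycleWeight v η.parts

theorem cycleIndex_zero (v : ℕ → A) : cycleIndex v 0 = 1 := by
  simp [cycleIndex, cycleWeight, centralizerOrder]

theorem smul_cycleIndex (v : ℕ → A) (n : ℕ) :
    (n : ℂ) • cycleIndex v n = ∑ k ∈ Finset.Icc 1 n, v k * cycleIndex v (n - k) := by
  have h1 : ∀ η : n.Partition, (n : ℂ) • cycleWeight v η.parts =
      ∑ k ∈ Finset.Icc 1 n, ((k : ℂ) * η.parts.count k) • cycleWeight v η.parts := by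
    intro η
    rw [← Finset.sum_smul]
    congr 1
    have h2 : n = ∑ k ∈ η.parts.toFinset, η.parts.count k * k := by
      conv_lhs => rw [← η.parts_sum]
      rw [Finset.sum_multiset_count]
      simp
    have h3 : ∑ k ∈ η.parts.toFinset, η.parts.count k * k =
        ∑ k ∈ Finset.Icc 1 n, η.parts.count k * k := by
      refine Finset.sum_subset ?_ ?_
      · intro k hk
        rw [Multiset.mem_toFinset] at hk
        exact Finset.mem_Icc.mpr ⟨η.parts_pos hk, η.le_of_mem_parts hk⟩
      · intro k _ hk
        rw [Multiset.mem_toFinset] at hk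
        simp [Multiset.count_eq_zero_of_notMem hk]
    conv_lhs => rw [h2, h3]
    push_cast
    exact Finset.sum_congr rfl fun _ _ => mul_comm _ _
  rw [cycleIndex, Finset.smul_sum, Finset.sum_congr rfl fun η _ => h1 η, Finset.sum_comm]
  refine Finset.sum_congr rfl fun k hk => ?_
  obtain ⟨hk1, hkn⟩ := Finset.mem_Icc.mp hk
  rw [cycleIndex, Finset.mul_sum]
  have h4 : ∑ η : n.Partition, ((k : ℂ) * η.parts.count k) • cycleWeight v η.parts =
      ∑ η : {η : n.Partition // k ∈ η.parts},
        ((k : ℂ) * η.1.parts.count k) • cycleWeight v η.1.parts := by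
    rw [← Finset.sum_subtype (Finset.univ.filter fun η : n.Partition => k ∈ η.parts)
      (by simp) (fun η : n.Partition => ((k : ℂ) * η.parts.count k) • cycleWeight v η.parts)]
    refine (Finset.sum_subset (Finset.filter_subset _ _) fun η _ hη => ?_).symm
    rw [Finset.mem_filter, not_and] at hη
    simp [Multiset.count_eq_zero_of_notMem (hη (Finset.mem_univ _))]
  rw [h4]
  refine Fintype.sum_equiv (Nat.Partition.partitionWithPartEquiv hk1 hkn) _ _ fun η => ?_
  rw [Nat.Partition.partitionWithPartEquiv_apply_parts, ← cycleWeight_cons v (by omega),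
    Multiset.cons_erase η.2, Multiset.count_erase_self,
    Nat.sub_add_cancel (Multiset.count_pos.mpr η.2)]

theorem cycleIndex_unique (v : ℕ → A) (g : ℕ → A) (h0 : g 0 = 1)
    (h : ∀ n : ℕ, (n : ℂ) • g n = ∑ k ∈ Finset.Icc 1 n, v k * g (n - k)) (n : ℕ) :
    cycleIndex v n = g n := by
  induction n using Nat.strong_induction_on with
  | _ n ih =>
    rcases Nat.eq_zero_or_pos n with rfl | hn
    · rw [cycleIndex_zero, h0]
    · have hn' : (n : ℂ) ≠ 0 := by exact_mod_cast hn.ne'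
      have h1 : (n : ℂ) • cycleIndex v n = (n : ℂ) • g n := by
        rw [smul_cycleIndex, h]
        refine Finset.sum_congr rfl fun k hk => ?_
        rw [ih (n - k) (by rw [Finset.mem_Icc] at hk; omega)]
      exact (smul_right_injective A hn') h1

theorem cycleIndex_pow (x : A) (n : ℕ) : cycleIndex (fun k => x ^ k) n = x ^ n := by
  refine cycleIndex_unique _ _ (pow_zero x) (fun n => ?_) n
  have : ∀ k ∈ Finset.Icc 1 n, x ^ k * x ^ (n - k) = x ^ n := by
    intro k hk
    rw [← pow_add, Nat.add_sub_cancel' (Finset.mem_Icc.mp hk).2]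
  rw [Finset.sum_congr rfl this]
  simp [Nat.cast_smul_eq_nsmul]

theorem cycleWeight_pow_mul (x : A) (v : ℕ → A) (s : Multiset ℕ) :
    cycleWeight (fun k => x ^ k * v k) s = x ^ s.sum * cycleWeight v s := by
  rw [cycleWeight, cycleWeight, Multiset.prod_map_mul, mul_smul_comm]
  congr 2
  induction s using Multiset.induction_on with
  | empty => simp
  | cons a s ih => rw [Multiset.map_cons, Multiset.prod_cons, ih, Multiset.sum_cons, pow_add]

theorem cycleIndex_pow_mul (x : A) (v : ℕ → A) (n : ℕ) :
    cycleIndex (fun k => x ^ k * v k) n = x ^ n * cycleIndex v n := by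
  rw [cycleIndex, cycleIndex, Finset.mul_sum]
  refine Finset.sum_congr rfl fun η _ => ?_
  rw [cycleWeight_pow_mul, η.parts_sum]

/-- The generating function of the cycle indices. -/
def cycleSeries (v : ℕ → A) : PowerSeries A := PowerSeries.mk (cycleIndex v)

/-- `∑ v_k X^k` over `k ≥ 1`. -/
def positiveSeries (v : ℕ → A) : PowerSeries A := PowerSeries.mk fun k => if k = 0 then 0 else v k

omit [Algebra ℂ A] in
theorem coeff_positiveSeries_mul (v : ℕ → A) (g : PowerSeries A) (n : ℕ) :
    PowerSeries.coeff n (positiveSeries v * g) =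
      ∑ k ∈ Finset.Icc 1 n, v k * PowerSeries.coeff (n - k) g := by
  rw [PowerSeries.coeff_mul, Finset.Nat.sum_antidiagonal_eq_sum_range_succ
    (fun i j => PowerSeries.coeff i (positiveSeries v) * PowerSeries.coeff j g),
    Finset.sum_range_succ', positiveSeries]
  simp only [PowerSeries.coeff_mk, Nat.succ_ne_zero, if_false, if_true, zero_mul, add_zero]
  rw [Finset.range_eq_Ico, Finset.sum_Ico_add' (fun k => v k * PowerSeries.coeff (n - k) g) 0 n 1]
  rfl

theorem X_mul_derivative_cycleSeries (v : ℕ → A) :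
    PowerSeries.X * PowerSeries.derivative A (cycleSeries v) =
      positiveSeries v * cycleSeries v := by
  ext n
  rw [coeff_positiveSeries_mul]
  simp only [cycleSeries, PowerSeries.coeff_mk, ← smul_cycleIndex]
  cases n with
  | zero => simp
  | succ n =>
    rw [PowerSeries.coeff_succ_X_mul, PowerSeries.coeff_derivative, PowerSeries.coeff_mk,
      Nat.cast_smul_eq_nsmul, nsmul_eq_mul, mul_comm]
    push_cast
    rfl

theorem eq_cycleSeries (v : ℕ → A) (g : PowerSeries A) (h0 : PowerSeries.coeff 0 g = 1)
    (h : PowerSeries.X * PowerSeries.derivative A g = positiveSeries v * g) :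
    g = cycleSeries v := by
  ext n
  rw [cycleSeries, PowerSeries.coeff_mk]
  refine (cycleIndex_unique v (fun n => PowerSeries.coeff n g) h0 (fun n => ?_) n).symm
  rw [← coeff_positiveSeries_mul, ← h]
  cases n with
  | zero => simp
  | succ n =>
    rw [PowerSeries.coeff_succ_X_mul, PowerSeries.coeff_derivative,
      Nat.cast_smul_eq_nsmul, nsmul_eq_mul, mul_comm]
    push_cast
    rfl

theorem cycleSeries_add (u v : ℕ → A) :
    cycleSeries (fun k => u k + v k) = cycleSeries u * cycleSeries v := by
  symm
  apply eq_cycleSeries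
  · simp [cycleSeries, cycleIndex_zero]
  · have : positiveSeries (fun k => u k + v k) = positiveSeries u + positiveSeries v := by
      ext k
      simp only [positiveSeries, PowerSeries.coeff_mk, map_add]
      split_ifs <;> simp
    rw [Derivation.leibniz, this, smul_eq_mul, smul_eq_mul, mul_add, mul_left_comm,
      X_mul_derivative_cycleSeries, mul_left_comm _ (cycleSeries v), X_mul_derivative_cycleSeries]
    ring

theorem cycleSeries_sum {ι : Type*} (s : Finset ι) (u : ι → ℕ → A) :
    cycleSeries (fun k => ∑ i ∈ s, u i k) = ∏ i ∈ s, cycleSeries (u i) := by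
  classical
  induction s using Finset.induction_on with
  | empty =>
    symm
    apply eq_cycleSeries
    · simp
    · have : positiveSeries (fun _ => (0 : A)) = 0 := by
        ext k
        simp [positiveSeries]
      simp [this]
  | insert a s ha ih =>
    simp only [Finset.sum_insert ha, Finset.prod_insert ha]
    rw [cycleSeries_add, ih]

end CycleIndex

/-! ### Permutation characters and power sums -/

section PermChar

variable {L : ℕ}

/-- The exponent vector with given entries. -/
abbrev expVec (α : Fin L → ℕ) : Fin L →₀ ℕ := Finsupp.equivFunOnFinite.symm α

/-- The product of the power sums `p_k` over the parts `k` of a partition. -/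
def powerSum (A : Type*) [CommSemiring A] (L : ℕ) (s : Multiset ℕ) : MvPolynomial (Fin L) A :=
  (s.map (MvPolynomial.psum (Fin L) A)).prod

/-- The coefficient of `x^α` in `p_s`: the value at cycle type `s` of the permutation character on
colourings with `α_i` points of colour `i`. -/
def permChar (α : Fin L → ℕ) (s : Multiset ℕ) : ℂ :=
  MvPolynomial.coeff (expVec α) (powerSum ℂ L s)

variable {A : Type*} [CommRing A] [Algebra ℂ A]

theorem coeff_powerSum (α : Fin L → ℕ) (s : Multiset ℕ) :
    MvPolynomial.coeff (expVec α) (powerSum A L s) = algebraMap ℂ A (permChar α s) := by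
  have h : powerSum A L s = MvPolynomial.map (algebraMap ℂ A) (powerSum ℂ L s) := by
    rw [powerSum, powerSum, map_multiset_prod, Multiset.map_map]
    congr 1
    refine Multiset.map_congr rfl fun k _ => ?_
    simp [MvPolynomial.psum]
  rw [h, MvPolynomial.coeff_map, permChar]

theorem cycleWeight_psum_mul (v : ℕ → A) (s : Multiset ℕ) :
    cycleWeight (fun k => MvPolynomial.psum (Fin L) A k * MvPolynomial.C (v k)) s =
      powerSum A L s * MvPolynomial.C (cycleWeight v s) := by
  rw [cycleWeight, cycleWeight, Multiset.prod_map_mul, powerSum, Algebra.smul_def, Algebra.smul_def,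
    map_mul, map_multiset_prod, Multiset.map_map, mul_left_comm]
  rfl

theorem map_cycleIndex {B : Type*} [CommRing B] [Algebra ℂ B] (f : A →ₐ[ℂ] B) (v : ℕ → A) (n : ℕ) :
    cycleIndex (fun k => f (v k)) n = f (cycleIndex v n) := by
  rw [cycleIndex, cycleIndex, map_sum]
  refine Finset.sum_congr rfl fun η _ => ?_
  rw [cycleWeight, cycleWeight, map_smul, map_multiset_prod, Multiset.map_map]
  rfl

theorem coeff_cycleIndex_psum_mul (v : ℕ → A) (n : ℕ) (α : Fin L → ℕ) :
    MvPolynomial.coeff (expVec α)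
        (cycleIndex (fun k => MvPolynomial.psum (Fin L) A k * MvPolynomial.C (v k)) n) =
      if ∑ i, α i = n then ∏ i, cycleIndex v (α i) else 0 := by
  classical
  have h1 : cycleIndex (fun k => MvPolynomial.psum (Fin L) A k * MvPolynomial.C (v k)) n =
      ∑ l ∈ Finset.finsuppAntidiag Finset.univ n,
        MvPolynomial.monomial l (∏ i, cycleIndex v (l i)) := by
    have h2 := congrArg (PowerSeries.coeff n) (cycleSeries_sum Finset.univ
      fun (i : Fin L) k => (MvPolynomial.X i : MvPolynomial (Fin L) A) ^ k * MvPolynomial.C (v k))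
    rw [PowerSeries.coeff_prod, cycleSeries, PowerSeries.coeff_mk] at h2
    simp only [← Finset.sum_mul] at h2
    rw [show (fun k => MvPolynomial.psum (Fin L) A k * MvPolynomial.C (v k)) =
      fun k => (∑ i, (MvPolynomial.X i : MvPolynomial (Fin L) A) ^ k) * MvPolynomial.C (v k)
      from rfl, h2]
    refine Finset.sum_congr rfl fun l _ => ?_
    rw [MvPolynomial.monomial_eq, map_prod, Finsupp.prod_fintype _ _ (by simp), mul_comm,
      ← Finset.prod_mul_distrib]
    refine Finset.prod_congr rfl fun i _ => ?_
    rw [cycleSeries, PowerSeries.coeff_mk, cycleIndex_pow_mul]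
    congr 1
    exact map_cycleIndex (IsScalarTower.toAlgHom ℂ A (MvPolynomial (Fin L) A)) v (l i)
  rw [h1, MvPolynomial.coeff_sum]
  simp only [MvPolynomial.coeff_monomial]
  rw [Finset.sum_ite_eq']
  simp [Finset.mem_finsuppAntidiag]

/-- Pairing with a permutation character evaluates the cycle indices of a Young subgroup. -/
theorem sum_permChar_smul (v : ℕ → A) (n : ℕ) (α : Fin L → ℕ) :
    ∑ η : n.Partition, permChar α η.parts • cycleWeight v η.parts =
      if ∑ i, α i = n then ∏ i, cycleIndex v (α i) else 0 := by
  rw [← coeff_cycleIndex_psum_mul, cycleIndex, MvPolynomial.coeff_sum]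
  refine Finset.sum_congr rfl fun η _ => ?_
  rw [cycleWeight_psum_mul, mul_comm, MvPolynomial.coeff_C_mul, mul_comm, coeff_powerSum, Algebra.smul_def]

/-- The complete homogeneous symmetric polynomial of degree `m`. -/
def completeSym (L m : ℕ) : MvPolynomial (Fin L) ℂ := cycleIndex (MvPolynomial.psum (Fin L) ℂ) m

theorem coeff_completeSym (m : ℕ) (α : Fin L → ℕ) :
    MvPolynomial.coeff (expVec α) (completeSym L m) = if ∑ i, α i = m then 1 else 0 := by
  have h := coeff_cycleIndex_psum_mul (A := ℂ) (fun _ => 1) m α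
  simp only [map_one, mul_one] at h
  rw [completeSym]
  refine h.trans ?_
  have h1 : ∀ k, cycleIndex (fun _ => (1 : ℂ)) k = 1 := by
    intro k
    have := cycleIndex_pow (1 : ℂ) k
    simpa using this
  simp [h1]

theorem sum_permChar_smul_powerSum {n : ℕ} {μ : Fin L → ℕ} (hμ : ∑ i, μ i = n) :
    ∑ η : n.Partition, (permChar μ η.parts * (zee η : ℂ)⁻¹) • powerSum ℂ L η.parts =
      ∏ j, completeSym L (μ j) := by
  have h := sum_permChar_smul (MvPolynomial.psum (Fin L) ℂ) n μ
  rw [if_pos hμ] at h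
  rw [show ∏ j, completeSym L (μ j) = ∏ i, cycleIndex (MvPolynomial.psum (Fin L) ℂ) (μ i) from rfl,
    ← h]
  refine Finset.sum_congr rfl fun η _ => ?_
  rw [cycleWeight, smul_smul]
  rfl

end PermChar

/-! ### Alternating polynomials and the Pieri rule -/

section Pieri

variable {L : ℕ}

/-- The staircase `(L - 1, …, 1, 0)`. -/
def staircase (L : ℕ) (i : Fin L) : ℕ := L - 1 - i

theorem staircase_strictAnti : StrictAnti (staircase L) := by
  intro i j h
  have := Fin.lt_def.mp h
  simp only [staircase]
  omega

/-- A function of exponent vectors that changes sign under transpositions of the entries. -/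
def IsAlternating (c : (Fin L → ℕ) → ℂ) : Prop :=
  ∀ (i j : Fin L), i ≠ j → ∀ γ : Fin L → ℕ, c (γ ∘ Equiv.swap i j) = -c γ

/-- The exponent vectors below `α` that are smaller by `k` in total. -/
def removals (k : ℕ) (α : Fin L → ℕ) : Finset (Fin L → ℕ) :=
  (Finset.Iic α).filter fun γ => ∑ i, γ i + k = ∑ i, α i

theorem mem_removals {k : ℕ} {α γ : Fin L → ℕ} :
    γ ∈ removals k α ↔ γ ≤ α ∧ ∑ i, γ i + k = ∑ i, α i := by
  simp [removals]

theorem coeff_mul_completeSym (P : MvPolynomial (Fin L) ℂ) (k : ℕ) (α : Fin L → ℕ) :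
    MvPolynomial.coeff (expVec α) (P * completeSym L k) =
      ∑ γ ∈ removals k α, MvPolynomial.coeff (expVec γ) P := by
  classical
  rw [MvPolynomial.coeff_mul]
  have h : ∀ x ∈ Finset.HasAntidiagonal.antidiagonal (expVec α),
      MvPolynomial.coeff x.1 P * MvPolynomial.coeff x.2 (completeSym L k) =
        if ∑ i, x.2 i = k then MvPolynomial.coeff x.1 P else 0 := by
    intro x _
    have := coeff_completeSym k (x.2 : Fin L → ℕ)
    rw [show expVec (x.2 : Fin L → ℕ) = x.2 from by ext; rfl] at this
    rw [this, mul_ite, mul_one, mul_zero]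
  rw [Finset.sum_congr rfl h, ← Finset.sum_filter]
  refine Finset.sum_bij' (fun x _ => (x.1 : Fin L → ℕ))
    (fun γ _ => (expVec γ, expVec fun i => α i - γ i)) ?_ ?_ ?_ ?_ ?_
  · intro x hx
    rw [Finset.mem_filter, Finset.HasAntidiagonal.mem_antidiagonal] at hx
    obtain ⟨hx, hk⟩ := hx
    have hi : ∀ i, x.1 i + x.2 i = α i := fun i => by
      rw [← Finsupp.add_apply, hx]
      rfl
    rw [mem_removals]
    refine ⟨fun i => (hi i) ▸ Nat.le_add_right _ _, ?_⟩
    rw [← hk, ← Finset.sum_add_distrib]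
    exact Finset.sum_congr rfl fun i _ => hi i
  · intro γ hγ
    rw [mem_removals] at hγ
    rw [Finset.mem_filter, Finset.HasAntidiagonal.mem_antidiagonal]
    have hi : ∀ i, γ i + (α i - γ i) = α i := fun i => Nat.add_sub_cancel' (hγ.1 i)
    refine ⟨by ext i; exact hi i, ?_⟩
    have h1 : ∑ i, γ i + ∑ i, (α i - γ i) = ∑ i, α i := by
      rw [← Finset.sum_add_distrib]
      exact Finset.sum_congr rfl fun i _ => hi i
    have h2 := hγ.2
    change ∑ i, (α i - γ i) = k
    omega
  · intro x hx
    rw [Finset.mem_filter, Finset.HasAntidiagonal.mem_antidiagonal] at hx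
    refine Prod.ext (by ext; rfl) ?_
    ext i
    have : x.1 i + x.2 i = α i := by
      rw [← Finsupp.add_apply, hx.1]
      rfl
    change α i - x.1 i = x.2 i
    omega
  · intro γ _
    rfl
  · intro x _
    congr 1
    ext i
    rfl

theorem comp_swap_mem_removals {k : ℕ} {α γ : Fin L → ℕ} (σ : Equiv.Perm (Fin L)) :
    γ ∘ σ ∈ removals k (α ∘ σ) ↔ γ ∈ removals k α := by
  rw [mem_removals, mem_removals]
  have h1 : ∑ i, (γ ∘ σ) i = ∑ i, γ i := Equiv.sum_comp σ γ
  have h2 : ∑ i, (α ∘ σ) i = ∑ i, α i := Equiv.sum_comp σ α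
  rw [h1, h2]
  refine and_congr_left fun _ => ⟨fun h i => ?_, fun h i => h (σ i)⟩
  have := h (σ.symm i)
  simpa using this

theorem IsAlternating.sum_removals {c : (Fin L → ℕ) → ℂ} (hc : IsAlternating c) (k : ℕ) :
    IsAlternating fun α => ∑ γ ∈ removals k α, c γ := by
  intro i j hij α
  change ∑ γ ∈ removals k (α ∘ Equiv.swap i j), c γ = -∑ γ ∈ removals k α, c γ
  rw [← Finset.sum_neg_distrib]
  have hinv : ∀ γ : Fin L → ℕ, (γ ∘ Equiv.swap i j) ∘ Equiv.swap i j = γ := by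
    intro γ
    funext x
    simp
  refine Finset.sum_bij' (fun γ _ => γ ∘ Equiv.swap i j) (fun γ _ => γ ∘ Equiv.swap i j)
    ?_ ?_ (fun γ _ => hinv γ) (fun γ _ => hinv γ) ?_
  · intro γ hγ
    rw [← comp_swap_mem_removals (Equiv.swap i j), hinv]
    exact hγ
  · intro γ hγ
    exact (comp_swap_mem_removals _).mpr hγ
  · intro γ _
    rw [hc i j hij, neg_neg]

/-- `γ` interlaces with `α`: each `γ_i` exceeds `α_{i+1}`. -/
def Interlaces (α γ : Fin L → ℕ) : Prop :=
  ∀ (i : ℕ) (h : i + 1 < L), α ⟨i + 1, h⟩ < γ ⟨i, by omega⟩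

open Classical in
/-- The Pieri rule: only interlacing vectors contribute. -/
theorem IsAlternating.pieri {c : (Fin L → ℕ) → ℂ} (hc : IsAlternating c) (k : ℕ)
    {α : Fin L → ℕ} (hα : Antitone α) :
    ∑ γ ∈ removals k α, c γ = ∑ γ ∈ (removals k α).filter (Interlaces α), c γ := by
  rw [← Finset.sum_filter_add_sum_filter_not (removals k α) (Interlaces α)]
  refine add_eq_left.mpr ?_
  let bad : (Fin L → ℕ) → ℕ → Prop := fun γ i =>
    ∃ h : i + 1 < L, γ ⟨i, by omega⟩ ≤ α ⟨i + 1, h⟩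
  have hbad : ∀ γ ∈ (removals k α).filter fun γ => ¬ Interlaces α γ, ∃ i, bad γ i := by
    intro γ hγ
    have := (Finset.mem_filter.mp hγ).2
    simp only [Interlaces, not_forall, not_lt] at this
    exact this
  let sw : ∀ γ : Fin L → ℕ, (∃ i, bad γ i) → Equiv.Perm (Fin L) := fun γ h =>
    Equiv.swap ⟨Nat.find h, by obtain ⟨h', -⟩ := Nat.find_spec h; omega⟩
      ⟨Nat.find h + 1, (Nat.find_spec h).1⟩
  have hsw : ∀ γ ∈ removals k α, ∀ h : ∃ i, bad γ i, γ ∘ sw γ h ∈ removals k α ∧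
      ∃ h' : ∃ i, bad (γ ∘ sw γ h) i, Nat.find h' = Nat.find h := by
    intro γ hγ h
    obtain ⟨hlt, hle⟩ := Nat.find_spec h
    rw [mem_removals] at hγ
    have hb : bad (γ ∘ sw γ h) (Nat.find h) := by
      refine ⟨hlt, ?_⟩
      simp only [sw, Function.comp_apply, Equiv.swap_apply_left]
      exact hγ.1 _
    refine ⟨mem_removals.mpr ⟨fun x => ?_, ?_⟩, ⟨_, hb⟩, ?_⟩
    · simp only [sw, Function.comp_apply]
      by_cases h1 : x = ⟨Nat.find h, by omega⟩
      · rw [h1, Equiv.swap_apply_left]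
        exact (hγ.1 _).trans (hα (by simp [Fin.le_def]))
      · by_cases h2 : x = ⟨Nat.find h + 1, hlt⟩
        · rw [h2, Equiv.swap_apply_right]
          exact hle
        · rw [Equiv.swap_apply_of_ne_of_ne h1 h2]
          exact hγ.1 x
    · rw [← hγ.2]
      congr 1
      exact Equiv.sum_comp (sw γ h) γ
    · rw [Nat.find_eq_iff]
      refine ⟨hb, fun m hm hbm => Nat.find_min h hm ?_⟩
      obtain ⟨h1, h2⟩ := hbm
      refine ⟨h1, ?_⟩
      simp only [sw, Function.comp_apply] at h2
      rwa [Equiv.swap_apply_of_ne_of_ne] at h2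
      · simp only [ne_eq, Fin.mk.injEq]
        omega
      · simp only [ne_eq, Fin.mk.injEq]
        omega
  refine Finset.sum_involution (fun γ hγ => γ ∘ sw γ (hbad γ hγ)) ?_ ?_ ?_ ?_
  · intro γ hγ
    change c γ + c (γ ∘ Equiv.swap _ _) = 0
    rw [hc _ _ (by simp), add_neg_cancel]
  · intro γ hγ h0 heq
    apply h0
    have h1 : c (γ ∘ sw γ (hbad γ hγ)) = -c γ := hc _ _ (by simp) γ
    rw [heq] at h1
    exact self_eq_neg.mp h1
  · intro γ hγ
    obtain ⟨h1, ⟨i, h2, h3⟩, -⟩ := hsw γ (Finset.mem_filter.mp hγ).1 (hbad γ hγ)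
    refine Finset.mem_filter.mpr ⟨h1, fun h => ?_⟩
    exact absurd (h i h2) (not_lt.mpr h3)
  · intro γ hγ
    obtain ⟨-, h', h3⟩ := hsw γ (Finset.mem_filter.mp hγ).1 (hbad γ hγ)
    funext x
    simp only [sw, Function.comp_apply, h3]
    simp

/-- The Vandermonde alternant `∑_w sgn(w) x^{w δ}`. -/
def alternant (L : ℕ) : MvPolynomial (Fin L) ℂ :=
  ∑ w : Equiv.Perm (Fin L),
    MvPolynomial.monomial (expVec (staircase L ∘ w)) (((Equiv.Perm.sign w : ℤˣ) : ℤ) : ℂ)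

theorem coeff_alternant (γ : Fin L → ℕ) :
    MvPolynomial.coeff (expVec γ) (alternant L) = ∑ w : Equiv.Perm (Fin L),
      if staircase L ∘ w = γ then (((Equiv.Perm.sign w : ℤˣ) : ℤ) : ℂ) else 0 := by
  classical
  rw [alternant, MvPolynomial.coeff_sum]
  refine Finset.sum_congr rfl fun w _ => ?_
  rw [MvPolynomial.coeff_monomial]
  simp only [EmbeddingLike.apply_eq_iff_eq]

theorem isAlternating_alternant :
    IsAlternating fun γ => MvPolynomial.coeff (expVec γ) (alternant L) := by
  intro i j hij γ
  change MvPolynomial.coeff (expVec (γ ∘ Equiv.swap i j)) (alternant L) =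
    -MvPolynomial.coeff (expVec γ) (alternant L)
  rw [coeff_alternant, coeff_alternant, ← Finset.sum_neg_distrib]
  refine Fintype.sum_equiv (Equiv.mulRight (Equiv.swap i j)) _ _ fun w => ?_
  have h : staircase L ∘ w = γ ∘ Equiv.swap i j ↔ staircase L ∘ ⇑(w * Equiv.swap i j) = γ := by
    constructor
    · intro h
      rw [Equiv.Perm.coe_mul, ← Function.comp_assoc, h]
      funext x
      simp
    · rintro rfl
      funext x
      simp
  simp only [Equiv.coe_mulRight, h, Equiv.Perm.sign_mul, Equiv.Perm.sign_swap hij]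
  split_ifs <;> simp

theorem perm_eq_one_of_strictMono {w : Equiv.Perm (Fin L)} (h : StrictMono w) : w = 1 := by
  ext x
  have := DFunLike.congr_fun
    (Subsingleton.elim (h.orderIsoOfSurjective _ w.surjective) (OrderIso.refl _)) x
  exact congrArg Fin.val this

theorem coeff_alternant_of_strictAnti {γ : Fin L → ℕ} (hγ : StrictAnti γ)
    (h : MvPolynomial.coeff (expVec γ) (alternant L) ≠ 0) : γ = staircase L := by
  rw [coeff_alternant] at h
  obtain ⟨w, -, hw⟩ := Finset.exists_ne_zero_of_sum_ne_zero h
  have hw' : staircase L ∘ w = γ := by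
    by_contra h'
    exact hw (if_neg h')
  have h1 : w = 1 := by
    apply perm_eq_one_of_strictMono
    intro i j hij
    have := hγ hij
    rw [← hw'] at this
    exact staircase_strictAnti.lt_iff_gt.mp this
  rw [← hw', h1]
  rfl

theorem coeff_alternant_staircase :
    MvPolynomial.coeff (expVec (staircase L)) (alternant L) = 1 := by
  rw [coeff_alternant, Finset.sum_eq_single 1]
  · simp
  · intro w _ hw
    refine if_neg fun h => hw ?_
    ext x
    rw [staircase_strictAnti.injective (congrFun h x)]
    rfl
  · simp

end Pieri

/-! ### Frobenius characters -/

section Frobenius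

variable {L : ℕ}

/-- The sum of the first `k` entries. -/
def partialSum (α : Fin L → ℕ) (k : ℕ) : ℕ := ∑ i with (i : Fin L).val < k, α i

theorem filter_lt_succ {k : ℕ} (hk : k < L) :
    (Finset.univ.filter fun i : Fin L => i.val < k + 1) =
      insert ⟨k, hk⟩ (Finset.univ.filter fun i : Fin L => i.val < k) := by
  ext i
  simp only [Finset.mem_filter, Finset.mem_univ, true_and, Finset.mem_insert, Fin.ext_iff]
  omega

theorem partialSum_succ (α : Fin L → ℕ) {k : ℕ} (hk : k < L) :
    partialSum α (k + 1) = α ⟨k, hk⟩ + partialSum α k := by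
  rw [partialSum, filter_lt_succ hk, Finset.sum_insert (by simp), partialSum]

theorem partialSum_of_le (α : Fin L → ℕ) {k : ℕ} (hk : L ≤ k) : partialSum α k = ∑ i, α i := by
  rw [partialSum, Finset.filter_true_of_mem fun i _ => i.2.trans_le hk]

theorem sum_eq_partialSum_add (α : Fin L → ℕ) (k : ℕ) :
    ∑ i, α i = partialSum α k + ∑ i with ¬ (i : Fin L).val < k, α i :=
  (Finset.sum_filter_add_sum_filter_not _ _ _).symm

theorem partialSum_mono {α β : Fin L → ℕ} (h : α ≤ β) (k : ℕ) :
    partialSum α k ≤ partialSum β k := Finset.sum_le_sum fun i _ => h i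

theorem partialSum_injective {α β : Fin L → ℕ} (h : ∀ k, partialSum α k = partialSum β k) :
    α = β := by
  funext i
  have h1 := partialSum_succ α i.2
  have h2 := partialSum_succ β i.2
  rw [h, h i] at h1
  rw [h2] at h1
  exact (Nat.add_right_cancel h1).symm

/-- The alternant times the first `r` complete homogeneous factors. -/
def pieriProduct (μ : Fin L → ℕ) (r : ℕ) : MvPolynomial (Fin L) ℂ :=
  alternant L * ∏ j with (j : Fin L).val < r, completeSym L (μ j)

theorem pieriProduct_zero (μ : Fin L → ℕ) : pieriProduct μ 0 = alternant L := by
  simp [pieriProduct]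

theorem pieriProduct_succ (μ : Fin L → ℕ) {r : ℕ} (hr : r < L) :
    pieriProduct μ (r + 1) = pieriProduct μ r * completeSym L (μ ⟨r, hr⟩) := by
  rw [pieriProduct, filter_lt_succ hr, Finset.prod_insert (by simp), pieriProduct]
  ring

theorem isAlternating_pieriProduct (μ : Fin L → ℕ) {r : ℕ} (hr : r ≤ L) :
    IsAlternating fun γ => MvPolynomial.coeff (expVec γ) (pieriProduct μ r) := by
  induction r with
  | zero =>
    rw [pieriProduct_zero]
    exact isAlternating_alternant
  | succ r ih =>
    simp only [pieriProduct_succ μ hr, coeff_mul_completeSym]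
    exact (ih (by omega)).sum_removals _

open Classical in
theorem coeff_pieriProduct_succ (μ : Fin L → ℕ) {r : ℕ} (hr : r < L) {α : Fin L → ℕ}
    (hα : Antitone α) :
    MvPolynomial.coeff (expVec α) (pieriProduct μ (r + 1)) =
      ∑ γ ∈ (removals (μ ⟨r, hr⟩) α).filter (Interlaces α),
        MvPolynomial.coeff (expVec γ) (pieriProduct μ r) := by
  rw [pieriProduct_succ μ hr, coeff_mul_completeSym]
  exact (isAlternating_pieriProduct μ hr.le).pieri _ hα

theorem Interlaces.strictAnti {α γ : Fin L → ℕ} (h : Interlaces α γ) (hle : γ ≤ α) :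
    StrictAnti γ := by
  have h1 : ∀ (i : ℕ) (h : i + 1 < L), γ ⟨i + 1, h⟩ < γ ⟨i, by omega⟩ := fun i hi =>
    (hle _).trans_lt (h i hi)
  have h2 : ∀ (d i : ℕ) (hd : i + d + 1 < L), γ ⟨i + d + 1, hd⟩ < γ ⟨i, by omega⟩ := by
    intro d
    induction d with
    | zero => exact fun i hd => h1 i hd
    | succ d ih => exact fun i hd => (h1 (i + d + 1) (by omega)).trans (ih i (by omega))
  intro i j hij
  have := h2 (j.val - i.val - 1) i.val (by have := j.2; have := Fin.lt_def.mp hij; omega)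
  have hj : (⟨i.val + (j.val - i.val - 1) + 1, by have := j.2; have := Fin.lt_def.mp hij; omega⟩
      : Fin L) = j := by
    ext
    have := Fin.lt_def.mp hij
    simp only
    omega
  rwa [hj] at this

theorem pieriProduct_support (μ : Fin L → ℕ) {r : ℕ} (hr : r ≤ L) {α : Fin L → ℕ}
    (hα : StrictAnti α) (h : MvPolynomial.coeff (expVec α) (pieriProduct μ r) ≠ 0) :
    (∀ i : Fin L, r ≤ i.val → α i = staircase L i) ∧
      ∑ i, α i = ∑ i, staircase L i + partialSum μ r ∧
      ∀ k ≤ r, partialSum μ k + partialSum (staircase L) k ≤ partialSum α k := by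
  induction r generalizing α with
  | zero =>
    rw [pieriProduct_zero] at h
    rw [coeff_alternant_of_strictAnti hα h]
    refine ⟨fun _ _ => rfl, by simp [partialSum], fun k hk => ?_⟩
    rw [Nat.le_zero.mp hk]
    simp [partialSum]
  | succ r ih =>
    classical
    rw [coeff_pieriProduct_succ μ hr hα.antitone] at h
    obtain ⟨γ, hγ, hne⟩ := Finset.exists_ne_zero_of_sum_ne_zero h
    obtain ⟨hγ1, hγ2⟩ := Finset.mem_filter.mp hγ
    obtain ⟨hle, hsum⟩ := mem_removals.mp hγ1
    obtain ⟨h1, h2, h3⟩ := ih (by omega) (hγ2.strictAnti hle) hne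
    have ha : ∀ i : Fin L, r + 1 ≤ i.val → α i = staircase L i := by
      intro i hi
      refine le_antisymm ?_ ?_
      · obtain ⟨j, hj⟩ : ∃ j, i.val = j + 1 := ⟨i.val - 1, by omega⟩
        have h4 := hγ2 j (hj ▸ i.2)
        rw [h1 ⟨j, _⟩ (by simp only; omega)] at h4
        have h5 : (⟨j + 1, hj ▸ i.2⟩ : Fin L) = i := by ext; exact hj.symm
        rw [h5] at h4
        simp only [staircase] at h4 ⊢
        omega
      · rw [← h1 i (by omega)]
        exact hle i
    have hb : ∑ i, α i = ∑ i, staircase L i + partialSum μ (r + 1) := by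
      rw [← hsum, h2, partialSum_succ μ hr]
      ring
    refine ⟨ha, hb, fun k hk => ?_⟩
    rcases Nat.lt_or_ge k (r + 1) with hk' | hk'
    · exact (h3 k (by omega)).trans (partialSum_mono hle k)
    · obtain rfl : k = r + 1 := by omega
      rw [sum_eq_partialSum_add α (r + 1), sum_eq_partialSum_add (staircase L) (r + 1)] at hb
      have : ∑ i with ¬ (i : Fin L).val < r + 1, α i =
          ∑ i with ¬ (i : Fin L).val < r + 1, staircase L i :=
        Finset.sum_congr rfl fun i hi => ha i (not_lt.mp (Finset.mem_filter.mp hi).2)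
      omega

/-- The staircase with the first `r` entries of `ρ` added. -/
def partialShift (ρ : Fin L → ℕ) (r : ℕ) (i : Fin L) : ℕ :=
  if i.val < r then ρ i + staircase L i else staircase L i

theorem partialShift_strictAnti {ρ : Fin L → ℕ} (hρ : Antitone ρ) (r : ℕ) :
    StrictAnti (partialShift ρ r) := by
  intro i j hij
  have h1 := staircase_strictAnti hij
  have h2 := hρ hij.le
  have h3 := Fin.lt_def.mp hij
  simp only [partialShift]
  split_ifs <;> omega

theorem coeff_pieriProduct_partialShift {ρ : Fin L → ℕ} (hρ : Antitone ρ) {r : ℕ} (hr : r ≤ L) :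
    MvPolynomial.coeff (expVec (partialShift ρ r)) (pieriProduct ρ r) = 1 := by
  induction r with
  | zero =>
    rw [pieriProduct_zero]
    exact coeff_alternant_staircase
  | succ r ih =>
    classical
    have hrL : r < L := hr
    have hsum : ∑ i, partialShift ρ r i + ρ ⟨r, hrL⟩ = ∑ i, partialShift ρ (r + 1) i := by
      rw [← Finset.add_sum_erase _ (partialShift ρ r) (Finset.mem_univ ⟨r, hrL⟩),
        ← Finset.add_sum_erase _ (partialShift ρ (r + 1)) (Finset.mem_univ ⟨r, hrL⟩)]
      have : ∀ i ∈ Finset.univ.erase (⟨r, hrL⟩ : Fin L),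
          partialShift ρ r i = partialShift ρ (r + 1) i := by
        intro i hi
        have h1 : i.val ≠ r := fun h => (Finset.ne_of_mem_erase hi) (Fin.ext h)
        simp only [partialShift]
        split_ifs <;> omega
      rw [Finset.sum_congr rfl this]
      have h1 : partialShift ρ r ⟨r, hrL⟩ = staircase L ⟨r, hrL⟩ := by simp [partialShift]
      have h2 : partialShift ρ (r + 1) ⟨r, hrL⟩ = ρ ⟨r, hrL⟩ + staircase L ⟨r, hrL⟩ := by
        simp [partialShift]
      rw [h1, h2]
      ring
    rw [coeff_pieriProduct_succ ρ hrL (partialShift_strictAnti hρ _).antitone,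
      Finset.sum_eq_single (partialShift ρ r), ih hrL.le]
    · intro γ hγ hne
      obtain ⟨hγ1, hγ2⟩ := Finset.mem_filter.mp hγ
      obtain ⟨hle, hs⟩ := mem_removals.mp hγ1
      by_contra h
      obtain ⟨h1, -, -⟩ := pieriProduct_support ρ hrL.le (hγ2.strictAnti hle) h
      have hle' : ∀ i ∈ Finset.univ, γ i ≤ partialShift ρ r i := by
        intro i _
        have h2 := hle i
        have h3 := h1 i
        simp only [partialShift] at h2 ⊢
        split_ifs at h2 ⊢ <;> omega
      apply hne
      funext i
      exact (Finset.sum_eq_sum_iff_of_le hle').mp (by omega) i (Finset.mem_univ i)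
    · intro h
      refine absurd (Finset.mem_filter.mpr ⟨mem_removals.mpr ⟨fun i => ?_, hsum⟩, ?_⟩) h
      · simp only [partialShift]
        split_ifs <;> omega
      · intro i hi
        have h1 := hρ (show (⟨i, by omega⟩ : Fin L) ≤ ⟨i + 1, hi⟩ by simp [Fin.le_def])
        simp only [partialShift, staircase]
        split_ifs <;> omega

/-- The coefficient of `x^{ρ + δ}` in `a_δ p_s`. -/
def frobChar (ρ : Fin L → ℕ) (s : Multiset ℕ) : ℂ :=
  MvPolynomial.coeff (expVec (ρ + staircase L)) (alternant L * powerSum ℂ L s)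

theorem sum_permChar_mul_frobChar {n : ℕ} (ρ : Fin L → ℕ) {μ : Fin L → ℕ} (hμ : ∑ i, μ i = n) :
    ∑ η : n.Partition, permChar μ η.parts * frobChar ρ η.parts / zee η =
      MvPolynomial.coeff (expVec (partialShift ρ L)) (pieriProduct μ L) := by
  have h1 : partialShift ρ L = ρ + staircase L := by
    funext i
    simp [partialShift]
  have h2 : pieriProduct μ L = alternant L * ∏ j, completeSym L (μ j) := by
    simp [pieriProduct]
  rw [h1, h2, ← sum_permChar_smul_powerSum hμ, Finset.mul_sum, MvPolynomial.coeff_sum]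
  refine Finset.sum_congr rfl fun η _ => ?_
  rw [mul_smul_comm, MvPolynomial.coeff_smul, smul_eq_mul, frobChar]
  ring

theorem partialSum_le_of_sum_permChar_mul_frobChar {n : ℕ} {ρ μ : Fin L → ℕ} (hρ : Antitone ρ)
    (hμ : ∑ i, μ i = n)
    (h : ∑ η : n.Partition, permChar μ η.parts * frobChar ρ η.parts / zee η ≠ 0) (k : ℕ) :
    partialSum μ k ≤ partialSum ρ k := by
  rw [sum_permChar_mul_frobChar ρ hμ] at h
  have key : ∀ k ≤ L, partialSum μ k ≤ partialSum ρ k := by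
    intro k hk
    have h1 := (pieriProduct_support μ le_rfl (partialShift_strictAnti hρ L) h).2.2 k hk
    have h2 : partialSum (partialShift ρ L) k = partialSum ρ k + partialSum (staircase L) k := by
      rw [partialSum, partialSum, partialSum, ← Finset.sum_add_distrib]
      refine Finset.sum_congr rfl fun i _ => ?_
      simp [partialShift]
    omega
  rcases le_total k L with hk | hk
  · exact key k hk
  · rw [partialSum_of_le _ hk, partialSum_of_le _ hk, ← partialSum_of_le μ le_rfl,
      ← partialSum_of_le ρ le_rfl]
    exact key L le_rfl

theorem sum_permChar_self_mul_frobChar {n : ℕ} {ρ : Fin L → ℕ} (hρ : Antitone ρ)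
    (hn : ∑ i, ρ i = n) :
    ∑ η : n.Partition, permChar ρ η.parts * frobChar ρ η.parts / zee η = 1 := by
  rw [sum_permChar_mul_frobChar ρ hn, coeff_pieriProduct_partialShift hρ le_rfl]

/-! ### The determinantal expansion -/

/-- `∑_w sgn(w) T(ρ + δ - w δ)`, over the `w` for which the argument is nonnegative. -/
def detExpand (T : (Fin L → ℕ) → ℂ) (ρ : Fin L → ℕ) : ℂ :=
  ∑ w : Equiv.Perm (Fin L), (((Equiv.Perm.sign w : ℤˣ) : ℤ) : ℂ) *
    if ∀ i, staircase L (w i) ≤ ρ i + staircase L i then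
      T (ρ + staircase L - staircase L ∘ w) else 0

theorem frobChar_eq (ρ : Fin L → ℕ) (s : Multiset ℕ) :
    frobChar ρ s = detExpand (fun α => permChar α s) ρ := by
  rw [frobChar, alternant, Finset.sum_mul, MvPolynomial.coeff_sum, detExpand]
  refine Finset.sum_congr rfl fun w _ => ?_
  rw [MvPolynomial.coeff_monomial_mul', mul_ite, mul_zero]
  refine if_congr Iff.rfl (congrArg _ ?_) rfl
  rw [permChar]
  congr 1
  ext i
  rfl

theorem sum_shift_eq {ρ : Fin L → ℕ} {w : Equiv.Perm (Fin L)}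
    (h : ∀ i, staircase L (w i) ≤ ρ i + staircase L i) :
    ∑ i, (ρ + staircase L - staircase L ∘ w) i = ∑ i, ρ i := by
  have h1 : ∑ i, (ρ + staircase L - staircase L ∘ w) i + ∑ i, (staircase L ∘ w) i =
      ∑ i, ρ i + ∑ i, staircase L i := by
    rw [← Finset.sum_add_distrib, ← Finset.sum_add_distrib]
    exact Finset.sum_congr rfl fun i _ => Nat.sub_add_cancel (h i)
  have h2 : ∑ i, (staircase L ∘ w) i = ∑ i, staircase L i := Equiv.sum_comp w (staircase L)
  omega

theorem partialSum_staircase_comp_le (w : Equiv.Perm (Fin L)) (k : ℕ) :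
    partialSum (staircase L ∘ w) k ≤ partialSum (staircase L) k := by
  have h : Monovary (fun i : Fin L => if i.val < k then 1 else 0) (staircase L) := by
    intro i j hij
    have := Fin.lt_def.mp (staircase_strictAnti.lt_iff_gt.mp hij)
    simp only
    split_ifs <;> omega
  have h1 := h.sum_mul_comp_perm_le_sum_mul (σ := w)
  simpa [partialSum, Finset.sum_filter] using h1

theorem partialSum_shift {ρ : Fin L → ℕ} {w : Equiv.Perm (Fin L)}
    (h : ∀ i, staircase L (w i) ≤ ρ i + staircase L i) (k : ℕ) :
    partialSum (ρ + staircase L - staircase L ∘ w) k + partialSum (staircase L ∘ w) k =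
      partialSum ρ k + partialSum (staircase L) k := by
  rw [partialSum, partialSum, partialSum, partialSum, ← Finset.sum_add_distrib,
    ← Finset.sum_add_distrib]
  exact Finset.sum_congr rfl fun i _ => Nat.sub_add_cancel (h i)

theorem partialSum_le_of_detExpand {T : (Fin L → ℕ) → ℂ} {ρ σ : Fin L → ℕ}
    (hT : ∀ α, ∑ i, α i = ∑ i, σ i → T α ≠ 0 → ∀ k, partialSum α k ≤ partialSum ρ k)
    (h : detExpand T σ ≠ 0) (k : ℕ) : partialSum σ k ≤ partialSum ρ k := by
  obtain ⟨w, -, hw⟩ := Finset.exists_ne_zero_of_sum_ne_zero h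
  have hw' := right_ne_zero_of_mul hw
  rw [ne_eq, ite_eq_right_iff, Classical.not_imp] at hw'
  have h1 := hT _ (sum_shift_eq hw'.1) hw'.2 k
  have h2 := partialSum_shift hw'.1 k
  have h3 := partialSum_staircase_comp_le w k
  omega

theorem eq_one_of_partialSum_staircase {w : Equiv.Perm (Fin L)}
    (h : ∀ k, partialSum (staircase L) k ≤ partialSum (staircase L ∘ w) k) : w = 1 := by
  have h1 : staircase L ∘ w = staircase L :=
    partialSum_injective fun k => le_antisymm (partialSum_staircase_comp_le w k) (h k)
  ext x
  rw [staircase_strictAnti.injective (congrFun h1 x)]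
  rfl

theorem detExpand_self {T : (Fin L → ℕ) → ℂ} {ρ : Fin L → ℕ}
    (hT : ∀ α, ∑ i, α i = ∑ i, ρ i → T α ≠ 0 → ∀ k, partialSum α k ≤ partialSum ρ k) :
    detExpand T ρ = T ρ := by
  rw [detExpand, Finset.sum_eq_single 1]
  · have h1 : staircase L ∘ ⇑(1 : Equiv.Perm (Fin L)) = staircase L := rfl
    have h2 : ∀ i, staircase L ((1 : Equiv.Perm (Fin L)) i) ≤ ρ i + staircase L i :=
      fun i => Nat.le_add_left _ _
    rw [h1, if_pos h2, add_tsub_cancel_right]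
    simp
  · intro w _ hw
    by_contra h
    have hw' := right_ne_zero_of_mul h
    rw [ne_eq, ite_eq_right_iff, Classical.not_imp] at hw'
    refine hw (eq_one_of_partialSum_staircase fun k => ?_)
    have h1 := hT _ (sum_shift_eq hw'.1) hw'.2 k
    have h2 := partialSum_shift hw'.1 k
    omega
  · simp

theorem sum_mul_frobChar {n : ℕ} (F : n.Partition → ℂ) (ρ : Fin L → ℕ) :
    ∑ η : n.Partition, F η * frobChar ρ η.parts / zee η =
      detExpand (fun α => ∑ η : n.Partition, F η * permChar α η.parts / zee η) ρ := by
  simp only [frobChar_eq, detExpand]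
  simp only [Finset.mul_sum, Finset.sum_div]
  rw [Finset.sum_comm]
  refine Finset.sum_congr rfl fun w _ => ?_
  split_ifs
  · rw [Finset.mul_sum]
    exact Finset.sum_congr rfl fun η _ => by ring
  · simp

end Frobenius

/-! ### Rows of the diagram and completeness of the Frobenius characters -/

section Rows

variable {n : ℕ}

theorem sort_parts_pos (ρ : n.Partition) : ∀ x ∈ ρ.parts.sort (· ≥ ·), 0 < x := fun _ hx =>
  ρ.parts_pos ((Multiset.mem_sort (· ≥ ·)).mp hx)

theorem rowLens_diagram (ρ : n.Partition) :
    (diagram ρ).rowLens = ρ.parts.sort (· ≥ ·) :=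
  YoungDiagram.rowLens_ofRowLens_eq_self (sort_parts_pos ρ)

theorem diagram_injective : Function.Injective (diagram : n.Partition → YoungDiagram) := by
  intro ρ σ h
  apply Nat.Partition.ext
  rw [← Multiset.sort_eq ρ.parts (· ≥ ·), ← Multiset.sort_eq σ.parts (· ≥ ·), ← rowLens_diagram,
    ← rowLens_diagram, h]

theorem colLen_zero_diagram (ρ : n.Partition) : (diagram ρ).colLen 0 = len ρ := by
  rw [← YoungDiagram.length_rowLens, rowLens_diagram, Multiset.length_sort, len]

theorem rowLen_diagram_eq_zero {ρ : n.Partition} {i : ℕ} (hi : len ρ ≤ i) :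
    (diagram ρ).rowLen i = 0 := by
  by_contra h
  have h1 : (i, 0) ∈ diagram ρ := YoungDiagram.mem_iff_lt_rowLen.mpr (Nat.pos_of_ne_zero h)
  rw [YoungDiagram.mem_iff_lt_colLen, colLen_zero_diagram] at h1
  omega

theorem len_le (ρ : n.Partition) : len ρ ≤ n := by
  have h := Multiset.card_nsmul_le_sum (s := ρ.parts) (a := 1) fun x hx => ρ.parts_pos hx
  rw [ρ.parts_sum] at h
  simpa [len] using h

/-- The row lengths of a partition, padded to `L` entries. -/
def rows (L : ℕ) (ρ : n.Partition) (i : Fin L) : ℕ := (diagram ρ).rowLen i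

theorem rows_antitone (L : ℕ) (ρ : n.Partition) : Antitone (rows L ρ) := fun i j h =>
  (diagram ρ).rowLen_anti i j h

theorem card_filter_cells_row (Y : YoungDiagram) (i : ℕ) :
    (Y.cells.filter fun c => c.1 = i).card = Y.rowLen i := by
  rw [YoungDiagram.rowLen_eq_card]
  rfl

theorem sum_rows {L : ℕ} {ρ : n.Partition} (hL : len ρ ≤ L) : ∑ i, rows L ρ i = n := by
  have h : ∀ c ∈ (diagram ρ).cells, c.1 ∈ Finset.range L := by
    intro c hc
    have h1 : (c.1, c.2) ∈ diagram ρ := hc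
    rw [YoungDiagram.mem_iff_lt_rowLen] at h1
    rw [Finset.mem_range]
    by_contra h2
    rw [rowLen_diagram_eq_zero (by omega)] at h1
    omega
  conv_rhs => rw [← card_cells_diagram ρ, Finset.card_eq_sum_card_fiberwise h]
  rw [← Fin.sum_univ_eq_sum_range (fun i => ((diagram ρ).cells.filter fun c => c.1 = i).card)]
  exact Finset.sum_congr rfl fun i _ => (card_filter_cells_row _ _).symm

theorem rows_injective : Function.Injective (rows n : n.Partition → Fin n → ℕ) := by
  intro ρ σ h
  apply diagram_injective
  ext ⟨i, j⟩
  rw [YoungDiagram.mem_cells, YoungDiagram.mem_cells, YoungDiagram.mem_iff_lt_rowLen,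
    YoungDiagram.mem_iff_lt_rowLen]
  rcases Nat.lt_or_ge i n with hi | hi
  · rw [show (diagram ρ).rowLen i = _ from congrFun h ⟨i, hi⟩]
    rfl
  · rw [rowLen_diagram_eq_zero ((len_le ρ).trans hi), rowLen_diagram_eq_zero ((len_le σ).trans hi)]

/-- The Frobenius character of `ρ`, as a function of the cycle type. -/
def frob (ρ η : n.Partition) : ℂ := frobChar (rows n ρ) η.parts

theorem sum_frob_mul_frob [DecidableEq n.Partition] (ρ σ : n.Partition) :
    ∑ η, frob ρ η * frob σ η / zee η = if ρ = σ then 1 else 0 := by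
  have hT : ∀ τ : n.Partition, ∀ α : Fin n → ℕ, ∑ i, α i = n →
      ∑ η : n.Partition, frob τ η * permChar α η.parts / zee η ≠ 0 →
      ∀ k, partialSum α k ≤ partialSum (rows n τ) k := by
    intro τ α hα h k
    refine partialSum_le_of_sum_permChar_mul_frobChar (rows_antitone n τ) hα ?_ k
    simpa only [frob, mul_comm (permChar α _)] using h
  have hle : ∀ ρ σ : n.Partition, ∑ η, frob ρ η * frob σ η / zee η ≠ 0 →
      ∀ k, partialSum (rows n σ) k ≤ partialSum (rows n ρ) k := by
    intro ρ σ h k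
    simp only [frob.eq_def σ, sum_mul_frobChar] at h
    refine partialSum_le_of_detExpand (fun α hα => hT ρ α ?_) h k
    rw [hα, sum_rows (len_le σ)]
  split_ifs with h
  · subst h
    simp only [frob.eq_def ρ, sum_mul_frobChar]
    rw [detExpand_self]
    · simp only [mul_comm (frobChar _ _)]
      exact sum_permChar_self_mul_frobChar (rows_antitone n ρ) (sum_rows (len_le ρ))
    · intro α hα
      refine hT ρ α ?_
      rw [hα, sum_rows (len_le ρ)]
  · by_contra h0
    refine h (rows_injective (partialSum_injective fun k => le_antisymm (hle σ ρ ?_ k)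
      (hle ρ σ h0 k)))
    simpa only [mul_comm (frob σ _)] using h0

/-- Completeness of the Frobenius characters in the space of class functions. -/
theorem eq_sum_frob (F : n.Partition → ℂ) (η : n.Partition) :
    F η = ∑ ρ, (∑ θ, F θ * frob ρ θ / zee θ) * frob ρ η := by
  classical
  let A : Matrix n.Partition n.Partition ℂ := Matrix.of fun ρ η => frob ρ η
  let B : Matrix n.Partition n.Partition ℂ := Matrix.of fun η ρ => frob ρ η / zee η
  have h : A * B = 1 := by
    ext ρ σ
    rw [Matrix.mul_apply, Matrix.one_apply, ← sum_frob_mul_frob]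
    exact Finset.sum_congr rfl fun θ _ => by simp only [A, B, Matrix.of_apply]; ring
  have h' : B * A = 1 := mul_eq_one_comm.mp h
  have h2 : F = Matrix.vecMul (Matrix.vecMul F B) A := by
    rw [Matrix.vecMul_vecMul, h', Matrix.vecMul_one]
  conv_lhs => rw [h2]
  simp only [Matrix.vecMul, dotProduct, A, B, Matrix.of_apply]
  exact Finset.sum_congr rfl fun ρ _ => by
    congr 1
    exact Finset.sum_congr rfl fun θ _ => by ring

end Rows

/-! ### Cycle types of permutations -/

section CycleType

variable {n : ℕ} {α : Type*} [Fintype α] [DecidableEq α]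

/-- The cycle type of a permutation of a set with `n` elements. -/
def cyclePartition (hα : Fintype.card α = n) (σ : Equiv.Perm α) : n.Partition where
  parts := σ.partition.parts
  parts_pos := σ.partition.parts_pos
  parts_sum := by rw [σ.partition.parts_sum, hα]

theorem parts_eq_filter_add (η : n.Partition) :
    η.parts = η.parts.filter (2 ≤ ·) +
      Multiset.replicate (n - (η.parts.filter (2 ≤ ·)).sum) 1 := by
  have hsplit : η.parts.filter (2 ≤ ·) + Multiset.replicate (η.parts.count 1) 1 = η.parts := by
    rw [← Multiset.filter_eq' η.parts 1]
    conv_rhs => rw [← Multiset.filter_add_not (2 ≤ ·) η.parts]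
    congr 1
    refine Multiset.filter_congr fun x hx => ?_
    have := η.parts_pos hx
    omega
  have hsum : (η.parts.filter (2 ≤ ·)).sum + η.parts.count 1 = n := by
    have := congrArg Multiset.sum hsplit
    simpa [η.parts_sum] using this
  conv_lhs => rw [← hsplit]
  congr 2
  omega

theorem cyclePartition_eq_iff (hα : Fintype.card α = n) (σ : Equiv.Perm α) (η : n.Partition) :
    cyclePartition hα σ = η ↔ σ.cycleType = η.parts.filter (2 ≤ ·) := by
  constructor
  · rintro rfl
    exact (Equiv.Perm.filter_parts_partition_eq_cycleType).symm
  · intro h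
    apply Nat.Partition.ext
    rw [parts_eq_filter_add η, ← h]
    change σ.partition.parts = _
    rw [Equiv.Perm.parts_partition, ← Equiv.Perm.sum_cycleType, hα]

theorem centralizerOrder_eq (s : Multiset ℕ) :
    centralizerOrder s = s.prod * ∏ j ∈ s.toFinset, (s.count j).factorial := by
  rw [centralizerOrder, Finset.prod_mul_distrib, mul_comm, Finset.prod_multiset_count]

theorem centralizerOrder_add_replicate {s : Multiset ℕ} (hs : 1 ∉ s) (c : ℕ) :
    centralizerOrder (s + Multiset.replicate c 1) = c.factorial * centralizerOrder s := by
  induction c with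
  | zero => simp
  | succ c ih =>
    rw [Multiset.replicate_succ, Multiset.add_cons, centralizerOrder_cons, ih, Multiset.count_add,
      Multiset.count_eq_zero_of_notMem hs, Multiset.count_replicate_self, Nat.factorial_succ]
    ring

theorem card_cyclePartition_mul (hα : Fintype.card α = n) (η : n.Partition) :
    (Finset.univ.filter fun σ : Equiv.Perm α => cyclePartition hα σ = η).card * zee η =
      n.factorial := by
  have h := Equiv.Perm.card_of_cycleType_mul_eq α (η.parts.filter (2 ≤ ·))
  have hle : (η.parts.filter (2 ≤ ·)).sum ≤ n := by
    conv_rhs => rw [← η.parts_sum]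
    conv_rhs => rw [← Multiset.filter_add_not (2 ≤ ·) η.parts, Multiset.sum_add]
    omega
  rw [if_pos ⟨by rw [hα]; exact hle, fun a ha => (Multiset.mem_filter.mp ha).2⟩, hα] at h
  rw [← h]
  congr 1
  · congr 1
    ext σ
    simp only [Finset.mem_filter, Finset.mem_univ, true_and]
    exact cyclePartition_eq_iff hα σ η
  · rw [zee_eq, parts_eq_filter_add η, centralizerOrder_add_replicate (by simp),
      centralizerOrder_eq, mul_assoc]
    rw [← parts_eq_filter_add η]

theorem sum_cyclePartition (hα : Fintype.card α = n) (F : n.Partition → ℂ) :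
    ∑ σ : Equiv.Perm α, F (cyclePartition hα σ) = n.factorial * ∑ η, F η / zee η := by
  rw [← Finset.sum_fiberwise Finset.univ (cyclePartition hα), Finset.mul_sum]
  refine Finset.sum_congr rfl fun η _ => ?_
  rw [Finset.sum_congr rfl (g := fun _ => F η), Finset.sum_const, nsmul_eq_mul,
    ← card_cyclePartition_mul hα η]
  · have := zee_ne_zero η
    push_cast
    field_simp
  · intro σ hσ
    rw [(Finset.mem_filter.mp hσ).2]

theorem cyclePartition_conj (hα : Fintype.card α = n) (σ τ : Equiv.Perm α) :
    cyclePartition hα (τ * σ * τ⁻¹) = cyclePartition hα σ := by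
  rw [cyclePartition_eq_iff, Equiv.Perm.cycleType_conj, ← cyclePartition_eq_iff hα]

theorem cyclePartition_inv (hα : Fintype.card α = n) (σ : Equiv.Perm α) :
    cyclePartition hα σ⁻¹ = cyclePartition hα σ := by
  rw [cyclePartition_eq_iff, Equiv.Perm.cycleType_inv, ← cyclePartition_eq_iff hα]

/-- The cycle of `σ` through the points of an orbit. -/
def orbitCycle (σ : Equiv.Perm α) : Quotient (Equiv.Perm.SameCycle.setoid σ) → Equiv.Perm α :=
  Quotient.lift σ.cycleOf fun _ _ h => Equiv.Perm.SameCycle.cycleOf_eq h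

omit [Fintype α] [DecidableEq α] in
theorem mk_eq_mk_iff (σ : Equiv.Perm α) (x y : α) :
    (Quotient.mk (Equiv.Perm.SameCycle.setoid σ) y = Quotient.mk _ x) ↔ σ.SameCycle x y := by
  rw [Quotient.eq]
  exact Equiv.Perm.sameCycle_comm

open Classical in
/-- The parts of the cycle type are the sizes of the orbits. -/
theorem prod_orbit_card {M : Type*} [CommMonoid M] (σ : Equiv.Perm α) (G : ℕ → M) :
    ∏ q : Quotient (Equiv.Perm.SameCycle.setoid σ),
        G (Finset.univ.filter fun x => Quotient.mk _ x = q).card =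
      (σ.partition.parts.map G).prod := by
  rw [Equiv.Perm.parts_partition, Equiv.Perm.cycleType_def, Multiset.map_add, Multiset.prod_add,
    Multiset.map_map, Multiset.map_replicate, Multiset.prod_replicate,
    ← Finset.prod_filter_mul_prod_filter_not Finset.univ fun q => orbitCycle σ q ≠ 1]
  congr 1
  · refine Finset.prod_bij (fun q _ => orbitCycle σ q) ?_ ?_ ?_ ?_
    · intro q hq
      induction q using Quotient.inductionOn with
      | _ x => exact Equiv.Perm.cycleOf_ne_one_iff_mem_cycleFactorsFinset.mp
                (Finset.mem_filter.mp hq).2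
    · intro q hq q' _ h
      induction q using Quotient.inductionOn with
      | _ x =>
        induction q' using Quotient.inductionOn with
        | _ y =>
          have hx : x ∈ σ.support := by
            rw [Equiv.Perm.mem_support]
            exact fun h => (Finset.mem_filter.mp hq).2 ((Equiv.Perm.cycleOf_eq_one_iff σ).mpr h)
          refine Quotient.sound ?_
          have hy : y ∈ (σ.cycleOf y).support := by
            rw [Equiv.Perm.mem_support_cycleOf_iff]
            refine ⟨Equiv.Perm.SameCycle.refl _ _, ?_⟩
            rw [Equiv.Perm.mem_support]
            intro hy
            refine (Finset.mem_filter.mp hq).2 (h.trans ((Equiv.Perm.cycleOf_eq_one_iff σ).mpr hy))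
          have h' : σ.cycleOf x = σ.cycleOf y := h
          rw [← h', Equiv.Perm.mem_support_cycleOf_iff] at hy
          exact hy.1
    · intro c hc
      obtain ⟨x, hx⟩ := Finset.nonempty_iff_ne_empty.mpr
        (fun h => (Equiv.Perm.mem_cycleFactorsFinset_iff.mp hc).1.ne_one
          (Equiv.Perm.support_eq_empty_iff.mp h))
      have h1 : c = σ.cycleOf x := Equiv.Perm.cycle_is_cycleOf hx hc
      refine ⟨Quotient.mk _ x, Finset.mem_filter.mpr ⟨Finset.mem_univ _, ?_⟩, h1.symm⟩
      change σ.cycleOf x ≠ 1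
      rw [← h1]
      exact (Equiv.Perm.mem_cycleFactorsFinset_iff.mp hc).1.ne_one
    · intro q hq
      induction q using Quotient.inductionOn with
      | _ x =>
        have hx : x ∈ σ.support := by
          rw [Equiv.Perm.mem_support]
          exact fun h => (Finset.mem_filter.mp hq).2 ((Equiv.Perm.cycleOf_eq_one_iff σ).mpr h)
        change _ = G (σ.cycleOf x).support.card
        congr 2
        ext y
        rw [Finset.mem_filter, Equiv.Perm.mem_support_cycleOf_iff, mk_eq_mk_iff]
        simp [hx]
  · rw [← Finset.card_univ, ← Finset.card_sdiff_of_subset (Finset.subset_univ _)]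
    have h1 : ∀ x, x ∉ σ.support → ∀ y, σ.SameCycle x y → x = y := by
      intro x hx y h
      exact h.eq_of_left (Equiv.Perm.notMem_support.mp hx)
    rw [Finset.prod_congr rfl (g := fun _ => G 1), Finset.prod_const]
    · congr 1
      symm
      refine Finset.card_bij (fun x _ => Quotient.mk _ x) ?_ ?_ ?_
      · intro x hx
        rw [Finset.mem_filter, not_not]
        refine ⟨Finset.mem_univ _, (Equiv.Perm.cycleOf_eq_one_iff σ).mpr ?_⟩
        exact Equiv.Perm.notMem_support.mp (Finset.mem_sdiff.mp hx).2
      · intro x hx y _ h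
        exact h1 x (Finset.mem_sdiff.mp hx).2 y (((mk_eq_mk_iff σ x y).mp h.symm))
      · intro q hq
        induction q using Quotient.inductionOn with
        | _ x =>
          rw [Finset.mem_filter, not_not] at hq
          refine ⟨x, Finset.mem_sdiff.mpr ⟨Finset.mem_univ _, ?_⟩, rfl⟩
          exact Equiv.Perm.notMem_support.mpr ((Equiv.Perm.cycleOf_eq_one_iff σ).mp hq.2)
    · intro q hq
      induction q using Quotient.inductionOn with
      | _ x =>
        rw [Finset.mem_filter, not_not] at hq
        have hx : x ∉ σ.support :=
          Equiv.Perm.notMem_support.mpr ((Equiv.Perm.cycleOf_eq_one_iff σ).mp hq.2)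
        congr 1
        rw [Finset.card_eq_one]
        refine ⟨x, ?_⟩
        ext y
        rw [Finset.mem_filter, mk_eq_mk_iff, Finset.mem_singleton]
        refine ⟨fun h => (h1 x hx y h.2).symm, ?_⟩
        rintro rfl
        exact ⟨Finset.mem_univ _, Equiv.Perm.SameCycle.refl _ _⟩

theorem apply_eq_of_sameCycle {β : Type*} {σ : Equiv.Perm α} {f : α → β} (hf : ∀ x, f (σ x) = f x)
    {x y : α} (h : σ.SameCycle x y) : f x = f y := by
  obtain ⟨i, -, -, rfl⟩ := h.exists_pow_eq
  induction i with
  | zero => rfl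
  | succ i ih => rw [pow_succ', Equiv.Perm.mul_apply, hf, ih ⟨i, by simp⟩]

theorem powerSum_eq_sum_colourings (L : ℕ) (σ : Equiv.Perm α) :
    powerSum ℂ L σ.partition.parts =
      ∑ f : α → Fin L with ∀ x, f (σ x) = f x, ∏ x, MvPolynomial.X (f x) := by
  classical
  rw [powerSum, ← prod_orbit_card]
  simp only [MvPolynomial.psum]
  rw [Finset.prod_univ_sum, Fintype.piFinset_univ]
  refine Finset.sum_bij (fun g _ x => g (Quotient.mk _ x)) ?_ ?_ ?_ ?_
  · intro g _
    refine Finset.mem_filter.mpr ⟨Finset.mem_univ _, fun x => ?_⟩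
    exact congrArg g ((mk_eq_mk_iff σ x (σ x)).mpr ⟨1, by simp⟩)
  · intro g _ g' _ h
    funext q
    induction q using Quotient.inductionOn with
    | _ x => exact congrFun h x
  · intro f hf
    exact ⟨Quotient.lift f fun x y h => apply_eq_of_sameCycle (Finset.mem_filter.mp hf).2 h,
      Finset.mem_univ _, rfl⟩
  · intro g _
    rw [← Finset.prod_fiberwise Finset.univ (Quotient.mk (Equiv.Perm.SameCycle.setoid σ))]
    refine Finset.prod_congr rfl fun q _ => ?_
    rw [Finset.prod_congr rfl (g := fun _ => MvPolynomial.X (g q)), Finset.prod_const]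
    intro x hx
    exact congrArg (fun q => MvPolynomial.X (g q)) (Finset.mem_filter.mp hx).2

/-- The colourings with `μ_i` points of colour `i`. -/
def colourings (α : Type*) [Fintype α] [DecidableEq α] {L : ℕ} (μ : Fin L → ℕ) :
    Finset (α → Fin L) :=
  Finset.univ.filter fun f => ∀ i, (Finset.univ.filter fun x => f x = i).card = μ i

theorem permChar_partition {L : ℕ} (μ : Fin L → ℕ) (σ : Equiv.Perm α) :
    permChar μ σ.partition.parts =
      ∑ f ∈ colourings α μ, if ∀ x, f (σ x) = f x then 1 else 0 := by
  classical
  rw [permChar, powerSum_eq_sum_colourings, MvPolynomial.coeff_sum, Finset.sum_filter,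
    colourings, Finset.sum_filter]
  refine Finset.sum_congr rfl fun f _ => ?_
  have h1 : (∏ x, MvPolynomial.X (f x) : MvPolynomial (Fin L) ℂ) =
      MvPolynomial.monomial (expVec fun i => (Finset.univ.filter fun x => f x = i).card) 1 := by
    rw [MvPolynomial.monomial_eq, map_one, one_mul, Finsupp.prod_fintype _ _ (by simp),
      ← Finset.prod_fiberwise Finset.univ f]
    refine Finset.prod_congr rfl fun i _ => ?_
    rw [Finset.prod_congr rfl (g := fun _ => MvPolynomial.X i), Finset.prod_const]
    · rfl
    · intro x hx
      rw [(Finset.mem_filter.mp hx).2]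
  rw [h1, MvPolynomial.coeff_monomial]
  simp only [EmbeddingLike.apply_eq_iff_eq, funext_iff]
  split_ifs <;> rfl

end CycleType

/-! ### Column-injective fillings -/

section Filling

variable {Y : YoungDiagram}

/-- A filling of the boxes with distinct entries in each column. -/
def ColumnInjective (f : {c : ℕ × ℕ // c ∈ Y.cells} → ℕ) : Prop :=
  ∀ c d, c.1.2 = d.1.2 → f c = f d → c = d

theorem val_snd_mem_range (c : {c : ℕ × ℕ // c ∈ Y.cells}) :
    c.1.2 ∈ Finset.range (Y.rowLen 0) := by
  have h : (c.1.1, c.1.2) ∈ Y := c.2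
  rw [YoungDiagram.mem_iff_lt_rowLen] at h
  exact Finset.mem_range.mpr (h.trans_le (Y.rowLen_anti 0 _ (Nat.zero_le _)))

theorem fst_lt_colLen (c : {c : ℕ × ℕ // c ∈ Y.cells}) : c.1.1 < Y.colLen c.1.2 := by
  have h : (c.1.1, c.1.2) ∈ Y := c.2
  rwa [YoungDiagram.mem_iff_lt_colLen] at h

theorem card_column (j : ℕ) :
    (Finset.univ.filter fun c : {c : ℕ × ℕ // c ∈ Y.cells} => c.1.2 = j).card = Y.colLen j := by
  rw [YoungDiagram.colLen_eq_card, ← Finset.card_map (Function.Embedding.subtype _)]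
  congr 1
  ext c
  simp only [Finset.mem_map, Finset.mem_filter, Finset.mem_univ, true_and, YoungDiagram.mem_col_iff,
    Function.Embedding.coe_subtype, Subtype.exists, exists_and_right, exists_eq_right]
  exact ⟨fun ⟨h, h'⟩ => ⟨h, h'⟩, fun ⟨h, h'⟩ => ⟨h, h'⟩⟩

theorem card_column_lt (j k : ℕ) :
    (Finset.univ.filter fun c : {c : ℕ × ℕ // c ∈ Y.cells} => c.1.1 < k ∧ c.1.2 = j).card =
      min k (Y.colLen j) := by
  rw [← Finset.card_range (min k (Y.colLen j))]
  refine Finset.card_bij (fun c _ => c.1.1) ?_ ?_ ?_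
  · intro c hc
    obtain ⟨-, h1, h2⟩ := Finset.mem_filter.mp hc
    rw [Finset.mem_range, lt_min_iff, ← h2]
    exact ⟨h1, fst_lt_colLen c⟩
  · intro c hc d hd h
    obtain ⟨-, -, h1⟩ := Finset.mem_filter.mp hc
    obtain ⟨-, -, h2⟩ := Finset.mem_filter.mp hd
    exact Subtype.ext (Prod.ext h (h1.trans h2.symm))
  · intro i hi
    rw [Finset.mem_range, lt_min_iff] at hi
    exact ⟨⟨(i, j), YoungDiagram.mem_iff_lt_colLen.mpr hi.2⟩, by simp [hi.1], rfl⟩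

theorem ColumnInjective.card_column_le {f : {c : ℕ × ℕ // c ∈ Y.cells} → ℕ}
    (hf : ColumnInjective f) (j k : ℕ) :
    (Finset.univ.filter fun c => f c < k ∧ c.1.2 = j).card ≤ min k (Y.colLen j) := by
  refine le_min ?_ ?_
  · conv_rhs => rw [← Finset.card_range k]
    refine Finset.card_le_card_of_injOn f (fun c hc => ?_) fun c hc d hd h => ?_
    · exact Finset.mem_coe.mpr (Finset.mem_range.mpr (Finset.mem_filter.mp hc).2.1)
    · exact hf c d ((Finset.mem_filter.mp hc).2.2.trans (Finset.mem_filter.mp hd).2.2.symm) h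
  · rw [← card_column]
    refine Finset.card_le_card fun c hc => ?_
    exact Finset.mem_filter.mpr ⟨Finset.mem_univ _, (Finset.mem_filter.mp hc).2.2⟩

theorem card_filter_eq_sum_columns (p : {c : ℕ × ℕ // c ∈ Y.cells} → Prop) [DecidablePred p] :
    (Finset.univ.filter p).card =
      ∑ j ∈ Finset.range (Y.rowLen 0), (Finset.univ.filter fun c => p c ∧ c.1.2 = j).card := by
  rw [Finset.card_eq_sum_card_fiberwise fun c _ => val_snd_mem_range c]
  simp only [Finset.filter_filter]

theorem ColumnInjective.card_lt_le {f : {c : ℕ × ℕ // c ∈ Y.cells} → ℕ}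
    (hf : ColumnInjective f) (k : ℕ) :
    (Finset.univ.filter fun c => f c < k).card ≤
      (Finset.univ.filter fun c : {c : ℕ × ℕ // c ∈ Y.cells} => c.1.1 < k).card := by
  rw [card_filter_eq_sum_columns, card_filter_eq_sum_columns]
  refine Finset.sum_le_sum fun j _ => ?_
  rw [card_column_lt]
  exact hf.card_column_le j k

theorem ColumnInjective.lt_colLen {f : {c : ℕ × ℕ // c ∈ Y.cells} → ℕ}
    (hf : ColumnInjective f)
    (h : ∀ k, (Finset.univ.filter fun c => f c < k).card =
      (Finset.univ.filter fun c : {c : ℕ × ℕ // c ∈ Y.cells} => c.1.1 < k).card)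
    (c : {c : ℕ × ℕ // c ∈ Y.cells}) : f c < Y.colLen c.1.2 := by
  have h1 := h (Y.colLen c.1.2)
  rw [card_filter_eq_sum_columns, card_filter_eq_sum_columns] at h1
  simp only [card_column_lt] at h1
  have h2 := (Finset.sum_eq_sum_iff_of_le fun j _ => hf.card_column_le j _).mp h1 _
    (val_snd_mem_range c)
  rw [min_self] at h2
  have h3 := Finset.eq_of_subset_of_card_le
    (s := Finset.univ.filter fun d => f d < Y.colLen c.1.2 ∧ d.1.2 = c.1.2)
    (t := Finset.univ.filter fun d : {c : ℕ × ℕ // c ∈ Y.cells} => d.1.2 = c.1.2)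
    (fun d hd => Finset.mem_filter.mpr ⟨Finset.mem_univ _, (Finset.mem_filter.mp hd).2.2⟩)
    (by rw [h2, card_column])
  have h4 : c ∈ Finset.univ.filter fun d : {c : ℕ × ℕ // c ∈ Y.cells} => d.1.2 = c.1.2 := by simp
  rw [← h3] at h4
  exact (Finset.mem_filter.mp h4).2.1

/-- A column-injective filling with as many entries `i` as there are boxes in row `i` comes from
the row filling by a permutation of the columns. -/
theorem ColumnInjective.exists_perm {f : {c : ℕ × ℕ // c ∈ Y.cells} → ℕ}
    (hf : ColumnInjective f)
    (h : ∀ k, (Finset.univ.filter fun c => f c < k).card =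
      (Finset.univ.filter fun c : {c : ℕ × ℕ // c ∈ Y.cells} => c.1.1 < k).card) :
    ∃ y : BoxPerm Y, (∀ c, (y c).1.2 = c.1.2) ∧ ∀ c, (y c).1.1 = f c := by
  let g : {c : ℕ × ℕ // c ∈ Y.cells} → {c : ℕ × ℕ // c ∈ Y.cells} := fun c =>
    ⟨(f c, c.1.2), YoungDiagram.mem_iff_lt_colLen.mpr (hf.lt_colLen h c)⟩
  have hg : Function.Injective g := by
    intro c d hcd
    have h1 := congrArg (fun x => x.1.1) hcd
    have h2 := congrArg (fun x => x.1.2) hcd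
    exact hf c d h2 h1
  exact ⟨Equiv.ofBijective g (Finite.injective_iff_bijective.mp hg), fun _ => rfl, fun _ => rfl⟩

end Filling

/-! ### The group algebra -/

section GroupAlgebra

variable {G : Type*} [Group G] [Fintype G]

theorem coeff_mul_one (u v : MonoidAlgebra ℂ G) :
    (u * v).coeff 1 = ∑ g, u.coeff g * v.coeff g⁻¹ := by
  classical
  have h : u = ∑ g, MonoidAlgebra.single g (u.coeff g) := by
    ext x
    simp
  conv_lhs => rw [h, Finset.sum_mul]
  rw [MonoidAlgebra.coeff_sum, Finsupp.finsetSum_apply]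
  exact Finset.sum_congr rfl fun g _ => by simp

theorem coeff_mul_one_comm (u v : MonoidAlgebra ℂ G) : (u * v).coeff 1 = (v * u).coeff 1 := by
  rw [coeff_mul_one, coeff_mul_one]
  refine Fintype.sum_equiv (Equiv.inv G) _ _ fun g => ?_
  simp [mul_comm]

theorem trace_mulLeft_mulRight (g : G) (e : MonoidAlgebra ℂ G) :
    LinearMap.trace ℂ (MonoidAlgebra ℂ G)
      (LinearMap.mulLeft ℂ (MonoidAlgebra.single g 1) ∘ₗ LinearMap.mulRight ℂ e) =
      ∑ x, e.coeff (x⁻¹ * g⁻¹ * x) := by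
  classical
  rw [LinearMap.trace_eq_matrix_trace ℂ (MonoidAlgebra.basis G ℂ), Matrix.trace]
  refine Finset.sum_congr rfl fun x _ => ?_
  rw [Matrix.diag_apply, LinearMap.toMatrix_apply]
  simp [MonoidAlgebra.basis, ← mul_assoc, MonoidAlgebra.single_mul_single]

end GroupAlgebra

/-! ### Young symmetrizers -/

section Young

variable {Y : YoungDiagram}

open Classical in
/-- The permutations that preserve every row. -/
def rowSet (Y : YoungDiagram) : Finset (BoxPerm Y) :=
  Finset.univ.filter fun σ => ∀ c, (σ c).1.1 = c.1.1

open Classical in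
/-- The permutations that preserve every column. -/
def colSet (Y : YoungDiagram) : Finset (BoxPerm Y) :=
  Finset.univ.filter fun σ => ∀ c, (σ c).1.2 = c.1.2

/-- The sign of a permutation as a complex number. -/
def csign {α : Type*} [Fintype α] [DecidableEq α] (σ : Equiv.Perm α) : ℂ :=
  ((Equiv.Perm.sign σ : ℤˣ) : ℤ)

theorem csign_mul {α : Type*} [Fintype α] [DecidableEq α] (σ τ : Equiv.Perm α) :
    csign (σ * τ) = csign σ * csign τ := by
  simp [csign]

theorem csign_inv {α : Type*} [Fintype α] [DecidableEq α] (σ : Equiv.Perm α) :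
    csign σ⁻¹ = csign σ := by
  simp [csign]

theorem csign_mul_self {α : Type*} [Fintype α] [DecidableEq α] (σ : Equiv.Perm α) :
    csign σ * csign σ = 1 := by
  rw [← csign_mul, csign, Equiv.Perm.sign_mul, Int.units_mul_self]
  simp

theorem mem_rowSet {σ : BoxPerm Y} : σ ∈ rowSet Y ↔ ∀ c, (σ c).1.1 = c.1.1 := by
  simp [rowSet]

theorem mem_colSet {σ : BoxPerm Y} : σ ∈ colSet Y ↔ ∀ c, (σ c).1.2 = c.1.2 := by
  simp [colSet]

theorem mul_mem_rowSet {σ τ : BoxPerm Y} (hσ : σ ∈ rowSet Y) (hτ : τ ∈ rowSet Y) :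
    σ * τ ∈ rowSet Y := by
  rw [mem_rowSet] at *
  exact fun c => (hσ _).trans (hτ c)

theorem mul_mem_colSet {σ τ : BoxPerm Y} (hσ : σ ∈ colSet Y) (hτ : τ ∈ colSet Y) :
    σ * τ ∈ colSet Y := by
  rw [mem_colSet] at *
  exact fun c => (hσ _).trans (hτ c)

theorem inv_mem_rowSet {σ : BoxPerm Y} (hσ : σ ∈ rowSet Y) : σ⁻¹ ∈ rowSet Y := by
  rw [mem_rowSet] at *
  intro c
  conv_rhs => rw [← show σ (σ⁻¹ c) = c from σ.apply_symm_apply c, hσ]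

theorem inv_mem_colSet {σ : BoxPerm Y} (hσ : σ ∈ colSet Y) : σ⁻¹ ∈ colSet Y := by
  rw [mem_colSet] at *
  intro c
  conv_rhs => rw [← show σ (σ⁻¹ c) = c from σ.apply_symm_apply c, hσ]

theorem rowSymmetrizer_eq :
    rowSymmetrizer Y = ∑ σ ∈ rowSet Y, MonoidAlgebra.single σ 1 := rfl

theorem colAntisymmetrizer_eq :
    colAntisymmetrizer Y = ∑ σ ∈ colSet Y, MonoidAlgebra.single σ (csign σ) := rfl

theorem rowSymmetrizer_mul_single {r : BoxPerm Y} (hr : r ∈ rowSet Y) :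
    rowSymmetrizer Y * MonoidAlgebra.single r 1 = rowSymmetrizer Y := by
  rw [rowSymmetrizer_eq, Finset.sum_mul]
  refine Finset.sum_bij' (fun σ _ => σ * r) (fun σ _ => σ * r⁻¹)
    (fun σ hσ => mul_mem_rowSet hσ hr) (fun σ hσ => mul_mem_rowSet hσ (inv_mem_rowSet hr))
    (by simp) (by simp) (by simp)

theorem single_mul_colAntisymmetrizer {t : BoxPerm Y} (ht : t ∈ colSet Y) :
    MonoidAlgebra.single t 1 * colAntisymmetrizer Y = csign t • colAntisymmetrizer Y := by
  rw [colAntisymmetrizer_eq, Finset.mul_sum, Finset.smul_sum]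
  refine Finset.sum_bij' (fun σ _ => t * σ) (fun σ _ => t⁻¹ * σ)
    (fun σ hσ => mul_mem_colSet ht hσ) (fun σ hσ => mul_mem_colSet (inv_mem_colSet ht) hσ)
    (by simp) (by simp) ?_
  intro σ _
  rw [MonoidAlgebra.single_mul_single, MonoidAlgebra.smul_single, smul_eq_mul, csign_mul,
    ← mul_assoc, csign_mul_self]

theorem colAntisymmetrizer_mul_single {t : BoxPerm Y} (ht : t ∈ colSet Y) :
    colAntisymmetrizer Y * MonoidAlgebra.single t 1 = csign t • colAntisymmetrizer Y := by
  rw [colAntisymmetrizer_eq, Finset.sum_mul, Finset.smul_sum]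
  refine Finset.sum_bij' (fun σ _ => σ * t) (fun σ _ => σ * t⁻¹)
    (fun σ hσ => mul_mem_colSet hσ ht) (fun σ hσ => mul_mem_colSet hσ (inv_mem_colSet ht))
    (by simp) (by simp) ?_
  intro σ _
  rw [MonoidAlgebra.single_mul_single, MonoidAlgebra.smul_single, smul_eq_mul, csign_mul,
    mul_left_comm, csign_mul_self, mul_one]

theorem card_filter_apply_lt (g : BoxPerm Y) (k : ℕ) :
    (Finset.univ.filter fun c => (g c).1.1 < k).card =
      (Finset.univ.filter fun c : {c : ℕ × ℕ // c ∈ Y.cells} => c.1.1 < k).card := by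
  refine Finset.card_bij (fun c _ => g c) ?_ (fun _ _ _ _ h => g.injective h) ?_
  · intro c hc
    simpa using hc
  · intro d hd
    exact ⟨g⁻¹ d, by simpa using hd, by simp⟩

theorem rowSymmetrizer_mul_single_mul (g : BoxPerm Y) :
    ∃ k : ℂ, rowSymmetrizer Y * MonoidAlgebra.single g 1 * colAntisymmetrizer Y =
      k • youngSymmetrizer Y := by
  by_cases hf : ColumnInjective fun c => (g c).1.1
  · obtain ⟨y, hy1, hy2⟩ := hf.exists_perm (card_filter_apply_lt g)
    have hr : g * y⁻¹ ∈ rowSet Y := by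
      rw [mem_rowSet]
      intro c
      have := hy2 (y⁻¹ c)
      rw [show y (y⁻¹ c) = c from y.apply_symm_apply c] at this
      exact this.symm
    refine ⟨csign y, ?_⟩
    have hg : MonoidAlgebra.single g (1 : ℂ) =
        MonoidAlgebra.single (g * y⁻¹) 1 * MonoidAlgebra.single y 1 := by
      rw [MonoidAlgebra.single_mul_single]
      simp
    rw [hg, ← mul_assoc, rowSymmetrizer_mul_single hr, mul_assoc,
      single_mul_colAntisymmetrizer (mem_colSet.mpr hy1), mul_smul_comm, youngSymmetrizer]
  · refine ⟨0, ?_⟩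
    simp only [ColumnInjective, not_forall] at hf
    obtain ⟨c, d, hcol, hrow, hne⟩ := hf
    have ht : Equiv.swap c d ∈ colSet Y := by
      rw [mem_colSet]
      intro x
      by_cases h1 : x = c
      · rw [h1, Equiv.swap_apply_left, hcol]
      · by_cases h2 : x = d
        · rw [h2, Equiv.swap_apply_right, hcol]
        · rw [Equiv.swap_apply_of_ne_of_ne h1 h2]
    have hs : Equiv.swap (g c) (g d) ∈ rowSet Y := by
      rw [mem_rowSet]
      intro x
      by_cases h1 : x = g c
      · rw [h1, Equiv.swap_apply_left]
        exact hrow.symm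
      · by_cases h2 : x = g d
        · rw [h2, Equiv.swap_apply_right]
          exact hrow
        · rw [Equiv.swap_apply_of_ne_of_ne h1 h2]
    have h1 : rowSymmetrizer Y * MonoidAlgebra.single g 1 * colAntisymmetrizer Y =
        -(rowSymmetrizer Y * MonoidAlgebra.single g 1 * colAntisymmetrizer Y) := by
      conv_lhs => rw [← rowSymmetrizer_mul_single hs]
      rw [mul_assoc (rowSymmetrizer Y), MonoidAlgebra.single_mul_single,
        ← Equiv.mul_swap_eq_swap_mul, ← MonoidAlgebra.single_mul_single, ← mul_assoc, mul_assoc,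
        single_mul_colAntisymmetrizer ht, csign, Equiv.Perm.sign_swap hne]
      simp
    rw [zero_smul]
    ext x
    have h2 := congrArg (fun u => u.coeff x) h1
    exact self_eq_neg.mp h2

theorem eq_sum_single {G : Type*} [Fintype G] (u : MonoidAlgebra ℂ G) :
    u = ∑ g, MonoidAlgebra.single g (u.coeff g) := by
  classical
  ext x
  simp

theorem rowSymmetrizer_mul_mul (u : MonoidAlgebra ℂ (BoxPerm Y)) :
    ∃ k : ℂ, rowSymmetrizer Y * u * colAntisymmetrizer Y = k • youngSymmetrizer Y := by
  choose k hk using rowSymmetrizer_mul_single_mul (Y := Y)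
  refine ⟨∑ g, u.coeff g * k g, ?_⟩
  conv_lhs => rw [eq_sum_single u, Finset.mul_sum, Finset.sum_mul]
  rw [Finset.sum_smul]
  refine Finset.sum_congr rfl fun g _ => ?_
  have h : MonoidAlgebra.single g (u.coeff g) = u.coeff g • MonoidAlgebra.single g (1 : ℂ) := by
    rw [MonoidAlgebra.smul_single, smul_eq_mul, mul_one]
  rw [h, mul_smul_comm, smul_mul_assoc, hk, smul_smul]

theorem youngSymmetrizer_eq : youngSymmetrizer Y =
    ∑ r ∈ rowSet Y, ∑ c ∈ colSet Y, MonoidAlgebra.single (r * c) (csign c) := by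
  rw [youngSymmetrizer, rowSymmetrizer_eq, colAntisymmetrizer_eq, Finset.sum_mul_sum]
  simp [MonoidAlgebra.single_mul_single]

theorem sum_coeff_youngSymmetrizer (F : BoxPerm Y → ℂ) :
    ∑ g, (youngSymmetrizer Y).coeff g * F g =
      ∑ r ∈ rowSet Y, ∑ c ∈ colSet Y, csign c * F (r * c) := by
  classical
  rw [youngSymmetrizer_eq]
  simp only [MonoidAlgebra.coeff_sum, Finsupp.finsetSum_apply, Finset.sum_mul]
  rw [Finset.sum_comm]
  refine Finset.sum_congr rfl fun r _ => ?_
  rw [Finset.sum_comm]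
  refine Finset.sum_congr rfl fun c _ => ?_
  simp [Finsupp.single_apply]

theorem coeff_youngSymmetrizer (g : BoxPerm Y) :
    (youngSymmetrizer Y).coeff g =
      ∑ r ∈ rowSet Y, ∑ c ∈ colSet Y, if r * c = g then csign c else 0 := by
  have h := sum_coeff_youngSymmetrizer (Y := Y) (fun x => if x = g then 1 else 0)
  simpa using h

theorem one_mem_rowSet : (1 : BoxPerm Y) ∈ rowSet Y := mem_rowSet.mpr fun _ => rfl

theorem one_mem_colSet : (1 : BoxPerm Y) ∈ colSet Y := mem_colSet.mpr fun _ => rfl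

theorem coeff_youngSymmetrizer_one : (youngSymmetrizer Y).coeff 1 = 1 := by
  rw [coeff_youngSymmetrizer, Finset.sum_eq_single 1, Finset.sum_eq_single 1]
  · simp [csign]
  · intro c _ hc
    rw [one_mul, if_neg hc]
  · exact fun h => absurd one_mem_colSet h
  · intro r hr hne
    refine Finset.sum_eq_zero fun c hc => if_neg fun h => hne ?_
    have hrc : r ∈ colSet Y := by
      rw [eq_inv_of_mul_eq_one_left h]
      exact inv_mem_colSet hc
    ext x : 1
    exact Subtype.ext (Prod.ext (mem_rowSet.mp hr x) (mem_colSet.mp hrc x))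
  · exact fun h => absurd one_mem_rowSet h

theorem exists_int_coeff_youngSymmetrizer (g : BoxPerm Y) :
    ∃ z : ℤ, (youngSymmetrizer Y).coeff g = z := by
  rw [coeff_youngSymmetrizer]
  refine ⟨∑ r ∈ rowSet Y, ∑ c ∈ colSet Y, if r * c = g then (Equiv.Perm.sign c : ℤ) else 0, ?_⟩
  push_cast
  rfl

/-- The scalar by which the Young symmetrizer is a multiple of an idempotent. -/
def youngScalar (Y : YoungDiagram) : ℂ :=
  (youngSymmetrizer Y * youngSymmetrizer Y).coeff 1

theorem youngSymmetrizer_mul_mul (x : MonoidAlgebra ℂ (BoxPerm Y)) :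
    youngSymmetrizer Y * x * youngSymmetrizer Y =
      (youngSymmetrizer Y * x * youngSymmetrizer Y).coeff 1 • youngSymmetrizer Y := by
  obtain ⟨k, hk⟩ := rowSymmetrizer_mul_mul (colAntisymmetrizer Y * x * rowSymmetrizer Y)
  have h : youngSymmetrizer Y * x * youngSymmetrizer Y = k • youngSymmetrizer Y := by
    rw [← hk, youngSymmetrizer]
    simp only [mul_assoc]
  rw [h]
  simp [coeff_youngSymmetrizer_one]

theorem youngSymmetrizer_mul_self :
    youngSymmetrizer Y * youngSymmetrizer Y = youngScalar Y • youngSymmetrizer Y := by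
  have h := youngSymmetrizer_mul_mul (Y := Y) 1
  rwa [mul_one] at h

theorem youngScalar_ne_zero : youngScalar Y ≠ 0 := by
  intro h0
  have h1 : LinearMap.mulRight ℂ (youngSymmetrizer Y) ^ 2 = 0 := by
    refine LinearMap.ext fun x => ?_
    change x * youngSymmetrizer Y * youngSymmetrizer Y = 0
    rw [mul_assoc, youngSymmetrizer_mul_self, h0, zero_smul, mul_zero]
  have h2 := (LinearMap.isNilpotent_trace_of_isNilpotent ⟨2, h1⟩).eq_zero
  have h3 := trace_mulLeft_mulRight (1 : BoxPerm Y) (youngSymmetrizer Y)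
  have h4 : LinearMap.mulLeft ℂ (MonoidAlgebra.single (1 : BoxPerm Y) (1 : ℂ)) =
      LinearMap.id := by
    rw [← MonoidAlgebra.one_def, LinearMap.mulLeft_one]
  rw [h4, LinearMap.id_comp, h2] at h3
  simp only [inv_one, mul_one, inv_mul_cancel, coeff_youngSymmetrizer_one, Finset.sum_const,
    nsmul_eq_mul, Finset.card_univ] at h3
  exact Fintype.card_ne_zero (Nat.cast_eq_zero.mp h3.symm)

theorem youngScalar_mul_character (g : BoxPerm Y) :
    youngScalar Y * (spechtRep Y).character g =
      ∑ x, (youngSymmetrizer Y).coeff (x⁻¹ * g⁻¹ * x) := by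
  rw [← trace_mulLeft_mulRight]
  have hmem : ∀ x, (LinearMap.mulLeft ℂ (MonoidAlgebra.single g 1) ∘ₗ
      LinearMap.mulRight ℂ (youngSymmetrizer Y)) x ∈ spechtModule Y := fun x =>
    ⟨MonoidAlgebra.single g 1 * x, by simp [mul_assoc]⟩
  rw [← LinearMap.trace_restrict_eq_of_forall_mem (spechtModule Y) _ hmem,
    Representation.character, ← smul_eq_mul, ← map_smul]
  congr 1
  ext ⟨_, y, rfl⟩ : 2
  simp only [LinearMap.smul_apply, spechtRep, MonoidHom.coe_mk, OneHom.coe_mk,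
    LinearMap.restrict_apply, LinearMap.comp_apply, LinearMap.mulLeft_apply,
    LinearMap.mulRight_apply, SetLike.mk_smul_mk]
  rw [mul_assoc y, youngSymmetrizer_mul_self]
  simp

end Young

/-! ### The characters of the Specht modules -/

section Specht

variable {n : ℕ}

theorem card_boxes (ρ : n.Partition) :
    Fintype.card {c : ℕ × ℕ // c ∈ (diagram ρ).cells} = n := by
  rw [Fintype.card_coe, card_cells_diagram]

theorem character_eq_chi (ρ : n.Partition) (g : BoxPerm (diagram ρ)) :
    (spechtRep (diagram ρ)).character g = chi ρ (cyclePartition (card_boxes ρ) g) :=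
  chi_eq ρ _ g rfl

/-- Pairing with a Specht character evaluates at the Young symmetrizer. -/
theorem youngScalar_mul_sum_chi (ρ : n.Partition) (F : n.Partition → ℂ) :
    youngScalar (diagram ρ) * ∑ η, chi ρ η * F η / zee η =
      ∑ g, (youngSymmetrizer (diagram ρ)).coeff g * F (cyclePartition (card_boxes ρ) g) := by
  have hn : (n.factorial : ℂ) ≠ 0 := by exact_mod_cast n.factorial_ne_zero
  apply mul_left_cancel₀ hn
  rw [mul_left_comm, ← sum_cyclePartition (card_boxes ρ) (fun η => chi ρ η * F η)]
  simp only [← character_eq_chi, Finset.mul_sum, ← mul_assoc, youngScalar_mul_character]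
  simp only [Finset.sum_mul]
  rw [Finset.sum_comm]
  have h : ∀ x ∈ (Finset.univ : Finset (BoxPerm (diagram ρ))),
      ∑ g, (youngSymmetrizer (diagram ρ)).coeff (x⁻¹ * g⁻¹ * x) *
        F (cyclePartition (card_boxes ρ) g) =
      ∑ g, (youngSymmetrizer (diagram ρ)).coeff g * F (cyclePartition (card_boxes ρ) g) := by
    intro x _
    refine Fintype.sum_equiv ((Equiv.inv _).trans (MulAut.conj x⁻¹).toEquiv) _ _ fun g => ?_
    have h1 : ((Equiv.inv _).trans (MulAut.conj x⁻¹).toEquiv) g = x⁻¹ * g⁻¹ * x := by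
      simp
    have h2 := cyclePartition_conj (card_boxes ρ) g⁻¹ x⁻¹
    rw [inv_inv, cyclePartition_inv] at h2
    rw [h1, h2]
  rw [Finset.sum_congr rfl h, Finset.sum_const, Finset.card_univ, Fintype.card_perm, card_boxes,
    nsmul_eq_mul, Finset.mul_sum]
  exact Finset.sum_congr rfl fun g _ => (mul_assoc _ _ _).symm

theorem sum_chi_mul_chi (ρ : n.Partition) : ∑ η, chi ρ η * chi ρ η / zee η = 1 := by
  have hc := youngScalar_ne_zero (Y := diagram ρ)
  apply mul_left_cancel₀ (mul_ne_zero hc hc)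
  rw [mul_assoc, youngScalar_mul_sum_chi, Finset.mul_sum, mul_one]
  simp only [← character_eq_chi, mul_left_comm (youngScalar _), youngScalar_mul_character,
    Finset.mul_sum]
  rw [Finset.sum_comm]
  have h : ∀ x ∈ (Finset.univ : Finset (BoxPerm (diagram ρ))),
      ∑ g, (youngSymmetrizer (diagram ρ)).coeff g *
        (youngSymmetrizer (diagram ρ)).coeff (x⁻¹ * g⁻¹ * x) =
      youngScalar (diagram ρ) * ((youngSymmetrizer (diagram ρ)).coeff x⁻¹ *
        (youngSymmetrizer (diagram ρ)).coeff x) := by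
    intro x _
    have h1 : ∀ g, (youngSymmetrizer (diagram ρ)).coeff (x⁻¹ * g⁻¹ * x) =
        (MonoidAlgebra.single x 1 * youngSymmetrizer (diagram ρ) *
          MonoidAlgebra.single x⁻¹ 1).coeff g⁻¹ := by
      intro g
      simp [mul_assoc]
    simp only [h1]
    have h2 : (youngSymmetrizer (diagram ρ) * MonoidAlgebra.single x 1 *
        youngSymmetrizer (diagram ρ)).coeff 1 =
        youngScalar (diagram ρ) * (youngSymmetrizer (diagram ρ)).coeff x⁻¹ := by
      rw [coeff_mul_one_comm, ← mul_assoc, youngSymmetrizer_mul_self, smul_mul_assoc,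
        MonoidAlgebra.coeff_smul_apply, MonoidAlgebra.coeff_mul_single_apply, smul_eq_mul, one_mul,
        mul_one]
    rw [← coeff_mul_one, ← mul_assoc, ← mul_assoc, youngSymmetrizer_mul_mul, h2, smul_mul_assoc,
      MonoidAlgebra.coeff_smul_apply, MonoidAlgebra.coeff_mul_single_apply, smul_eq_mul, one_mul,
      mul_one, inv_inv, mul_assoc]
  rw [Finset.sum_congr rfl h, ← Finset.mul_sum]
  congr 1
  rw [youngScalar, coeff_mul_one]
  exact Finset.sum_congr rfl fun g _ => mul_comm _ _

theorem sum_stabilizer_eq_zero {Y : YoungDiagram} {L : ℕ}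
    {f : {c : ℕ × ℕ // c ∈ Y.cells} → Fin L} (hf : ¬ ColumnInjective fun c => (f c).val) :
    ∑ g, (youngSymmetrizer Y).coeff g * (if ∀ x, f (g x) = f x then 1 else 0) = 0 := by
  simp only [ColumnInjective, not_forall] at hf
  obtain ⟨c, d, hcol, hrow, hne⟩ := hf
  have ht : Equiv.swap c d ∈ colSet Y := by
    rw [mem_colSet]
    intro x
    by_cases h1 : x = c
    · rw [h1, Equiv.swap_apply_left, hcol]
    · by_cases h2 : x = d
      · rw [h2, Equiv.swap_apply_right, hcol]
      · rw [Equiv.swap_apply_of_ne_of_ne h1 h2]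
  have hs : ∀ x, f (Equiv.swap c d x) = f x := by
    intro x
    by_cases h1 : x = c
    · rw [h1, Equiv.swap_apply_left]
      exact Fin.ext hrow.symm
    · by_cases h2 : x = d
      · rw [h2, Equiv.swap_apply_right]
        exact Fin.ext hrow
      · rw [Equiv.swap_apply_of_ne_of_ne h1 h2]
  have he : ∀ g, (youngSymmetrizer Y).coeff (g * Equiv.swap c d) =
      -(youngSymmetrizer Y).coeff g := by
    intro g
    have h1 : youngSymmetrizer Y * MonoidAlgebra.single (Equiv.swap c d) 1 =
        -youngSymmetrizer Y := by
      rw [youngSymmetrizer, mul_assoc, colAntisymmetrizer_mul_single ht, csign,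
        Equiv.Perm.sign_swap hne]
      simp
    have h2 := congrArg (fun u => u.coeff g) h1
    simpa using h2
  apply self_eq_neg.mp
  conv_lhs => rw [← Equiv.sum_comp (Equiv.mulRight (Equiv.swap c d))]
  rw [← Finset.sum_neg_distrib]
  refine Finset.sum_congr rfl fun g _ => ?_
  rw [Equiv.coe_mulRight, he, neg_mul]
  congr 2
  have : (∀ x, f ((g * Equiv.swap c d) x) = f x) ↔ ∀ x, f (g x) = f x := by
    constructor
    · intro h x
      have := h (Equiv.swap c d x)
      rw [Equiv.Perm.mul_apply, Equiv.swap_apply_self, hs] at this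
      exact this
    · intro h x
      rw [Equiv.Perm.mul_apply, h, hs]
  simp only [this]

theorem card_lt_of_mem_colourings {α : Type*} [Fintype α] [DecidableEq α] {L : ℕ} {μ : Fin L → ℕ}
    {f : α → Fin L} (hf : f ∈ colourings α μ) (k : ℕ) :
    (Finset.univ.filter fun c => (f c).val < k).card = partialSum μ k := by
  rw [partialSum, Finset.card_eq_sum_card_fiberwise (f := f)
    (t := Finset.univ.filter fun i : Fin L => i.val < k)]
  · refine Finset.sum_congr rfl fun i hi => ?_
    rw [← (Finset.mem_filter.mp hf).2 i, Finset.filter_filter]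
    congr 1
    ext c
    simp only [Finset.mem_filter, Finset.mem_univ, true_and, and_iff_right_iff_imp]
    rintro rfl
    exact (Finset.mem_filter.mp hi).2
  · intro c hc
    simpa using hc

theorem rowFilling_lt {ρ : n.Partition} {L : ℕ} (hL : len ρ ≤ L)
    (c : {c : ℕ × ℕ // c ∈ (diagram ρ).cells}) : c.1.1 < L := by
  have h : (c.1.1, c.1.2) ∈ diagram ρ := c.2
  rw [YoungDiagram.mem_iff_lt_rowLen] at h
  by_contra h'
  rw [rowLen_diagram_eq_zero (by omega)] at h
  omega

/-- The filling of each box by its row. -/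
def rowFilling {ρ : n.Partition} {L : ℕ} (hL : len ρ ≤ L)
    (c : {c : ℕ × ℕ // c ∈ (diagram ρ).cells}) : Fin L := ⟨c.1.1, rowFilling_lt hL c⟩

theorem rowFilling_comp_mem_colourings {ρ : n.Partition} {L : ℕ} (hL : len ρ ≤ L)
    (y : BoxPerm (diagram ρ)) : rowFilling hL ∘ y ∈ colourings _ (rows L ρ) := by
  refine Finset.mem_filter.mpr ⟨Finset.mem_univ _, fun i => ?_⟩
  rw [rows, ← card_filter_cells_row]
  refine Finset.card_bij (fun c _ => (y c).1) ?_ ?_ ?_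
  · intro c hc
    exact Finset.mem_filter.mpr ⟨(y c).2, congrArg Fin.val (Finset.mem_filter.mp hc).2⟩
  · intro c _ d _ h
    exact y.injective (Subtype.ext h)
  · intro b hb
    obtain ⟨h1, h2⟩ := Finset.mem_filter.mp hb
    refine ⟨y.symm ⟨b, h1⟩, Finset.mem_filter.mpr ⟨Finset.mem_univ _, Fin.ext ?_⟩, by simp⟩
    change (y (y.symm ⟨b, h1⟩)).1.1 = i
    rw [Equiv.apply_symm_apply]
    exact h2

theorem card_fst_lt {ρ : n.Partition} {L : ℕ} (hL : len ρ ≤ L) (k : ℕ) :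
    (Finset.univ.filter fun c : {c : ℕ × ℕ // c ∈ (diagram ρ).cells} => c.1.1 < k).card =
      partialSum (rows L ρ) k :=
  card_lt_of_mem_colourings (rowFilling_comp_mem_colourings hL 1) k

theorem youngScalar_mul_sum_chi_permChar (ρ : n.Partition) {L : ℕ} (μ : Fin L → ℕ) :
    youngScalar (diagram ρ) * ∑ η : n.Partition, chi ρ η * permChar μ η.parts / zee η =
      ∑ f ∈ colourings _ μ, ∑ g, (youngSymmetrizer (diagram ρ)).coeff g *
        (if ∀ x, f (g x) = f x then 1 else 0) := by
  rw [youngScalar_mul_sum_chi ρ fun η => permChar μ η.parts, Finset.sum_comm]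
  refine Finset.sum_congr rfl fun g _ => ?_
  rw [← Finset.mul_sum, ← permChar_partition]
  rfl

theorem partialSum_le_of_sum_chi_mul_permChar (ρ : n.Partition) {L : ℕ} (hL : len ρ ≤ L)
    (μ : Fin L → ℕ) (h : ∑ η : n.Partition, chi ρ η * permChar μ η.parts / zee η ≠ 0) (k : ℕ) :
    partialSum μ k ≤ partialSum (rows L ρ) k := by
  have h1 := mul_ne_zero (youngScalar_ne_zero (Y := diagram ρ)) h
  rw [youngScalar_mul_sum_chi_permChar] at h1
  obtain ⟨f, hf, hne⟩ := Finset.exists_ne_zero_of_sum_ne_zero h1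
  have hcol : ColumnInjective fun c => (f c).val := by
    by_contra hcol
    exact hne (sum_stabilizer_eq_zero hcol)
  rw [← card_lt_of_mem_colourings hf, ← card_fst_lt hL]
  exact hcol.card_lt_le k

theorem sum_rowFilling_stabilizer {ρ : n.Partition} {L : ℕ} (hL : len ρ ≤ L)
    {y : BoxPerm (diagram ρ)} (hy : y ∈ colSet (diagram ρ)) :
    ∑ g, (youngSymmetrizer (diagram ρ)).coeff g *
        (if ∀ x, (rowFilling hL ∘ y) (g x) = (rowFilling hL ∘ y) x then 1 else 0) =
      ∑ r ∈ rowSet (diagram ρ), csign y * (youngSymmetrizer (diagram ρ)).coeff (y⁻¹ * r⁻¹) := by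
  classical
  simp only [mul_ite, mul_one, mul_zero]
  rw [← Finset.sum_filter]
  have hiff : ∀ g : BoxPerm (diagram ρ),
      (∀ x, (rowFilling hL ∘ y) (g x) = (rowFilling hL ∘ y) x) ↔ y * g * y⁻¹ ∈ rowSet _ := by
    intro g
    rw [mem_rowSet]
    constructor
    · intro h c
      have := congrArg Fin.val (h (y⁻¹ c))
      simpa [rowFilling] using this
    · intro h c
      have := h (y c)
      simpa [rowFilling] using this
  have he : ∀ g, (youngSymmetrizer (diagram ρ)).coeff (g * y) =
      csign y * (youngSymmetrizer (diagram ρ)).coeff g := by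
    intro g
    have h1 : youngSymmetrizer (diagram ρ) * MonoidAlgebra.single y⁻¹ 1 =
        csign y • youngSymmetrizer (diagram ρ) := by
      rw [youngSymmetrizer, mul_assoc, colAntisymmetrizer_mul_single (inv_mem_colSet hy),
        csign_inv, mul_smul_comm]
    have h2 := congrArg (fun u => u.coeff g) h1
    simpa using h2
  refine Finset.sum_bij' (fun g _ => (y * g * y⁻¹)⁻¹) (fun r _ => y⁻¹ * r⁻¹ * y) ?_ ?_ ?_ ?_ ?_
  · intro g hg
    exact inv_mem_rowSet ((hiff g).mp (Finset.mem_filter.mp hg).2)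
  · intro r hr
    refine Finset.mem_filter.mpr ⟨Finset.mem_univ _, (hiff _).mpr ?_⟩
    have : y * (y⁻¹ * r⁻¹ * y) * y⁻¹ = r⁻¹ := by group
    rw [this]
    exact inv_mem_rowSet hr
  · intro g _
    group
  · intro r _
    group
  · intro g _
    rw [← he]
    congr 1
    group

theorem sum_chi_mul_permChar_rows (ρ : n.Partition) {L : ℕ} (hL : len ρ ≤ L) :
    ∑ η : n.Partition, chi ρ η * permChar (rows L ρ) η.parts / zee η = 1 := by
  classical
  apply mul_left_cancel₀ (youngScalar_ne_zero (Y := diagram ρ))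
  have hsub : (colSet (diagram ρ)).image (fun y : BoxPerm (diagram ρ) => rowFilling hL ∘ ⇑y) ⊆
      colourings _ (rows L ρ) := by
    intro f hf
    obtain ⟨y, -, rfl⟩ := Finset.mem_image.mp hf
    exact rowFilling_comp_mem_colourings hL y
  rw [youngScalar_mul_sum_chi_permChar, mul_one, ← Finset.sum_subset hsub, Finset.sum_image]
  · rw [Finset.sum_congr rfl fun y hy => sum_rowFilling_stabilizer hL hy, Finset.sum_comm,
      youngScalar, coeff_mul_one,
      sum_coeff_youngSymmetrizer fun g => (youngSymmetrizer (diagram ρ)).coeff g⁻¹]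
    simp only [mul_inv_rev]
  · intro y hy y' hy' h
    ext x : 1
    have h1 := congrArg Fin.val (congrFun h x)
    exact Subtype.ext (Prod.ext h1 ((mem_colSet.mp hy x).trans (mem_colSet.mp hy' x).symm))
  · intro f hf hnot
    apply sum_stabilizer_eq_zero
    intro hcol
    apply hnot
    obtain ⟨y, hy1, hy2⟩ := hcol.exists_perm fun k => by
      rw [card_lt_of_mem_colourings hf, card_fst_lt hL]
    exact Finset.mem_image.mpr ⟨y, mem_colSet.mpr hy1, funext fun c => Fin.ext (hy2 c)⟩

/-! ### Frobenius' character formula -/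

theorem exists_real_chi (ρ η : n.Partition) : ∃ x : ℝ, chi ρ η = x := by
  choose e he using exists_int_coeff_youngSymmetrizer (Y := diagram ρ)
  have h1 : youngScalar (diagram ρ) = ((∑ g, (e g : ℝ) * e g⁻¹ : ℝ) : ℂ) := by
    rw [youngScalar, coeff_mul_one]
    push_cast
    simp only [he]
  have h2 := youngScalar_mul_character (Classical.choose (exists_cycleType ρ η))
  refine ⟨(∑ g, (e g : ℝ) * e g⁻¹)⁻¹ *
    ∑ x, (e (x⁻¹ * (Classical.choose (exists_cycleType ρ η))⁻¹ * x) : ℝ), ?_⟩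
  have h3 : chi ρ η = (youngScalar (diagram ρ))⁻¹ *
      ∑ x, (youngSymmetrizer (diagram ρ)).coeff
        (x⁻¹ * (Classical.choose (exists_cycleType ρ η))⁻¹ * x) := by
    rw [← h2, inv_mul_cancel_left₀ youngScalar_ne_zero, chi]
  rw [h3, h1]
  simp only [he]
  push_cast
  rfl

theorem exists_int_permChar {L : ℕ} (μ : Fin L → ℕ) (η : n.Partition) :
    ∃ z : ℤ, permChar μ η.parts = z := by
  obtain ⟨σ, hσ⟩ := exists_cycleType η η
  rw [← hσ, permChar_partition]
  exact ⟨∑ f ∈ colourings _ μ, if ∀ x, f (σ x) = f x then 1 else 0, by push_cast; rfl⟩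

theorem exists_real_frob (ρ η : n.Partition) : ∃ x : ℝ, frob ρ η = x := by
  choose z hz using fun μ : Fin n → ℕ => exists_int_permChar μ η
  rw [frob, frobChar_eq, detExpand]
  simp only [hz]
  refine ⟨∑ w : Equiv.Perm (Fin n), ((Equiv.Perm.sign w : ℤ) : ℝ) *
    if ∀ i, staircase n (w i) ≤ rows n ρ i + staircase n i then
      (z (rows n ρ + staircase n - staircase n ∘ w) : ℝ) else 0, ?_⟩
  push_cast
  exact Finset.sum_congr rfl fun w _ => by split_ifs <;> simp

theorem sum_chi_mul_frob_self (ρ : n.Partition) : ∑ η, chi ρ η * frob ρ η / zee η = 1 := by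
  simp only [frob, sum_mul_frobChar]
  rw [detExpand_self, sum_chi_mul_permChar_rows ρ (len_le ρ)]
  intro α _ h
  exact partialSum_le_of_sum_chi_mul_permChar ρ (len_le ρ) α h

/-- **Frobenius' character formula** for the Specht modules. -/
theorem chi_eq_frob (ρ η : n.Partition) : chi ρ η = frob ρ η := by
  classical
  have hreal : ∀ σ, ∃ x : ℝ, ∑ θ, chi ρ θ * frob σ θ / zee θ = x := by
    intro σ
    choose a ha using exists_real_chi ρ
    choose b hb using exists_real_frob σ
    refine ⟨∑ θ, a θ * b θ / zee θ, ?_⟩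
    simp only [ha, hb]
    push_cast
    rfl
  choose m hm using hreal
  have hexp : ∀ θ, chi ρ θ = ∑ σ, (m σ : ℂ) * frob σ θ := by
    intro θ
    rw [eq_sum_frob (chi ρ) θ]
    simp only [hm]
  have hself : m ρ = 1 := by
    have := sum_chi_mul_frob_self ρ
    rw [hm] at this
    exact_mod_cast this
  have hnorm : ∑ σ, m σ * m σ = 1 := by
    have h1 := sum_chi_mul_chi ρ
    have h2 : ∑ θ, chi ρ θ * chi ρ θ / zee θ = ∑ σ, (m σ : ℂ) * m σ := by
      have h3 : ∀ σ, (m σ : ℂ) * m σ = ∑ θ, m σ * (chi ρ θ * frob σ θ / zee θ) := by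
        intro σ
        rw [← Finset.mul_sum, hm]
      simp only [h3]
      rw [Finset.sum_comm]
      refine Finset.sum_congr rfl fun θ _ => ?_
      conv_lhs => rw [mul_div_assoc, hexp θ, Finset.sum_mul]
      exact Finset.sum_congr rfl fun σ _ => by rw [← hexp θ]; ring
    rw [h2] at h1
    exact_mod_cast h1
  have hzero : ∀ σ, σ ≠ ρ → m σ = 0 := by
    intro σ hσ
    rw [← Finset.add_sum_erase _ _ (Finset.mem_univ ρ), hself, mul_one, add_eq_left,
      Finset.sum_eq_zero_iff_of_nonneg fun σ _ => mul_self_nonneg _] at hnorm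
    exact mul_self_eq_zero.mp (hnorm σ (Finset.mem_erase.mpr ⟨hσ, Finset.mem_univ _⟩))
  rw [hexp, Finset.sum_eq_single ρ]
  · rw [hself, Complex.ofReal_one, one_mul]
  · intro σ _ hσ
    rw [hzero σ hσ, Complex.ofReal_zero, zero_mul]
  · simp

end Specht

/-! ### Hook lengths -/

section Hooks

variable {M : Type*} [CommMonoid M]

/-- The shifted row length `ρ_i + L - 1 - i`. -/
def shiftedRow (Y : YoungDiagram) (L i : ℕ) : ℕ := Y.rowLen i + (L - 1 - i)

theorem shiftedRow_lt {Y : YoungDiagram} {L i k : ℕ} (hik : i < k) (hk : k < L) :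
    shiftedRow Y L k < shiftedRow Y L i := by
  have := Y.rowLen_anti i k hik.le
  simp only [shiftedRow]
  omega

theorem hook_add {Y : YoungDiagram} {L : ℕ} (hL : ∀ i, L ≤ i → Y.rowLen i = 0) {i j : ℕ}
    (hj : j < Y.rowLen i) :
    hook Y (i, j) + (L - Y.colLen j + j) = shiftedRow Y L i ∧ i < Y.colLen j ∧ Y.colLen j ≤ L := by
  have h1 : i < Y.colLen j := by
    rw [← YoungDiagram.mem_iff_lt_colLen]
    exact YoungDiagram.mem_iff_lt_rowLen.mpr hj
  have h2 : Y.colLen j ≤ L := by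
    by_contra h
    have h3 : (L, j) ∈ Y := YoungDiagram.mem_iff_lt_colLen.mpr (by omega)
    rw [YoungDiagram.mem_iff_lt_rowLen, hL L le_rfl] at h3
    omega
  refine ⟨?_, h1, h2⟩
  simp only [hook, shiftedRow]
  omega

/-- The hook lengths in a row and the differences of shifted rows together exhaust an interval. -/
theorem prod_hook_row {Y : YoungDiagram} {L : ℕ} (hL : ∀ i, L ≤ i → Y.rowLen i = 0) {i : ℕ}
    (hi : i < L) (g : ℕ → M) :
    (∏ j ∈ Finset.range (Y.rowLen i), g (hook Y (i, j))) *
        ∏ k ∈ Finset.Ico (i + 1) L, g (shiftedRow Y L i - shiftedRow Y L k) =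
      ∏ v ∈ Finset.Icc 1 (shiftedRow Y L i), g v := by
  have hinj1 : Set.InjOn (fun j => hook Y (i, j)) (Finset.range (Y.rowLen i)) := by
    intro j hj j' hj' h
    obtain ⟨h1, -, h2⟩ := hook_add hL (Finset.mem_range.mp hj)
    obtain ⟨h1', -, h2'⟩ := hook_add hL (Finset.mem_range.mp hj')
    simp only at h
    rcases le_total j j' with hle | hle
    · have := Y.colLen_anti j j' hle
      omega
    · have := Y.colLen_anti j' j hle
      omega
  have hinj2 : Set.InjOn (fun k => shiftedRow Y L i - shiftedRow Y L k)
      (Finset.Ico (i + 1) L) := by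
    intro k hk k' hk' h
    obtain ⟨h1, h2⟩ := Finset.mem_Ico.mp hk
    obtain ⟨h1', h2'⟩ := Finset.mem_Ico.mp hk'
    have h3 := shiftedRow_lt (Y := Y) (show i < k by omega) h2
    have h3' := shiftedRow_lt (Y := Y) (show i < k' by omega) h2'
    simp only at h
    rcases lt_trichotomy k k' with hlt | hlt | hlt
    · have := shiftedRow_lt (Y := Y) hlt h2'
      omega
    · exact hlt
    · have := shiftedRow_lt (Y := Y) hlt h2
      omega
  have hdisj : Disjoint ((Finset.range (Y.rowLen i)).image fun j => hook Y (i, j))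
      ((Finset.Ico (i + 1) L).image fun k => shiftedRow Y L i - shiftedRow Y L k) := by
    rw [Finset.disjoint_left]
    intro v hv hv'
    obtain ⟨j, hj, rfl⟩ := Finset.mem_image.mp hv
    obtain ⟨k, hk, h⟩ := Finset.mem_image.mp hv'
    obtain ⟨h1, h2, h3⟩ := hook_add hL (Finset.mem_range.mp hj)
    obtain ⟨hk1, hk2⟩ := Finset.mem_Ico.mp hk
    have h4 := shiftedRow_lt (Y := Y) (show i < k by omega) hk2
    have h5 : j < Y.rowLen k ↔ k < Y.colLen j := by
      rw [← YoungDiagram.mem_iff_lt_colLen, YoungDiagram.mem_iff_lt_rowLen]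
    have h6 : shiftedRow Y L k = Y.rowLen k + (L - 1 - k) := rfl
    by_cases h7 : j < Y.rowLen k
    · have := h5.mp h7
      omega
    · have := mt h5.mpr h7
      omega
  have hunion : ((Finset.range (Y.rowLen i)).image fun j => hook Y (i, j)) ∪
      ((Finset.Ico (i + 1) L).image fun k => shiftedRow Y L i - shiftedRow Y L k) =
      Finset.Icc 1 (shiftedRow Y L i) := by
    apply Finset.eq_of_subset_of_card_le
    · intro v hv
      rw [Finset.mem_Icc]
      rcases Finset.mem_union.mp hv with hv | hv
      · obtain ⟨j, hj, rfl⟩ := Finset.mem_image.mp hv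
        obtain ⟨h1, -, -⟩ := hook_add hL (Finset.mem_range.mp hj)
        refine ⟨?_, by omega⟩
        simp only [hook]
        omega
      · obtain ⟨k, hk, rfl⟩ := Finset.mem_image.mp hv
        obtain ⟨hk1, hk2⟩ := Finset.mem_Ico.mp hk
        have h4 := shiftedRow_lt (Y := Y) (show i < k by omega) hk2
        omega
    · rw [Finset.card_union_of_disjoint hdisj, Finset.card_image_of_injOn hinj1,
        Finset.card_image_of_injOn hinj2, Nat.card_Icc, Finset.card_range, Nat.card_Ico, shiftedRow]
      omega
  rw [← hunion, Finset.prod_union hdisj, Finset.prod_image hinj1, Finset.prod_image hinj2]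

theorem prod_cells {Y : YoungDiagram} {L : ℕ} (hL : ∀ i, L ≤ i → Y.rowLen i = 0)
    (F : ℕ × ℕ → M) :
    ∏ c ∈ Y.cells, F c = ∏ i ∈ Finset.range L, ∏ j ∈ Finset.range (Y.rowLen i), F (i, j) := by
  rw [Finset.prod_sigma']
  refine Finset.prod_bij' (fun c _ => ⟨c.1, c.2⟩) (fun x _ => (x.1, x.2)) ?_ ?_ ?_ ?_ ?_
  · rintro ⟨i, j⟩ hc
    have h : j < Y.rowLen i := YoungDiagram.mem_iff_lt_rowLen.mp hc
    simp only [Finset.mem_sigma, Finset.mem_range]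
    refine ⟨?_, h⟩
    by_contra h'
    rw [hL i (by omega)] at h
    omega
  · rintro ⟨i, j⟩ hx
    simp only [Finset.mem_sigma, Finset.mem_range] at hx
    exact YoungDiagram.mem_iff_lt_rowLen.mpr hx.2
  · intro _ _
    rfl
  · intro _ _
    rfl
  · intro _ _
    rfl

theorem prod_hook {Y : YoungDiagram} {L : ℕ} (hL : ∀ i, L ≤ i → Y.rowLen i = 0) (g : ℕ → M) :
    (∏ c ∈ Y.cells, g (hook Y c)) *
        ∏ i ∈ Finset.range L, ∏ k ∈ Finset.Ico (i + 1) L,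
          g (shiftedRow Y L i - shiftedRow Y L k) =
      ∏ i ∈ Finset.range L, ∏ v ∈ Finset.Icc 1 (shiftedRow Y L i), g v := by
  rw [prod_cells hL, ← Finset.prod_mul_distrib]
  exact Finset.prod_congr rfl fun i hi => prod_hook_row hL (Finset.mem_range.mp hi) g

theorem prod_Icc_add (g : ℕ → M) (d r : ℕ) :
    ∏ v ∈ Finset.Icc 1 (r + d), g v =
      (∏ v ∈ Finset.Icc 1 d, g v) * ∏ v ∈ Finset.Icc 1 r, g (v + d) := by
  induction r with
  | zero => simp
  | succ r ih =>
    rw [Finset.prod_Icc_succ_top (by omega), ← mul_assoc, ← ih,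
      show r + 1 + d = (r + d) + 1 by ring, Finset.prod_Icc_succ_top (by omega)]

theorem prod_differences (g : ℕ → M) (L : ℕ) :
    ∏ i ∈ Finset.range L, ∏ v ∈ Finset.Icc 1 (L - 1 - i), g v =
      ∏ i ∈ Finset.range L, ∏ k ∈ Finset.Ico (i + 1) L, g (k - i) := by
  refine Finset.prod_congr rfl fun i hi => ?_
  refine Finset.prod_bij' (fun v _ => v + i) (fun k _ => k - i) ?_ ?_ ?_ ?_ ?_
  · intro v hv
    simp only [Finset.mem_range, Finset.mem_Icc, Finset.mem_Ico] at *
    omega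
  · intro k hk
    simp only [Finset.mem_range, Finset.mem_Icc, Finset.mem_Ico] at *
    omega
  · intro v _
    simp
  · intro k hk
    simp only [Finset.mem_Ico] at hk
    omega
  · intro v _
    simp

theorem prod_pairs (F : ℕ → ℕ → M) (L : ℕ) :
    ∏ b ∈ Finset.Icc 1 L, ∏ a ∈ Finset.Ico 1 b, F a b =
      ∏ i ∈ Finset.range L, ∏ k ∈ Finset.Ico (i + 1) L, F (i + 1) (k + 1) := by
  rw [Finset.prod_sigma', Finset.prod_sigma']
  refine Finset.prod_bij' (fun x _ => ⟨x.2 - 1, x.1 - 1⟩) (fun x _ => ⟨x.2 + 1, x.1 + 1⟩)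
    ?_ ?_ ?_ ?_ ?_
  · rintro ⟨b, a⟩ hx
    simp only [Finset.mem_sigma, Finset.mem_range, Finset.mem_Icc, Finset.mem_Ico] at *
    omega
  · rintro ⟨i, k⟩ hx
    simp only [Finset.mem_sigma, Finset.mem_range, Finset.mem_Icc, Finset.mem_Ico] at *
    omega
  · rintro ⟨b, a⟩ hx
    simp only [Finset.mem_sigma, Finset.mem_Icc, Finset.mem_Ico] at hx
    simp only [Sigma.mk.injEq, heq_eq_eq]
    omega
  · rintro ⟨i, k⟩ _
    simp
  · rintro ⟨b, a⟩ hx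
    simp only [Finset.mem_sigma, Finset.mem_Icc, Finset.mem_Ico] at hx
    simp only
    rw [Nat.sub_add_cancel (by omega), Nat.sub_add_cancel (by omega)]

theorem prod_Icc_one_eq_range (F : ℕ → M) (L : ℕ) :
    ∏ i ∈ Finset.Icc 1 L, F i = ∏ i ∈ Finset.range L, F (i + 1) := by
  induction L with
  | zero => simp
  | succ L ih => rw [Finset.prod_Icc_succ_top (by omega), ih, Finset.prod_range_succ]

end Hooks

section VFormula

open Complex (sin)

theorem V_eq {lam : ℂ} (hlam : ∀ k : ℕ, 1 ≤ k → sin (k * lam / 2) ≠ 0) {n : ℕ}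
    (μ : n.Partition) :
    V μ lam = 1 / (2 ^ n * ∏ x ∈ (diagram μ).cells, sin (hook (diagram μ) x * lam / 2)) := by
  set s : ℕ → ℂ := fun m => sin (m * lam / 2) with hs
  set Y := diagram μ with hY
  set l := len μ with hl
  have hL : ∀ i, l ≤ i → Y.rowLen i = 0 := fun i hi => rowLen_diagram_eq_zero hi
  have hs0 : ∀ m, 0 < m → s m ≠ 0 := fun m hm => hlam m hm
  have h1 := prod_hook hL s
  have h2 : ∀ i, ∏ v ∈ Finset.Icc 1 (shiftedRow Y l i), s v =
      (∏ v ∈ Finset.Icc 1 (l - 1 - i), s v) *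
        ∏ v ∈ Finset.Icc 1 (Y.rowLen i), s (v + (l - 1 - i)) := fun i =>
    prod_Icc_add s _ _
  simp only [h2, Finset.prod_mul_distrib] at h1
  rw [prod_differences] at h1
  have hA : (∏ b ∈ Finset.Icc 1 l, ∏ a ∈ Finset.Ico 1 b,
      sin (((part μ a : ℂ) - part μ b + b - a) * lam / 2) / sin (((b : ℂ) - a) * lam / 2)) =
      (∏ i ∈ Finset.range l, ∏ k ∈ Finset.Ico (i + 1) l, s (shiftedRow Y l i - shiftedRow Y l k)) /
        ∏ i ∈ Finset.range l, ∏ k ∈ Finset.Ico (i + 1) l, s (k - i) := by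
    rw [prod_pairs, ← Finset.prod_div_distrib]
    refine Finset.prod_congr rfl fun i hi => ?_
    rw [← Finset.prod_div_distrib]
    refine Finset.prod_congr rfl fun k hk => ?_
    obtain ⟨hk1, hk2⟩ := Finset.mem_Ico.mp hk
    have h3 := shiftedRow_lt (Y := Y) (show i < k by omega) hk2
    have e1 : (((shiftedRow Y l i - shiftedRow Y l k : ℕ) : ℂ)) =
        (part μ (i + 1) : ℂ) - part μ (k + 1) + ((k + 1 : ℕ) : ℂ) - ((i + 1 : ℕ) : ℂ) := by
      have : ((shiftedRow Y l i - shiftedRow Y l k : ℕ) : ℤ) =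
          (part μ (i + 1) : ℤ) - part μ (k + 1) + ((k + 1 : ℕ) : ℤ) - ((i + 1 : ℕ) : ℤ) := by
        rw [Nat.cast_sub h3.le]
        simp only [shiftedRow, part, Nat.add_sub_cancel, ← hY]
        omega
      exact_mod_cast congrArg (Int.cast : ℤ → ℂ) this
    have e2 : ((k - i : ℕ) : ℂ) = ((k + 1 : ℕ) : ℂ) - ((i + 1 : ℕ) : ℂ) := by
      rw [Nat.cast_sub (by omega)]
      push_cast
      ring
    simp only [hs]
    rw [e1, e2]
  have hB : (∏ i ∈ Finset.Icc 1 l, ∏ v ∈ Finset.Icc 1 (part μ i),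
      2 * sin (((v : ℂ) - i + l) * lam / 2)) =
      2 ^ n * ∏ i ∈ Finset.range l, ∏ v ∈ Finset.Icc 1 (Y.rowLen i), s (v + (l - 1 - i)) := by
    have hn : ∑ i ∈ Finset.range l, Y.rowLen i = n := by
      rw [← Fin.sum_univ_eq_sum_range]
      exact sum_rows (L := l) (ρ := μ) le_rfl
    rw [prod_Icc_one_eq_range]
    conv_rhs => rw [← hn, ← Finset.prod_pow_eq_pow_sum, ← Finset.prod_mul_distrib]
    refine Finset.prod_congr rfl fun i hi => ?_
    rw [Finset.mem_range] at hi
    rw [Finset.prod_mul_distrib, Finset.prod_const, Nat.card_Icc]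
    congr 1
    refine Finset.prod_congr rfl fun v _ => ?_
    simp only [hs]
    congr 3
    have e : (v : ℂ) - ((i + 1 : ℕ) : ℂ) + l = ((v + (l - 1 - i) : ℕ) : ℂ) := by
      have : (v : ℤ) - ((i + 1 : ℕ) : ℤ) + l = ((v + (l - 1 - i) : ℕ) : ℤ) := by omega
      exact_mod_cast congrArg (Int.cast : ℤ → ℂ) this
    exact e
  have hV : V μ lam = (∏ i ∈ Finset.range l, ∏ k ∈ Finset.Ico (i + 1) l,
        s (shiftedRow Y l i - shiftedRow Y l k)) /
        (∏ i ∈ Finset.range l, ∏ k ∈ Finset.Ico (i + 1) l, s (k - i)) *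
      (1 / (2 ^ n * ∏ i ∈ Finset.range l, ∏ v ∈ Finset.Icc 1 (Y.rowLen i),
        s (v + (l - 1 - i)))) := by
    rw [← hA, ← hB]
    rfl
  have hD : ∏ i ∈ Finset.range l, ∏ k ∈ Finset.Ico (i + 1) l, s (k - i) ≠ 0 := by
    refine Finset.prod_ne_zero_iff.mpr fun i _ => Finset.prod_ne_zero_iff.mpr fun k hk => hs0 _ ?_
    have := Finset.mem_Ico.mp hk
    omega
  have hN : ∏ i ∈ Finset.range l, ∏ v ∈ Finset.Icc 1 (Y.rowLen i), s (v + (l - 1 - i)) ≠ 0 := by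
    refine Finset.prod_ne_zero_iff.mpr fun i _ => Finset.prod_ne_zero_iff.mpr fun v hv => hs0 _ ?_
    have := Finset.mem_Icc.mp hv
    omega
  have hH : ∏ x ∈ Y.cells, s (hook Y x) ≠ 0 := by
    refine Finset.prod_ne_zero_iff.mpr fun x _ => hs0 _ ?_
    simp only [hook]
    omega
  rw [hV]
  change _ = 1 / (2 ^ n * ∏ x ∈ Y.cells, s (hook Y x))
  field_simp
  rw [mul_comm, h1]

end VFormula

/-! ### The principal specialization -/

section Specialization

open Complex (I exp sin)

theorem one_sub_exp_pow (lam : ℂ) (k : ℕ) :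
    1 - exp (-(I * lam)) ^ k = I * exp (-(I * (k * lam / 2))) * (2 * sin (k * lam / 2)) := by
  rw [Complex.sin, ← Complex.exp_nat_mul]
  have h1 : exp (-(k * lam / 2) * I) = exp (-(I * (k * lam / 2))) := by congr 1; ring
  have h2 : exp (k * lam / 2 * I) = exp (I * (k * lam / 2)) := by congr 1; ring
  have h3 : exp (k * -(I * lam)) = exp (-(I * (k * lam / 2))) * exp (-(I * (k * lam / 2))) := by
    rw [← Complex.exp_add]
    congr 1
    ring
  have h4 : exp (-(I * (k * lam / 2))) * exp (I * (k * lam / 2)) = 1 := by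
    rw [← Complex.exp_add, neg_add_cancel, Complex.exp_zero]
  rw [h1, h2, h3]
  linear_combination (-1 : ℂ) * h4 + (exp (-(I * (k * lam / 2))) * exp (-(I * (k * lam / 2))) -
    exp (-(I * (k * lam / 2))) * exp (I * (k * lam / 2))) * (-1) * Complex.I_mul_I

/-- The value of the power sum `p_k` in the specialization of the theorem. -/
def specPower (lam : ℂ) (k : ℕ) : ℂ := -(I ^ (k + 1) / (2 * sin (k * lam / 2)))

/-- The value of the complete homogeneous symmetric function `h_m`. -/
def specComplete (lam : ℂ) (m : ℕ) : ℂ :=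
  exp (I * lam / 4 * (m * (m - 1))) / ∏ v ∈ Finset.Icc 1 m, (2 * sin (v * lam / 2))

variable {lam : ℂ} (hlam : ∀ k : ℕ, 1 ≤ k → sin (k * lam / 2) ≠ 0)

include hlam

theorem one_sub_exp_pow_ne_zero {k : ℕ} (hk : 1 ≤ k) : 1 - exp (-(I * lam)) ^ k ≠ 0 := by
  rw [one_sub_exp_pow]
  exact mul_ne_zero (mul_ne_zero Complex.I_ne_zero (Complex.exp_ne_zero _))
    (mul_ne_zero two_ne_zero (hlam k hk))

theorem specPower_eq {k : ℕ} (hk : 1 ≤ k) :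
    specPower lam k = (I * exp (-(I * lam / 2))) ^ k + exp (-(I * lam)) ^ k * specPower lam k := by
  have h1 := one_sub_exp_pow lam k
  have h2 : (I * exp (-(I * lam / 2))) ^ k = I ^ k * exp (-(I * (k * lam / 2))) := by
    rw [mul_pow, ← Complex.exp_nat_mul]
    congr 2
    ring
  have h3 : specPower lam k * (2 * sin (k * lam / 2)) = -I ^ (k + 1) := by
    have := hlam k hk
    rw [specPower]
    field_simp
  have h4 : I ^ (k + 1) * I = -I ^ k := by
    rw [pow_succ, mul_assoc, Complex.I_mul_I, mul_neg_one]
  rw [h2]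
  linear_combination specPower lam k * h1 + I * exp (-(I * (k * lam / 2))) * h3 -
    exp (-(I * (k * lam / 2))) * h4

omit hlam in
theorem cycleIndex_congr {A : Type*} [CommRing A] [Algebra ℂ A] {u v : ℕ → A}
    (h : ∀ k, 1 ≤ k → u k = v k) (n : ℕ) : cycleIndex u n = cycleIndex v n := by
  refine Finset.sum_congr rfl fun η _ => ?_
  rw [cycleWeight, cycleWeight, Multiset.map_congr rfl fun k hk => h k (η.parts_pos hk)]

theorem cycleIndex_specPower_succ (m : ℕ) :
    (1 - exp (-(I * lam)) ^ (m + 1)) * cycleIndex (specPower lam) (m + 1) =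
      I * exp (-(I * lam / 2)) * cycleIndex (specPower lam) m := by
  set u := I * exp (-(I * lam / 2))
  set r := exp (-(I * lam))
  have h : ∀ m, cycleIndex (specPower lam) m =
      ∑ j ∈ Finset.range (m + 1), r ^ j * cycleIndex (specPower lam) j * u ^ (m - j) := by
    intro m
    have h1 := congrArg (PowerSeries.coeff m)
      (cycleSeries_add (fun k => r ^ k * specPower lam k) (fun k => u ^ k))
    rw [PowerSeries.coeff_mul, Finset.Nat.sum_antidiagonal_eq_sum_range_succ
      (fun i j => PowerSeries.coeff i (cycleSeries fun k => r ^ k * specPower lam k) *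
        PowerSeries.coeff j (cycleSeries fun k => u ^ k))] at h1
    simp only [cycleSeries, PowerSeries.coeff_mk, cycleIndex_pow, cycleIndex_pow_mul] at h1
    rw [← h1]
    refine cycleIndex_congr (fun k hk => ?_) m
    rw [add_comm]
    exact specPower_eq hlam hk
  have h2 := h (m + 1)
  rw [Finset.sum_range_succ, Nat.sub_self, pow_zero, mul_one] at h2
  have h3 : ∑ j ∈ Finset.range (m + 1), r ^ j * cycleIndex (specPower lam) j * u ^ (m + 1 - j) =
      u * cycleIndex (specPower lam) m := by
    rw [h m, Finset.mul_sum]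
    refine Finset.sum_congr rfl fun j hj => ?_
    rw [Finset.mem_range] at hj
    rw [show m + 1 - j = (m - j) + 1 by omega, pow_succ]
    ring
  rw [h3] at h2
  linear_combination h2

theorem specComplete_succ (m : ℕ) :
    (1 - exp (-(I * lam)) ^ (m + 1)) * specComplete lam (m + 1) =
      I * exp (-(I * lam / 2)) * specComplete lam m := by
  rw [one_sub_exp_pow, specComplete, specComplete, Finset.prod_Icc_succ_top (by omega)]
  have h1 := hlam (m + 1) (by omega)
  have h2 : ∏ v ∈ Finset.Icc 1 m, (2 * sin (v * lam / 2)) ≠ 0 :=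
    Finset.prod_ne_zero_iff.mpr fun v hv =>
      mul_ne_zero two_ne_zero (hlam v (Finset.mem_Icc.mp hv).1)
  have h3 : exp (-(I * ((m + 1 : ℕ) * lam / 2))) *
      exp (I * lam / 4 * ((m + 1 : ℕ) * ((m + 1 : ℕ) - 1))) =
      exp (-(I * lam / 2)) * exp (I * lam / 4 * (m * (m - 1))) := by
    rw [← Complex.exp_add, ← Complex.exp_add]
    congr 1
    push_cast
    ring
  rw [← mul_div_assoc (I * exp (-(I * ((m + 1 : ℕ) * lam / 2))) * _),
    ← mul_div_assoc (I * exp (-(I * lam / 2))),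
    div_eq_div_iff (mul_ne_zero h2 (mul_ne_zero two_ne_zero h1)) h2]
  linear_combination I * (2 * sin ((m + 1 : ℕ) * lam / 2)) *
    (∏ v ∈ Finset.Icc 1 m, (2 * sin (v * lam / 2))) * h3

theorem cycleIndex_specPower (m : ℕ) : cycleIndex (specPower lam) m = specComplete lam m := by
  induction m with
  | zero => rw [cycleIndex_zero, specComplete]; simp
  | succ m ih =>
    apply mul_left_cancel₀ (one_sub_exp_pow_ne_zero hlam (show 1 ≤ m + 1 by omega))
    rw [cycleIndex_specPower_succ hlam, specComplete_succ hlam, ih]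

/-- A shifted entry of the Jacobi–Trudi matrix as a polynomial in `r^b`. -/
theorem specComplete_sub (b d : ℕ) :
    (if d ≤ b then specComplete lam (b - d) else 0) =
      specComplete lam b * ∏ s ∈ Finset.range d,
        (I * exp (I * lam * (1 / 2 + s)) * (exp (-(I * lam)) ^ b - exp (-(I * lam)) ^ s)) := by
  induction d with
  | zero => simp
  | succ d ih =>
    rw [Finset.prod_range_succ, ← mul_assoc, ← ih]
    by_cases hd : d + 1 ≤ b
    · rw [if_pos hd, if_pos (by omega)]
      obtain ⟨m, hm⟩ : ∃ m, b = m + 1 + d := ⟨b - (d + 1), by omega⟩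
      rw [show b - d = m + 1 by omega, show b - (d + 1) = m by omega]
      have h1 := specComplete_succ hlam m
      have h2 : exp (-(I * lam)) ^ b = exp (-(I * lam)) ^ (m + 1) * exp (-(I * lam)) ^ d := by
        rw [hm, pow_add]
      have h3 : exp (I * lam * (1 / 2 + d)) * exp (-(I * lam)) ^ d = exp (I * lam / 2) := by
        rw [← Complex.exp_nat_mul, ← Complex.exp_add]
        congr 1
        ring
      have h4 : exp (I * lam / 2) * exp (-(I * lam / 2)) = 1 := by
        rw [← Complex.exp_add, add_neg_cancel, Complex.exp_zero]
      rw [h2]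
      linear_combination (I * exp (I * lam / 2)) * h1 -
        I * I * specComplete lam m * h4 * (-1) + specComplete lam m * Complex.I_mul_I -
        specComplete lam (m + 1) * I * (exp (-(I * lam)) ^ (m + 1) - 1) * h3
    · rw [if_neg hd]
      by_cases hd' : d ≤ b
      · obtain rfl : b = d := by omega
        simp
      · rw [if_neg hd', zero_mul]

end Specialization

/-! ### Evaluation of the Jacobi–Trudi determinant -/

section PairSums

@[to_additive]
theorem prod_pairs_succ {M : Type*} [CommMonoid M] (f : ℕ → ℕ → M) (L : ℕ) :
    ∏ i ∈ Finset.range (L + 1), ∏ k ∈ Finset.Ico (i + 1) (L + 1), f i k =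
      (∏ i ∈ Finset.range L, ∏ k ∈ Finset.Ico (i + 1) L, f i k) *
        ∏ i ∈ Finset.range L, f i L := by
  rw [Finset.prod_range_succ, Finset.Ico_self, Finset.prod_empty, mul_one, ← Finset.prod_mul_distrib]
  refine Finset.prod_congr rfl fun i hi => ?_
  rw [Finset.mem_range] at hi
  rw [Finset.prod_Ico_succ_top (by omega)]

theorem sum_pairs_add (b : ℕ → ℤ) (L : ℕ) :
    ∑ i ∈ Finset.range L, ∑ k ∈ Finset.Ico (i + 1) L, (b i + b k) =
      (L - 1) * ∑ i ∈ Finset.range L, b i := by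
  induction L with
  | zero => simp
  | succ L ih =>
    rw [sum_pairs_succ, ih, Finset.sum_add_distrib, Finset.sum_const, Finset.card_range,
      Finset.sum_range_succ, nsmul_eq_mul]
    push_cast
    ring

theorem sum_pairs_right (g : ℕ → ℤ) (L : ℕ) :
    ∑ i ∈ Finset.range L, ∑ k ∈ Finset.Ico (i + 1) L, g k = ∑ k ∈ Finset.range L, k * g k := by
  induction L with
  | zero => simp
  | succ L ih =>
    rw [sum_pairs_succ (fun _ k => g k), ih, Finset.sum_const, Finset.card_range,
      Finset.sum_range_succ, nsmul_eq_mul]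

theorem sum_range_staircase_aux (N : ℤ) (m : ℕ) :
    2 * ∑ i ∈ Finset.range m, (-(N - i) * (N + i + 1) + i * (2 + 4 * (N - i))) =
      -2 * m * (N ^ 2 + N) - m * (m - 1) * (2 * m - 1) + (3 + 4 * N) * m * (m - 1) := by
  induction m with
  | zero => simp
  | succ m ih =>
    rw [Finset.sum_range_succ, mul_add, ih]
    push_cast
    ring

theorem sum_range_staircase_eq_zero (L : ℕ) :
    ∑ i ∈ Finset.range L, (-(((L : ℤ) - 1) - i) * (((L : ℤ) - 1) + i + 1) +
      i * (2 + 4 * (((L : ℤ) - 1) - i))) = 0 := by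
  have h := sum_range_staircase_aux ((L : ℤ) - 1) L
  have h2 : -2 * (L : ℤ) * (((L : ℤ) - 1) ^ 2 + ((L : ℤ) - 1)) - L * (L - 1) * (2 * L - 1) +
      (3 + 4 * ((L : ℤ) - 1)) * L * (L - 1) = 0 := by ring
  rw [h2] at h
  omega

variable {n : ℕ}

theorem kappa_eq_sum_range (ρ : n.Partition) :
    kappa ρ = ∑ i ∈ Finset.range n, (((diagram ρ).rowLen i : ℤ) ^ 2 - (diagram ρ).rowLen i -
      2 * i * (diagram ρ).rowLen i) := by
  have h1 : (n : ℤ) = ∑ i ∈ Finset.range n, ((diagram ρ).rowLen i : ℤ) := by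
    have := sum_rows (len_le ρ)
    rw [Finset.sum_range (fun i => ((diagram ρ).rowLen i : ℤ))]
    exact_mod_cast this.symm
  have h2 : ∑ i ∈ Finset.Icc 1 (len ρ), ((part ρ i : ℤ) ^ 2 - 2 * i * part ρ i) =
      ∑ i ∈ Finset.Icc 1 n, ((part ρ i : ℤ) ^ 2 - 2 * i * part ρ i) := by
    refine Finset.sum_subset (Finset.Icc_subset_Icc_right (len_le ρ)) fun i hi hi' => ?_
    rw [Finset.mem_Icc] at hi hi'
    have : part ρ i = 0 := rowLen_diagram_eq_zero (by omega)
    simp [this]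
  have h3 : ∑ i ∈ Finset.Icc 1 n, ((part ρ i : ℤ) ^ 2 - 2 * i * part ρ i) =
      ∑ i ∈ Finset.range n, (((diagram ρ).rowLen i : ℤ) ^ 2 -
        2 * (i + 1) * (diagram ρ).rowLen i) := by
    rw [← Finset.Ico_add_one_right_eq_Icc, Finset.range_eq_Ico]
    refine (Finset.sum_Ico_add' (fun i : ℕ => ((part ρ i : ℤ) ^ 2 - 2 * i * part ρ i))
      0 n 1).symm.trans (Finset.sum_congr rfl fun i _ => ?_)
    simp [part]
  rw [kappa, h2, h3]
  nth_rewrite 1 [h1]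
  rw [← Finset.sum_add_distrib]
  exact Finset.sum_congr rfl fun i _ => by ring

theorem sum_exponent_eq_kappa (ρ : n.Partition) :
    ∑ i ∈ Finset.range n, (shiftedRow (diagram ρ) n i : ℤ) * (shiftedRow (diagram ρ) n i - 1) +
      ∑ i ∈ Finset.range n, ∑ k ∈ Finset.Ico (i + 1) n, (2 + 4 * ((n - 1 - k : ℕ) : ℤ) -
        2 * (shiftedRow (diagram ρ) n i + shiftedRow (diagram ρ) n k)) = kappa ρ := by
  set b : ℕ → ℤ := fun i => (shiftedRow (diagram ρ) n i : ℤ)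
  have h1 : ∑ i ∈ Finset.range n, ∑ k ∈ Finset.Ico (i + 1) n, (2 + 4 * ((n - 1 - k : ℕ) : ℤ) -
        2 * (b i + b k)) = ∑ k ∈ Finset.range n, k * (2 + 4 * ((n - 1 - k : ℕ) : ℤ)) -
          2 * ((n - 1) * ∑ i ∈ Finset.range n, b i) := by
    rw [← sum_pairs_add, ← sum_pairs_right (fun k => 2 + 4 * ((n - 1 - k : ℕ) : ℤ)), Finset.mul_sum,
      ← Finset.sum_sub_distrib]
    refine Finset.sum_congr rfl fun i _ => ?_
    rw [Finset.mul_sum, ← Finset.sum_sub_distrib]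
  rw [h1, kappa_eq_sum_range, Finset.mul_sum, Finset.mul_sum, ← Finset.sum_sub_distrib,
    ← Finset.sum_add_distrib, ← sub_eq_zero, ← Finset.sum_sub_distrib,
    ← sum_range_staircase_eq_zero n]
  refine Finset.sum_congr rfl fun i hi => ?_
  rw [Finset.mem_range] at hi
  have h2 : ((n - 1 - i : ℕ) : ℤ) = n - 1 - i := by omega
  have h3 : (shiftedRow (diagram ρ) n i : ℤ) = (diagram ρ).rowLen i + (n - 1 - i) := by
    simp only [shiftedRow, Nat.cast_add, h2]
  simp only [b]
  rw [h2, h3]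
  ring

end PairSums

section Determinant

open Complex (I exp sin)

theorem prod_range_staircase {M : Type*} [CommMonoid M] (f : ℕ → M) {L i : ℕ} (hi : i < L) :
    ∏ s ∈ Finset.range (L - 1 - i), f s = ∏ k ∈ Finset.Ico (i + 1) L, f (L - 1 - k) := by
  rw [Finset.prod_Ico_eq_prod_range, show L - (i + 1) = L - 1 - i by omega,
    ← Finset.prod_range_reflect]
  refine Finset.prod_congr rfl fun k hk => ?_
  congr 1
  omega

/-- The Vandermonde determinant in decreasing order, with monic polynomial entries. -/
theorem det_prod_sub (L : ℕ) (x : ℕ → ℂ) (c : ℕ → ℂ) :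
    (Matrix.of fun i j : Fin L => ∏ s ∈ Finset.range (staircase L j), (x i - c s)).det =
      ∏ i ∈ Finset.range L, ∏ k ∈ Finset.Ico (i + 1) L, (x i - x k) := by
  have h1 := Matrix.det_eval_matrixOfPolynomials_eq_det_vandermonde (fun i : Fin L => x (Fin.rev i))
    (fun j => ∏ s ∈ Finset.range j, (Polynomial.X - Polynomial.C (c s)))
    (fun j => by simp [Polynomial.natDegree_prod_of_monic _ _ fun s _ => Polynomial.monic_X_sub_C (c s)])
    (fun j => Polynomial.monic_prod_of_monic _ _ fun s _ => Polynomial.monic_X_sub_C (c s))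
  have h2 : (Matrix.of fun i j : Fin L => ∏ s ∈ Finset.range (staircase L j), (x i - c s)).det =
      (Matrix.vandermonde fun i : Fin L => x (Fin.rev i)).det := by
    rw [h1, ← Matrix.det_submatrix_equiv_self Fin.revPerm]
    congr 1
    ext i j
    simp only [Matrix.submatrix_apply, Matrix.of_apply, Fin.revPerm_apply, Polynomial.eval_prod,
      Polynomial.eval_sub, Polynomial.eval_X, Polynomial.eval_C]
    congr 2
    simp [staircase, Fin.val_rev]
    omega
  rw [h2, Matrix.det_vandermonde]
  have h3 : ∀ i : Fin L, ∏ j ∈ Finset.Ioi i, (x (Fin.rev j) - x (Fin.rev i)) =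
      ∏ k ∈ Finset.range (Fin.rev i : ℕ), (x k - x (Fin.rev i)) := by
    intro i
    refine Finset.prod_bij (fun j _ => (Fin.rev j : ℕ)) ?_ ?_ ?_ ?_
    · intro j hj
      rw [Finset.mem_Ioi, Fin.lt_def] at hj
      rw [Finset.mem_range, Fin.val_rev, Fin.val_rev]
      omega
    · intro j _ j' _ h
      rw [Fin.val_rev, Fin.val_rev] at h
      exact Fin.ext (by omega)
    · intro k hk
      rw [Finset.mem_range, Fin.val_rev] at hk
      refine ⟨⟨L - 1 - k, by omega⟩, ?_, ?_⟩
      · rw [Finset.mem_Ioi, Fin.lt_def]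
        simp only
        omega
      · rw [Fin.val_rev]
        simp only
        omega
    · intro j _
      rfl
  simp only [h3]
  rw [← Equiv.prod_comp Fin.revPerm]
  simp only [Fin.revPerm_apply, Fin.rev_rev]
  rw [← Finset.prod_range (fun i => ∏ k ∈ Finset.range i, (x k - x i))]
  clear h1 h2 h3
  induction L with
  | zero => simp
  | succ L ih => rw [Finset.prod_range_succ, ih, prod_pairs_succ]

theorem exp_pow_sub_exp_pow (lam : ℂ) {a b : ℕ} (h : b ≤ a) :
    exp (-(I * lam)) ^ a - exp (-(I * lam)) ^ b =
      -I * exp (-(I * lam * (a + b) / 2)) * (2 * sin ((a - b : ℕ) * lam / 2)) := by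
  obtain ⟨k, rfl⟩ := Nat.exists_eq_add_of_le h
  have h1 := one_sub_exp_pow lam k
  have h2 : exp (-(I * lam)) ^ b * exp (-(I * (k * lam / 2))) =
      exp (-(I * lam * ((b + k : ℕ) + b) / 2)) := by
    rw [← Complex.exp_nat_mul, ← Complex.exp_add]
    congr 1
    push_cast
    ring
  rw [Nat.add_sub_cancel_left, pow_add, ← h2]
  linear_combination (-exp (-(I * lam)) ^ b) * h1

variable {lam : ℂ} {n : ℕ}

theorem detExpand_prod {L : ℕ} (h : ℕ → ℂ) (ρ : Fin L → ℕ) :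
    detExpand (fun α => ∏ i, h (α i)) ρ =
      (Matrix.of fun i j : Fin L => if staircase L j ≤ ρ i + staircase L i then
        h (ρ i + staircase L i - staircase L j) else 0).det := by
  rw [← Matrix.det_transpose, Matrix.det_apply', detExpand]
  refine Finset.sum_congr rfl fun w _ => ?_
  congr 1
  simp only [Matrix.transpose_apply, Matrix.of_apply]
  split_ifs with hw
  · exact Finset.prod_congr rfl fun i _ => by rw [if_pos (hw i)]; rfl
  · push Not at hw
    obtain ⟨i, hi⟩ := hw
    exact (Finset.prod_eq_zero (Finset.mem_univ i) (if_neg (by omega))).symm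

theorem detExpand_congr {L : ℕ} {S T : (Fin L → ℕ) → ℂ} {ρ : Fin L → ℕ}
    (h : ∀ α : Fin L → ℕ, ∑ i, α i = ∑ i, ρ i → S α = T α) : detExpand S ρ = detExpand T ρ := by
  refine Finset.sum_congr rfl fun w _ => ?_
  congr 1
  split_ifs with hw
  · refine h _ ?_
    have h1 : ∑ i, (ρ + staircase L - staircase L ∘ w) i + ∑ i, staircase L (w i) =
        ∑ i, ρ i + ∑ i, staircase L i := by
      rw [← Finset.sum_add_distrib, ← Finset.sum_add_distrib]
      exact Finset.sum_congr rfl fun i _ => Nat.sub_add_cancel (hw i)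
    rw [Equiv.sum_comp w (staircase L)] at h1
    exact Nat.add_right_cancel h1
  · rfl

theorem det_specComplete (hlam : ∀ k : ℕ, 1 ≤ k → sin (k * lam / 2) ≠ 0) (ρ : n.Partition) :
    (Matrix.of fun i j : Fin n => if staircase n j ≤ rows n ρ i + staircase n i then
        specComplete lam (rows n ρ i + staircase n i - staircase n j) else 0).det =
      exp (kappa ρ * I * lam / 4) /
        ∏ e ∈ (diagram ρ).cells, 2 * sin (hook (diagram ρ) e * lam / 2) := by
  set b : ℕ → ℕ := shiftedRow (diagram ρ) n
  set q := exp (-(I * lam)) with hq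
  set c : ℕ → ℂ := fun s => I * exp (I * lam * (1 / 2 + s))
  set g : ℕ → ℂ := fun v => 2 * sin (v * lam / 2)
  have hg : ∀ v, 1 ≤ v → g v ≠ 0 := fun v hv => mul_ne_zero two_ne_zero (hlam v hv)
  have h1 : (Matrix.of fun i j : Fin n => if staircase n j ≤ rows n ρ i + staircase n i then
        specComplete lam (rows n ρ i + staircase n i - staircase n j) else 0).det =
      (∏ i ∈ Finset.range n, specComplete lam (b i)) *
        ((∏ i ∈ Finset.range n, ∏ k ∈ Finset.Ico (i + 1) n, c (n - 1 - k)) *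
          ∏ i ∈ Finset.range n, ∏ k ∈ Finset.Ico (i + 1) n, (q ^ b i - q ^ b k)) := by
    rw [← det_prod_sub n (fun i => q ^ b i) (fun s => q ^ s)]
    have hc : ∏ i ∈ Finset.range n, ∏ k ∈ Finset.Ico (i + 1) n, c (n - 1 - k) =
        ∏ i : Fin n, ∏ s ∈ Finset.range (staircase n i), c s := by
      rw [Finset.prod_range]
      exact Finset.prod_congr rfl fun i _ => (prod_range_staircase c i.2).symm
    rw [hc, Finset.prod_range, ← Matrix.det_mul_row, ← Matrix.det_mul_column]
    congr 1
    ext i j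
    simp only [Matrix.of_apply]
    rw [← Finset.prod_mul_distrib]
    exact specComplete_sub hlam _ _
  have h2 : ∀ i ∈ Finset.range n, ∀ k ∈ Finset.Ico (i + 1) n,
      c (n - 1 - k) * (q ^ b i - q ^ b k) =
        exp (I * lam / 4 * ((2 + 4 * ((n - 1 - k : ℕ) : ℤ) - 2 * (b i + b k) : ℤ) : ℂ)) *
          g (b i - b k) := by
    intro i _ k hk
    obtain ⟨hk1, hk2⟩ := Finset.mem_Ico.mp hk
    rw [exp_pow_sub_exp_pow lam (shiftedRow_lt (Y := diagram ρ) (show i < k by omega) hk2).le]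
    have h3 : exp (I * lam / 4 * ((2 + 4 * ((n - 1 - k : ℕ) : ℤ) - 2 * (b i + b k) : ℤ) : ℂ)) =
        exp (I * lam * (1 / 2 + (n - 1 - k : ℕ))) * exp (-(I * lam * (b i + b k) / 2)) := by
      rw [← Complex.exp_add]
      congr 1
      push_cast
      ring
    rw [h3]
    linear_combination (-exp (I * lam * (1 / 2 + (n - 1 - k : ℕ))) *
      exp (-(I * lam * (b i + b k) / 2)) * g (b i - b k)) * Complex.I_mul_I
  have h4 : (∏ i ∈ Finset.range n, specComplete lam (b i)) =
      exp (I * lam / 4 * ((∑ i ∈ Finset.range n, (b i : ℤ) * (b i - 1) : ℤ) : ℂ)) /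
        ∏ i ∈ Finset.range n, ∏ v ∈ Finset.Icc 1 (b i), g v := by
    simp only [specComplete]
    rw [Finset.prod_div_distrib, ← Complex.exp_sum, Int.cast_sum, Finset.mul_sum]
    simp
    rfl
  have h5 : ∏ i ∈ Finset.range n, ∏ k ∈ Finset.Ico (i + 1) n,
      exp (I * lam / 4 * ((2 + 4 * ((n - 1 - k : ℕ) : ℤ) - 2 * (b i + b k) : ℤ) : ℂ)) =
      exp (I * lam / 4 * ((∑ i ∈ Finset.range n, ∑ k ∈ Finset.Ico (i + 1) n,
        (2 + 4 * ((n - 1 - k : ℕ) : ℤ) - 2 * (b i + b k)) : ℤ) : ℂ)) := by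
    simp only [Int.cast_sum, Finset.mul_sum, Complex.exp_sum]
  have h6 := prod_hook (fun i hi => rowLen_diagram_eq_zero ((len_le ρ).trans hi) :
    ∀ i, n ≤ i → (diagram ρ).rowLen i = 0) g
  have hD : ∏ i ∈ Finset.range n, ∏ k ∈ Finset.Ico (i + 1) n, g (b i - b k) ≠ 0 := by
    refine Finset.prod_ne_zero_iff.mpr fun i _ => Finset.prod_ne_zero_iff.mpr fun k hk => hg _ ?_
    obtain ⟨hk1, hk2⟩ := Finset.mem_Ico.mp hk
    have := shiftedRow_lt (Y := diagram ρ) (show i < k by omega) hk2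
    simp only [b]
    omega
  have h7 : (∏ i ∈ Finset.range n, ∏ k ∈ Finset.Ico (i + 1) n, c (n - 1 - k)) *
      ∏ i ∈ Finset.range n, ∏ k ∈ Finset.Ico (i + 1) n, (q ^ b i - q ^ b k) =
      (∏ i ∈ Finset.range n, ∏ k ∈ Finset.Ico (i + 1) n,
        exp (I * lam / 4 * ((2 + 4 * ((n - 1 - k : ℕ) : ℤ) - 2 * (b i + b k) : ℤ) : ℂ))) *
      ∏ i ∈ Finset.range n, ∏ k ∈ Finset.Ico (i + 1) n, g (b i - b k) := by
    simp only [← Finset.prod_mul_distrib]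
    exact Finset.prod_congr rfl fun i hi => Finset.prod_congr rfl (h2 i hi)
  rw [h1, h7, h4, h5, ← h6, mul_comm (∏ x ∈ _, _), div_mul_eq_mul_div, ← mul_assoc, mul_comm _
    (∏ i ∈ Finset.range n, ∏ k ∈ Finset.Ico (i + 1) n, g (b i - b k)), mul_div_mul_left _ _ hD,
    ← Complex.exp_add, ← mul_add, ← Int.cast_add, sum_exponent_eq_kappa]
  congr 2
  ring

/-- The specialization of the Schur function of `ρ`. -/
theorem sum_specPower_mul_frob (hlam : ∀ k : ℕ, 1 ≤ k → sin (k * lam / 2) ≠ 0)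
    (ρ : n.Partition) :
    ∑ θ : n.Partition, (θ.parts.map (specPower lam)).prod * frob ρ θ / zee θ =
      exp (kappa ρ * I * lam / 4) /
        ∏ e ∈ (diagram ρ).cells, 2 * sin (hook (diagram ρ) e * lam / 2) := by
  rw [← det_specComplete hlam, ← detExpand_prod]
  simp only [frob]
  rw [sum_mul_frobChar]
  refine detExpand_congr fun α hα => ?_
  rw [sum_rows (len_le ρ)] at hα
  have h := sum_permChar_smul (specPower lam) n α
  rw [if_pos hα] at h
  simp only [cycleIndex_specPower hlam] at h
  rw [← h]
  refine Finset.sum_congr rfl fun η _ => ?_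
  rw [cycleWeight, smul_eq_mul, smul_eq_mul, zee_eq]
  ring

theorem sum_hook_mul_chi (hlam : ∀ k : ℕ, 1 ≤ k → sin (k * lam / 2) ≠ 0) (η : n.Partition) :
    ∑ ρ : n.Partition, exp (kappa ρ * I * lam / 4) /
        (∏ e ∈ (diagram ρ).cells, 2 * sin (hook (diagram ρ) e * lam / 2)) * (chi ρ η / zee η) =
      cycleWeight (specPower lam) η.parts := by
  rw [cycleWeight, smul_eq_mul, eq_sum_frob (fun θ => (θ.parts.map (specPower lam)).prod) η,
    Finset.mul_sum]
  refine Finset.sum_congr rfl fun ρ _ => ?_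
  rw [sum_specPower_mul_frob hlam, chi_eq_frob, zee_eq]
  ring

theorem hookSeries_eq (hlam : ∀ k : ℕ, 1 ≤ k → sin (k * lam / 2) ≠ 0) :
    hookSeries lam = partitionSeries fun μ => cycleWeight (specPower lam) μ.2.parts := by
  rw [hookSeries]
  congr 1
  funext μ
  exact sum_hook_mul_chi hlam μ.2

theorem Rbullet_zero (hlam : ∀ k : ℕ, 1 ≤ k → sin (k * lam / 2) ≠ 0) :
    Rbullet lam 0 = hookSeries lam := by
  rw [Rbullet, hookSeries]
  congr 1
  funext μ
  refine Finset.sum_congr rfl fun ν _ => ?_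
  rw [V_eq hlam, Finset.prod_mul_distrib, Finset.prod_const, card_cells_diagram,
    show I * (0 + 1 / 2) * kappa ν * lam / 2 = kappa ν * I * lam / 4 by ring]
  ring

end Determinant

/-! ### The formal logarithm -/

section FormalLog

open MvPowerSeries (coeff constantCoeff pderiv)

/-- All coefficients of total degree less than `N` vanish. -/
def VanishBelow (N : ℕ) (f : MvPowerSeries ℕ+ ℂ) : Prop := ∀ m, m.degree < N → coeff m f = 0

theorem vanishBelow_pow {u : MvPowerSeries ℕ+ ℂ} (hu : constantCoeff u = 0) (N : ℕ) :
    VanishBelow N (u ^ N) := fun _ hm => MvPowerSeries.coeff_of_lt_order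
  (lt_of_lt_of_le (by exact_mod_cast hm) (MvPowerSeries.le_order_pow_of_constantCoeff_eq_zero N hu))

theorem VanishBelow.mul_left {N : ℕ} {f : MvPowerSeries ℕ+ ℂ} (hf : VanishBelow N f)
    (g : MvPowerSeries ℕ+ ℂ) : VanishBelow N (g * f) := by
  classical
  intro m hm
  rw [MvPowerSeries.coeff_mul]
  refine Finset.sum_eq_zero fun x hx => ?_
  rw [hf x.2, mul_zero]
  have h := congrArg Finsupp.degree (Finset.HasAntidiagonal.mem_antidiagonal.mp hx)
  rw [map_add] at h
  omega

theorem VanishBelow.pderiv {N : ℕ} {f : MvPowerSeries ℕ+ ℂ} (hf : VanishBelow (N + 1) f) (d : ℕ+) :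
    VanishBelow N (MvPowerSeries.pderiv ℂ d f) := by
  intro m hm
  rw [MvPowerSeries.coeff_pderiv, hf, zero_mul]
  rw [map_add, Finsupp.degree_single]
  omega

theorem coeff_formalLog {f : MvPowerSeries ℕ+ ℂ} (hf : constantCoeff f = 1) {m : ℕ+ →₀ ℕ} {N : ℕ}
    (hN : m.degree < N) :
    coeff m (formalLog f) = ∑ k ∈ Finset.range N, (-1) ^ (k + 1) / (k : ℂ) * coeff m ((f - 1) ^ k) := by
  have hu : constantCoeff (f - 1) = 0 := by rw [map_sub, hf, map_one, sub_self]
  rw [formalLog, PowerSeries.coeff_subst (PowerSeries.HasSubst.of_constantCoeff_zero hu)]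
  rw [finsum_eq_sum_of_support_subset (s := Finset.range N)]
  · refine Finset.sum_congr rfl fun k _ => ?_
    rw [PowerSeries.coeff_log, smul_eq_mul]
    split_ifs with hk
    · simp [hk]
    · simp
  · intro k hk
    by_contra hk'
    rw [Finset.coe_range, Set.mem_Iio, not_lt] at hk'
    apply hk
    simp only
    rw [vanishBelow_pow hu k m (by omega), smul_zero]

theorem vanishBelow_formalLog_sub {f : MvPowerSeries ℕ+ ℂ} (hf : constantCoeff f = 1) (N : ℕ) :
    VanishBelow N (formalLog f -
      ∑ k ∈ Finset.range N, MvPowerSeries.C ((-1) ^ (k + 1) / (k : ℂ)) * (f - 1) ^ k) := by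
  intro m hm
  rw [map_sub, coeff_formalLog hf hm, map_sum]
  simp only [MvPowerSeries.coeff_C_mul]
  exact sub_self _

theorem mul_pderiv_logSum (f : MvPowerSeries ℕ+ ℂ) (d : ℕ+) (N : ℕ) :
    f * pderiv ℂ d (∑ k ∈ Finset.range (N + 1),
        MvPowerSeries.C ((-1) ^ (k + 1) / (k : ℂ)) * (f - 1) ^ k) =
      pderiv ℂ d f - (1 - f) ^ N * pderiv ℂ d f := by
  have h : ∀ k, pderiv ℂ d (MvPowerSeries.C ((-1) ^ (k + 1 + 1) / ((k + 1 : ℕ) : ℂ)) *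
      (f - 1) ^ (k + 1)) = (1 - f) ^ k * pderiv ℂ d f := by
    intro k
    have h1 : (((k + 1 : ℕ) : ℂ)) ≠ 0 := by exact_mod_cast Nat.succ_ne_zero k
    have h2 : ((k + 1 : ℕ) : MvPowerSeries ℕ+ ℂ) = MvPowerSeries.C ((k + 1 : ℕ) : ℂ) :=
      (map_natCast MvPowerSeries.C _).symm
    rw [Derivation.leibniz, MvPowerSeries.pderiv_C, smul_zero, add_zero, smul_eq_mul,
      MvPowerSeries.pderiv_pow, map_sub, MvPowerSeries.pderiv_one, sub_zero, Nat.add_sub_cancel, h2,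
      ← mul_assoc, ← mul_assoc, ← map_mul, div_mul_cancel₀ _ h1, pow_add, pow_add, mul_assoc ((-1) ^ k)]
    rw [show (1 - f) = (-1) * (f - 1) by ring, mul_pow]
    simp
  rw [map_sum, Finset.sum_range_succ']
  simp only [h]
  have h0 : pderiv ℂ d (MvPowerSeries.C ((-1) ^ (0 + 1) / ((0 : ℕ) : ℂ)) * (f - 1) ^ 0) = 0 := by
    simp
  rw [h0, add_zero, ← Finset.sum_mul, ← mul_assoc]
  have h3 := mul_neg_geom_sum (1 - f) N
  rw [sub_sub_cancel] at h3
  rw [h3, sub_mul, one_mul]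

theorem mul_pderiv_formalLog {f : MvPowerSeries ℕ+ ℂ} (hf : constantCoeff f = 1) (d : ℕ+) :
    f * pderiv ℂ d (formalLog f) = pderiv ℂ d f := by
  have hu : constantCoeff (1 - f) = 0 := by rw [map_sub, hf, map_one, sub_self]
  ext m
  set N := m.degree + 1
  have h1 := ((vanishBelow_formalLog_sub hf (N + 1)).pderiv d).mul_left f m (Nat.lt_succ_self _)
  have h2 := (vanishBelow_pow hu N).mul_left (pderiv ℂ d f) m (Nat.lt_succ_self _)
  rw [map_sub, mul_sub, mul_pderiv_logSum, map_sub, map_sub, mul_comm ((1 - f) ^ N), h2, sub_zero,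
    sub_eq_zero] at h1
  exact h1

theorem constantCoeff_formalLog {f : MvPowerSeries ℕ+ ℂ} (hf : constantCoeff f = 1) :
    constantCoeff (formalLog f) = 0 := by
  rw [← MvPowerSeries.coeff_zero_eq_constantCoeff_apply,
    coeff_formalLog hf (N := 1) (by simp)]
  simp

theorem formalLog_eq_of_pderiv {f g : MvPowerSeries ℕ+ ℂ} (hf : constantCoeff f = 1)
    (hg : constantCoeff g = 0) (h : ∀ d, pderiv ℂ d f = pderiv ℂ d g * f) : formalLog f = g := by
  have hf0 : f ≠ 0 := by
    rintro rfl
    simp at hf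
  refine MvPowerSeries.pderiv.ext (fun d => mul_left_cancel₀ hf0 ?_)
    (by rw [constantCoeff_formalLog hf, hg])
  rw [mul_pderiv_formalLog hf, h, mul_comm]

/-- The series `∑ c_d X_d`. -/
def linearSeries (c : ℕ+ → ℂ) : MvPowerSeries ℕ+ ℂ := fun m =>
  ∑ d ∈ m.support, coeff m (MvPowerSeries.C (c d) * MvPowerSeries.X d)

theorem coeff_C_mul_X [DecidableEq (ℕ+ →₀ ℕ)] (a : ℂ) (d : ℕ+) (m : ℕ+ →₀ ℕ) :
    coeff m (MvPowerSeries.C a * MvPowerSeries.X d) = if m = Finsupp.single d 1 then a else 0 := by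
  classical
  rw [MvPowerSeries.coeff_C_mul, MvPowerSeries.coeff_X, mul_ite, mul_one, mul_zero]
  congr

theorem hasSum_linearSeries (c : ℕ+ → ℂ) :
    HasSum (fun d => MvPowerSeries.C (c d) * MvPowerSeries.X d) (linearSeries c) := by
  classical
  rw [MvPowerSeries.WithPiTopology.hasSum_iff_hasSum_coeff]
  intro m
  refine hasSum_sum_of_ne_finset_zero fun d hd => ?_
  rw [coeff_C_mul_X, if_neg]
  rintro rfl
  exact hd (by simp)

theorem pderiv_linearSeries (c : ℕ+ → ℂ) (d : ℕ+) :
    pderiv ℂ d (linearSeries c) = MvPowerSeries.C (c d) := by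
  classical
  ext m
  rw [MvPowerSeries.coeff_pderiv, MvPowerSeries.coeff_C]
  have h : coeff (m + Finsupp.single d 1) (linearSeries c) = if m = 0 then c d else 0 := by
    change ∑ e ∈ _, _ = _
    rw [Finset.sum_eq_single d]
    · rw [coeff_C_mul_X]
      simp
    · intro e _ he
      rw [coeff_C_mul_X, if_neg]
      intro h1
      have h2 := DFunLike.congr_fun h1 d
      rw [Finsupp.single_eq_of_ne (Ne.symm he)] at h2
      simp at h2
    · intro hd
      simp at hd
  rw [h]
  split_ifs with h0
  · simp [h0]
  · rw [zero_mul]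

theorem parts_ofExponent_add_single (m : ℕ+ →₀ ℕ) (d : ℕ+) :
    (ofExponent (m + Finsupp.single d 1)).2.parts = (d : ℕ) ::ₘ (ofExponent m).2.parts := by
  rw [parts_ofExponent, parts_ofExponent, map_add, Finsupp.toMultiset_single, one_smul,
    Multiset.map_add, Multiset.map_singleton, add_comm, Multiset.singleton_add]

theorem count_parts_ofExponent (m : ℕ+ →₀ ℕ) (d : ℕ+) :
    (ofExponent m).2.parts.count (d : ℕ) = m d := by
  rw [parts_ofExponent, Multiset.count_map_eq_count' _ _ PNat.coe_injective,
    Finsupp.count_toMultiset]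

theorem pderiv_partitionSeries_cycleWeight (v : ℕ → ℂ) (d : ℕ+) :
    pderiv ℂ d (partitionSeries fun μ => cycleWeight v μ.2.parts) =
      MvPowerSeries.C (v d / d) * partitionSeries fun μ => cycleWeight v μ.2.parts := by
  ext m
  rw [MvPowerSeries.coeff_pderiv, MvPowerSeries.coeff_C_mul, coeff_partitionSeries,
    coeff_partitionSeries, parts_ofExponent_add_single]
  have h := cycleWeight_cons v d.ne_zero (ofExponent m).2.parts
  have hd : ((d : ℕ) : ℂ) ≠ 0 := by exact_mod_cast d.ne_zero
  rw [count_parts_ofExponent, smul_eq_mul] at h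
  push_cast at h
  field_simp
  linear_combination h

theorem constantCoeff_partitionSeries_cycleWeight (v : ℕ → ℂ) :
    constantCoeff (partitionSeries fun μ => cycleWeight v μ.2.parts) = 1 := by
  rw [← MvPowerSeries.coeff_zero_eq_constantCoeff_apply, coeff_partitionSeries, parts_ofExponent]
  simp [cycleWeight, centralizerOrder]

theorem hasSum_formalLog_cycleWeight (v : ℕ → ℂ) :
    HasSum (fun d : ℕ+ => MvPowerSeries.C (v d / d) * (MvPowerSeries.X d : MvPowerSeries ℕ+ ℂ))
      (formalLog (partitionSeries fun μ => cycleWeight v μ.2.parts)) := by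
  rw [formalLog_eq_of_pderiv (g := linearSeries fun d => v d / d)
    (constantCoeff_partitionSeries_cycleWeight v) ?_ fun d => ?_]
  · exact hasSum_linearSeries _
  · rw [← MvPowerSeries.coeff_zero_eq_constantCoeff_apply]
    rfl
  · rw [pderiv_linearSeries, pderiv_partitionSeries_cycleWeight]

end FormalLog

section Splittings

open MvPowerSeries (coeff constantCoeff)

/-- The exponent of the monomial `p_μ`. -/
def exponent (μ : Ptn) : ℕ+ →₀ ℕ := Multiset.toFinsupp (μ.2.parts.map Nat.toPNat')

theorem ofExponent_exponent (μ : Ptn) : ofExponent (exponent μ) = μ :=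
  ((eq_exponent_iff _ μ).mp rfl).symm

theorem exponent_ofExponent (m : ℕ+ →₀ ℕ) : exponent (ofExponent m) = m :=
  ((eq_exponent_iff m _).mpr rfl).symm

theorem exponent_eq_zero_iff (μ : Ptn) : exponent μ = 0 ↔ μ.1 = 0 := by
  rw [exponent, map_eq_zero_iff _ (Multiset.toFinsupp.injective), Multiset.map_eq_zero]
  constructor
  · intro h
    rw [← μ.2.parts_sum, h, Multiset.sum_zero]
  · intro h
    have h1 := μ.2.parts_sum.trans h
    rw [Multiset.sum_eq_zero_iff] at h1
    exact Multiset.eq_zero_of_forall_notMem fun x hx => (μ.2.parts_pos hx).ne' (h1 x hx)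

theorem sum_exponent_eq_iff {n : ℕ} (t : Fin n → Ptn) (μ : Ptn) :
    ∑ i, exponent (t i) = exponent μ ↔ ∑ i, (t i).2.parts = μ.2.parts := by
  have h : ∑ i, exponent (t i) = Multiset.toFinsupp ((∑ i, (t i).2.parts).map Nat.toPNat') := by
    rw [← Multiset.coe_mapAddMonoidHom, map_sum, map_sum]
    rfl
  constructor
  · intro h1
    rw [h, exponent, EmbeddingLike.apply_eq_iff_eq] at h1
    have h2 := congrArg (Multiset.map ((↑) : ℕ+ → ℕ)) h1
    rw [Multiset.map_map, Multiset.map_map] at h2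
    have h3 : ∀ s : Multiset ℕ, (∀ x ∈ s, 0 < x) →
        s.map (((↑) : ℕ+ → ℕ) ∘ Nat.toPNat') = s := by
      intro s hs
      conv_rhs => rw [← Multiset.map_id s]
      refine Multiset.map_congr rfl fun x hx => ?_
      simp [hs x hx]
    rwa [h3, h3] at h2
    · exact fun x hx => μ.2.parts_pos hx
    · intro x hx
      obtain ⟨i, -, hi⟩ := Multiset.mem_sum.mp hx
      exact (t i).2.parts_pos hi
  · intro h1
    rw [h, h1]
    rfl

theorem partitionSeries_sub_one_pow {a : Ptn → ℂ} (ha : constantCoeff (partitionSeries a) = 1)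
    (n : ℕ) : (partitionSeries a - 1) ^ n =
      partitionSeries fun μ => ∑ᶠ t ∈ splittings n μ, ∏ i, a (t i) := by
  classical
  ext m
  have hc : ∀ μ : Ptn, coeff (exponent μ) (partitionSeries a - 1) = if μ.1 = 0 then 0 else a μ := by
    intro μ
    rw [map_sub, MvPowerSeries.coeff_one, coeff_partitionSeries, ofExponent_exponent]
    simp only [exponent_eq_zero_iff]
    split_ifs with h
    · rw [← MvPowerSeries.coeff_zero_eq_constantCoeff_apply, coeff_partitionSeries,
        ← (exponent_eq_zero_iff μ).mpr h, ofExponent_exponent] at ha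
      rw [ha, sub_self]
    · rw [sub_zero]
  have hpow : (partitionSeries a - 1) ^ n = ∏ _i : Fin n, (partitionSeries a - 1) := by simp
  rw [coeff_partitionSeries, finsum_mem_eq_finite_toFinset_sum _ (splittings_finite n _), hpow,
    MvPowerSeries.coeff_prod]
  symm
  refine Finset.sum_of_injOn
    (fun t => Finsupp.equivFunOnFinite.symm fun i => exponent (t i)) ?_ ?_ ?_ ?_
  · intro s _ t _ h
    funext i
    have := DFunLike.congr_fun h i
    rw [← ofExponent_exponent (s i), ← ofExponent_exponent (t i)]
    exact congrArg ofExponent this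
  · intro t ht
    have ht := (Set.Finite.mem_toFinset _).mp ht
    rw [Finset.mem_coe, Finset.mem_finsuppAntidiag]
    refine ⟨?_, Finset.subset_univ _⟩
    have := (sum_exponent_eq_iff t _).mpr ht.2
    rw [exponent_ofExponent] at this
    exact this
  · intro l hl hl'
    rw [Finset.mem_finsuppAntidiag] at hl
    by_contra h0
    apply hl'
    refine ⟨fun i => ofExponent (l i), ?_, ?_⟩
    · rw [Finset.mem_coe, Set.Finite.mem_toFinset]
      refine ⟨fun i => ?_, ?_⟩
      · by_contra hi
        apply h0
        refine Finset.prod_eq_zero (Finset.mem_univ i) ?_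
        rw [← exponent_ofExponent (l i), hc, if_pos (Nat.eq_zero_of_not_pos hi)]
      · rw [← sum_exponent_eq_iff]
        simp only [exponent_ofExponent]
        exact hl.1
    · ext1 i
      exact exponent_ofExponent (l i)
  · intro t ht
    have ht := (Set.Finite.mem_toFinset _).mp ht
    refine Finset.prod_congr rfl fun i _ => ?_
    change _ = coeff (exponent (t i)) _
    rw [hc, if_neg (ht.1 i).ne']

theorem R_eq_formalLog {lam τ : ℂ} (h : constantCoeff (Rbullet lam τ) = 1) :
    R lam τ = formalLog (Rbullet lam τ) := by
  refine HasSum.tsum_eq ?_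
  rw [MvPowerSeries.WithPiTopology.hasSum_iff_hasSum_coeff]
  intro m
  have hu : constantCoeff (Rbullet lam τ - 1) = 0 := by rw [map_sub, h, map_one, sub_self]
  set F : ℕ → ℂ := fun k => (-1) ^ (k + 1 + 1) / ((k + 1 : ℕ) : ℂ) *
    coeff m ((Rbullet lam τ - 1) ^ (k + 1)) with hF
  have h1 : (fun n : ℕ+ => coeff m (Rterm lam τ n)) = F ∘ Equiv.pnatEquivNat := by
    funext n
    have h2 : ((n : ℕ) - 1) + 1 = n := Nat.sub_add_cancel n.pos
    have h3 : F (Equiv.pnatEquivNat n) = (-1) ^ ((n : ℕ) - 1) / (n : ℂ) *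
        coeff m ((Rbullet lam τ - 1) ^ (n : ℕ)) := by
      change (-1) ^ ((n : ℕ) - 1 + 1 + 1) / (((n : ℕ) - 1 + 1 : ℕ) : ℂ) *
        coeff m ((Rbullet lam τ - 1) ^ ((n : ℕ) - 1 + 1)) = _
      rw [pow_succ (-1 : ℂ) ((n : ℕ) - 1 + 1), pow_succ (-1 : ℂ) ((n : ℕ) - 1), h2]
      simp
    rw [Function.comp_apply, h3, Rterm, MvPowerSeries.coeff_C_mul, Rbullet,
      partitionSeries_sub_one_pow h]
  have h4 : coeff m (formalLog (Rbullet lam τ)) = ∑ k ∈ Finset.range (m.degree + 1), F k := by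
    rw [coeff_formalLog h (N := m.degree + 1 + 1) (by omega), Finset.sum_range_succ', Nat.cast_zero,
      div_zero, zero_mul, add_zero]
  rw [h1, h4, Equiv.hasSum_iff]
  refine hasSum_sum_of_ne_finset_zero fun k hk => ?_
  rw [Finset.mem_range, not_lt] at hk
  rw [hF]
  simp only
  rw [vanishBelow_pow hu (k + 1) m (by omega), mul_zero]

end Splittings

end MarinoVafa

end

theorem mainTheorem4 (lam : ℂ)
    (hlam : ∀ k : ℕ, 1 ≤ k → Complex.sin (k * lam / 2) ≠ 0) :
    (MvPowerSeries.constantCoeff (MarinoVafa.hookSeries lam) = 1 ∧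
      HasSum (fun d : ℕ+ =>
          -(MvPowerSeries.C
              (Complex.I ^ ((d : ℕ) + 1) / (2 * (d : ℂ) * Complex.sin ((d : ℂ) * lam / 2))) *
            (MvPowerSeries.X d : MvPowerSeries ℕ+ ℂ)))
        (MarinoVafa.formalLog (MarinoVafa.hookSeries lam))) ∧
    (∀ (n : ℕ) (μ : n.Partition),
      MarinoVafa.V μ lam =
        1 / (2 ^ n * ∏ x ∈ (MarinoVafa.diagram μ).cells,
          Complex.sin (MarinoVafa.hook (MarinoVafa.diagram μ) x * lam / 2))) ∧
    (MvPowerSeries.constantCoeff (MarinoVafa.Rbullet lam 0) = 1 ∧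
      MarinoVafa.R lam 0 = MarinoVafa.formalLog (MarinoVafa.Rbullet lam 0) ∧
      HasSum (fun d : ℕ+ =>
          -(MvPowerSeries.C
              (Complex.I ^ ((d : ℕ) + 1) / (2 * (d : ℂ) * Complex.sin ((d : ℂ) * lam / 2))) *
            (MvPowerSeries.X d : MvPowerSeries ℕ+ ℂ)))
        (MarinoVafa.R lam 0)) := by
  have hc : MvPowerSeries.constantCoeff (MarinoVafa.hookSeries lam) = 1 := by
    rw [MarinoVafa.hookSeries_eq hlam]
    exact MarinoVafa.constantCoeff_partitionSeries_cycleWeight _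
  have hR : MvPowerSeries.constantCoeff (MarinoVafa.Rbullet lam 0) = 1 := by
    rw [MarinoVafa.Rbullet_zero hlam, hc]
  have hs : HasSum (fun d : ℕ+ =>
      -(MvPowerSeries.C
          (Complex.I ^ ((d : ℕ) + 1) / (2 * (d : ℂ) * Complex.sin ((d : ℂ) * lam / 2))) *
        (MvPowerSeries.X d : MvPowerSeries ℕ+ ℂ)))
      (MarinoVafa.formalLog (MarinoVafa.hookSeries lam)) := by
    rw [MarinoVafa.hookSeries_eq hlam]
    convert! MarinoVafa.hasSum_formalLog_cycleWeight (MarinoVafa.specPower lam) using 2 with d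
    rw [← neg_mul, ← map_neg, MarinoVafa.specPower, neg_div, div_div, mul_right_comm]
  refine ⟨⟨hc, hs⟩, fun n μ => MarinoVafa.V_eq hlam μ, hR, MarinoVafa.R_eq_formalLog hR, ?_⟩
  rw [MarinoVafa.R_eq_formalLog hR, MarinoVafa.Rbullet_zero hlam]
  exact hs
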